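/- Setting. Let $(X,\mathscr B,\mu)$ be a $\sigma$-finite measure space with $\mu(X)=+\infty$ and let $T:X\to X$ be measurable with $T_\#\mu=\mu$. For a measurable map $S$ (non-singular for $\mu$), $\widehat S:L^1(\mu)\to L^1(\mu)$ is its transfer operator, $\int (\widehat S f)\, g\,d\mu=\int f\,(g\circ S)\,d\mu$ for $g\in L^\infty(\mu)$. Put $L^1_+(\mu)=\{u\in L^1(\mu): u\ge 0,\ \int u\,d\mu>0\}$. Assume that $(X,\mathscr B,\mu,T)$ is a conservative ergodic measure preserving transformation, i.e. $\sum_{k\ge0}\widehat T^k u=+\infty$ $\mu$-a.e. for all $u\in L^1_+(\mu)$, and that it is pointwise dual ergodic, i.e. there is a sequence $(c_n)$ in $[0,\infty)$ with $\frac1{c_n}\sum_{k=0}^{n-1}\widehat T^k u\to\int u\,d\mu$ $\mu$-a.e. for all $u\in L^1(\mu)$. For $A\in\mathscr B$ let $r_A^{(1)}<r_A^{(2)}<\dots$ be the successive times $n\ge1$ with $T^nx\in A$ ($+\infty$ if there is none), $r_A=r_A^{(1)}$, $T_A=T^{r_A}$, and, if $0<\mu(A)<\infty$, $\mu_A=\mu(\cdot\cap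 A)/\mu(A)$. Let $\alpha\in(0,1]$ and let $(a_n)_{n\ge0}$ be a sequence in $[0,\infty)$; write $a(s)=a_{\lfloor s\rfloor}$. Let $b:[0,\infty)\to[0,\infty)$ be an asymptotic inverse of $a$, i.e. $a(b(s))\sim s$ and $b(a(s))\sim s$ as $s\to\infty$, and put $\gamma(s)=1/b(1/s)$. Let $(B_n)_{n\ge0}$ be measurable sets with $\mu(B_n)>0$ and $\mu(B_n)\to0$. Suppose that they satisfy the following conditions $(A)_\alpha$ with some $\theta\in(0,1]$ (set equalities are modulo $\mu$-null sets). (A0) $(a_n)$ is regularly varying of index $\alpha$, i.e. $a(xy)/a(x)\to y^\alpha$ as $x\to\infty$ for all $y>0$, and there is a uniform set $Y\in\mathscr B$ with normalizing sequence $(a_n)$ such that $B_n\subset Y$ for all $n$; uniform means that $\mu(Y)>0$ and that for some $f\in L^1_+(\mu)$ one has $\frac1{a_n}\sum_{k=0}^{n-1}\widehat T^k f\to\int f\,d\mu$ in $L^\infty(Y,\mu|_Y)$. (A1) For every $n\ge1$, $B_n=U(B_n)\sqcup Q(B_n)$ with measurable $U(B_n),Q(B_n)$, and $\mu(Q(B_n))/\mu(B_n)\to\theta$.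 (A2) There are measurable $\tau_n:B_n\to\{0,1,2,\dots\}$ and a compact $\mathcal U\subset L^1(\mu)$ with $\widehat{T^{\tau_n}}\big(\mathbf 1_{Q(B_n)}/\mu(Q(B_n))\big)\in\mathcal U$ for all $n\ge1$. (A3) $\gamma(\mu(B_n))\,\tau_n\Rightarrow 0$ in law under $\mu_{B_n}$. (A4) $\mu_{Q(B_n)}(r_{B_n}<\tau_n)\to0$. Moreover, along the $n$ for which $\mu(U(B_n))>0$: (A5) $\mu_{U(B_n)}(r_{B_n}>\tau_n)\to0$; (A6) $\Big\|\widehat{T_{B_n}}\Big(\frac{\mathbf 1_{U(B_n)}}{\mu(U(B_n))}\Big)-\frac{\mathbf 1_{B_n}}{\mu(B_n)}\Big\|_{L^\infty(\mu_{B_n})}\to0$, where $\widehat{T_{B_n}}$ is the transfer operator of $T_{B_n}$ on $(B_n,\mu_{B_n})$. Limit processes. For $\lambda>0$, $H_\alpha(\lambda)$ denotes the law on $[0,\infty)$ with Laplace transform $s\mapsto\lambda/(\lambda+s^\alpha)$, $s\ge0$ (it exists and is unique), $W_{\alpha,\theta}(\lambda)$ the law $(1-\theta)\delta_0+\theta H_\alpha(\lambda)$,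 and $\mathrm{Geo}(\theta)$ the law on $\{1,2,\dots\}$ giving mass $\theta(1-\theta)^{k-1}$ to $k$. For a law $W$ on $[0,\infty)$ other than $\delta_0$, $\mathrm{RPP}(W)$ is the law of $\sum_{i\ge1}\delta_{W_1+\dots+W_i}$ with $W_1,W_2,\dots$ i.i.d. of law $W$; $\mathrm{FPP}_\alpha(\lambda)=\mathrm{RPP}(H_\alpha(\lambda))$; and $\mathrm{CFPP}_\alpha(\lambda,\pi)$ is the law of $\sum_{i\ge1}X_i\,\delta_{W_1+\dots+W_i}$ where the $W_i$ are i.i.d. of law $H_\alpha(\lambda)$ and the $X_i$ are i.i.d. of law $\pi$, independent of the $W_i$. Theorem. Let $N_n=\sum_{k\ge1}\delta_{\gamma(\mu(B_n))\,r_{B_n}^{(k)}}$, a random Radon atomic measure on $[0,\infty)$; the space of such measures carries the vague topology and its Borel $\sigma$-algebra, and convergence in law is weak convergence of laws on this space. Then, as $n\to\infty$, 1. (hitting process) $N_n$ converges in law to $\mathrm{CFPP}_\alpha(\theta\,\Gamma(1+\alpha),\mathrm{Geo}(\theta))$ under every probability measure $\nu\ll\mu$; 2. (return process) $N_n$, considered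 under $\mu_{B_n}$, converges in law to $\mathrm{RPP}(W_{\alpha,\theta}(\theta\,\Gamma(1+\alpha)))$. In particular, if $\theta=1$, both limits are $\mathrm{FPP}_\alpha(\Gamma(1+\alpha))$. -/

import Mathlib

open MeasureTheory ProbabilityTheory Filter Topology Set
open scoped NNReal ENNReal BoundedContinuousFunction CompactlySupported

namespace RareEvents

noncomputable section

/-! ### Transfer operators and infinite ergodic theory -/

section Dynamics

variable {X : Type*} [MeasurableSpace X]

/-- The transfer operator `Ŝ` of a map `S` with respect to `μ`, acting on (representatives of)
functions `f ∈ L¹(μ)`: the density with respect to `μ` of the image under `S` of the signed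
measure `f dμ`, computed on the positive and negative parts of `f` separately.
See `transferOp_duality` for the identity `∫ f · (g ∘ S) dμ = ∫ (Ŝ f) · g dμ`. -/
def transferOp (μ : Measure X) (S : X → X) (f : X → ℝ) : X → ℝ := fun x =>
  (((μ.withDensity fun y => ENNReal.ofReal (f y)).map S).rnDeriv μ x).toReal
    - (((μ.withDensity fun y => ENNReal.ofReal (-f y)).map S).rnDeriv μ x).toReal

theorem transferOp_duality_pos (μ : Measure X) [SigmaFinite μ] {S : X → X}
    (hS : Measure.QuasiMeasurePreserving S μ μ) {f : X → ℝ} (hf : Integrable f μ)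
    {g : X → ℝ} (hg : Measurable g) {C : ℝ} (hC : ∀ x, |g x| ≤ C) :
    Integrable (fun x =>
      (((μ.withDensity fun y => ENNReal.ofReal (f y)).map S).rnDeriv μ x).toReal) μ ∧
    Integrable (fun x =>
      (((μ.withDensity fun y => ENNReal.ofReal (f y)).map S).rnDeriv μ x).toReal * g x) μ ∧
    Integrable (fun x => max (f x) 0 * g (S x)) μ ∧
    ∫ x, max (f x) 0 * g (S x) ∂μ
      = ∫ x, (((μ.withDensity fun y => ENNReal.ofReal (f y)).map S).rnDeriv μ x).toReal
          * g x ∂μ := by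
  set ρ := μ.withDensity fun y => ENNReal.ofReal (f y) with hρ
  have hfm : AEMeasurable (fun y => ENNReal.ofReal (f y)) μ :=
    hf.aestronglyMeasurable.aemeasurable.ennreal_ofReal
  have : IsFiniteMeasure ρ := isFiniteMeasure_withDensity_ofReal hf.2
  have : IsFiniteMeasure (ρ.map S) := by infer_instance
  have hac : ρ.map S ≪ μ :=
    ((withDensity_absolutelyContinuous μ _).map hS.measurable).trans hS.absolutelyContinuous
  have hgi : Integrable g (ρ.map S) :=
    Integrable.of_bound hg.aestronglyMeasurable C (ae_of_all _ fun x => by simpa using hC x)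
  have h1 : Integrable (fun x => ((ρ.map S).rnDeriv μ x).toReal) μ :=
    Measure.integrable_toReal_rnDeriv
  have h2 : Integrable (fun x => ((ρ.map S).rnDeriv μ x).toReal * g x) μ :=
    (integrable_toReal_rnDeriv_mul_iff hac).2 hgi
  have h3 : Integrable (fun x => max (f x) 0 * g (S x)) μ := by
    have := hf.pos_part.bdd_mul (c := C) (hg.comp hS.measurable).aestronglyMeasurable
      (ae_of_all _ fun x => by simpa using hC (S x))
    simpa [mul_comm] using this
  refine ⟨h1, h2, h3, ?_⟩
  have e1 : ∫ x, ((ρ.map S).rnDeriv μ x).toReal * g x ∂μ = ∫ x, g x ∂(ρ.map S) := by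
    simpa [smul_eq_mul] using integral_rnDeriv_smul (f := g) hac
  rw [e1, integral_map hS.measurable.aemeasurable hg.aestronglyMeasurable, hρ,
    integral_withDensity_eq_integral_toReal_smul₀ hfm (ae_of_all _ fun _ => ENNReal.ofReal_lt_top)]
  simp [ENNReal.toReal_ofReal', smul_eq_mul]

/-- `transferOp μ S` is the transfer operator: it maps integrable functions to integrable
functions and is dual to the composition with `S` on bounded functions. -/
theorem transferOp_duality (μ : Measure X) [SigmaFinite μ] {S : X → X}
    (hS : Measure.QuasiMeasurePreserving S μ μ) {f : X → ℝ} (hf : Integrable f μ)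
    {g : X → ℝ} (hg : Measurable g) {C : ℝ} (hC : ∀ x, |g x| ≤ C) :
    Integrable (transferOp μ S f) μ ∧
      ∫ x, f x * g (S x) ∂μ = ∫ x, transferOp μ S f x * g x ∂μ := by
  obtain ⟨a1, a2, a3, a4⟩ := transferOp_duality_pos μ hS hf hg hC
  obtain ⟨b1, b2, b3, b4⟩ := transferOp_duality_pos μ hS hf.neg hg hC
  simp only [Pi.neg_apply] at b1 b2 b3 b4
  refine ⟨a1.sub b1, ?_⟩
  simp only [transferOp, sub_mul]
  rw [integral_sub a2 b2, ← a4, ← b4, ← integral_sub a3 b3]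
  congr 1
  ext x
  rw [← sub_mul, max_zero_sub_max_neg_zero_eq_self]

/-- Conservative ergodic measure preserving transformation: for every `u ∈ L¹₊(μ)`, i.e.
`u ≥ 0` integrable with positive integral, `∑ₖ T̂ᵏ u = +∞` almost everywhere. -/
structure IsCEMPT (μ : Measure X) (T : X → X) : Prop where
  measurePreserving : MeasurePreserving T μ μ
  sum_eq_top : ∀ u : X → ℝ, Integrable u μ → 0 ≤ᵐ[μ] u → 0 < ∫ x, u x ∂μ →
    ∀ᵐ x ∂μ, ∑' k : ℕ, ENNReal.ofReal ((transferOp μ T)^[k] u x) = ∞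

/-- The normalized Birkhoff sums `(1 / aₙ) ∑_{k < n} T̂ᵏ u`. -/
def dualAverage (μ : Measure X) (T : X → X) (a : ℕ → ℝ≥0) (u : X → ℝ) (n : ℕ) (x : X) : ℝ :=
  (1 / (a n : ℝ)) * ∑ k ∈ Finset.range n, (transferOp μ T)^[k] u x

/-- Pointwise dual ergodicity. -/
def IsPointwiseDualErgodic (μ : Measure X) (T : X → X) : Prop :=
  ∃ a : ℕ → ℝ≥0, ∀ u : X → ℝ, Integrable u μ →
    ∀ᵐ x ∂μ, Tendsto (fun n => dualAverage μ T a u n x) atTop (𝓝 (∫ y, u y ∂μ))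

/-- `Y` is a uniform set with normalizing sequence `a`: for some `f ∈ L¹₊(μ)` the averages
`(1 / aₙ) ∑_{k < n} T̂ᵏ f` converge to `∫ f dμ` in `L^∞` on `Y`. -/
structure IsUniformSet (μ : Measure X) (T : X → X) (Y : Set X) (a : ℕ → ℝ≥0) : Prop where
  measurableSet : MeasurableSet Y
  measure_pos : 0 < μ Y
  exists_uniform : ∃ f : X → ℝ, Integrable f μ ∧ 0 ≤ᵐ[μ] f ∧ 0 < ∫ x, f x ∂μ ∧
    Tendsto (fun n => eLpNorm (fun x => dualAverage μ T a f n x - ∫ y, f y ∂μ) ∞ (μ.restrict Y))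
      atTop (𝓝 0)

/-- Regular variation of index `α` at infinity of the function `x ↦ a_{⌊x⌋}`. -/
def IsRegularlyVarying (a : ℕ → ℝ≥0) (α : ℝ) : Prop :=
  ∀ y : ℝ≥0, 0 < y → Tendsto (fun x : ℝ≥0 => a ⌊x * y⌋₊ / a ⌊x⌋₊) atTop (𝓝 (y ^ α))

/-- `b` is an asymptotic inverse of `a`: `a(b(s)) ∼ s` and `b(a(s)) ∼ s` as `s → ∞`,
where `a(s) = a_{⌊s⌋}`. -/
structure IsAsymptoticInverse (a : ℕ → ℝ≥0) (b : ℝ≥0 → ℝ≥0) : Prop where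
  left : Tendsto (fun s : ℝ≥0 => a ⌊b s⌋₊ / s) atTop (𝓝 1)
  right : Tendsto (fun s : ℝ≥0 => b (a ⌊s⌋₊) / s) atTop (𝓝 1)

/-- The scaling function `γ(s) = 1 / b(1 / s)`. -/
def scaling (b : ℝ≥0 → ℝ≥0) (s : ℝ≥0) : ℝ≥0 := 1 / b (1 / s)

/-- `returnTime T A k x` is the `k`-th time `n ≥ 1` at which `Tⁿ x ∈ A`, and `⊤` if there are
fewer than `k` such times; `returnTime T A 0 x = 0`. -/
def returnTime (T : X → X) (A : Set X) : ℕ → X → ℕ∞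
  | 0, _ => 0
  | k + 1, x => sInf {n : ℕ∞ | returnTime T A k x < n ∧ ∃ m : ℕ, n = m ∧ T^[m] x ∈ A}

/-- The induced map `T_A x = T^{r_A(x)} x`. -/
def inducedMap (T : X → X) (A : Set X) (x : X) : X := T^[(returnTime T A 1 x).toNat] x

end Dynamics

/-! ### Point processes on `[0, ∞)` -/

/-- The space of Radon (locally finite) atomic measures on `[0, ∞)`. -/
def AtomicRadon : Type :=
  {ν : Measure ℝ≥0 // IsLocallyFiniteMeasure ν ∧ ∃ S : Set ℝ≥0, S.Countable ∧ ν Sᶜ = 0}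

/-- The topology of vague convergence: the coarsest one for which `ν ↦ ∫ f dν` is continuous
for every continuous compactly supported `f`. -/
instance : TopologicalSpace AtomicRadon :=
  TopologicalSpace.induced (fun ν (f : C_c(ℝ≥0, ℝ)) => ∫ x, f x ∂ν.1) inferInstance

instance : MeasurableSpace AtomicRadon := borel AtomicRadon

instance : BorelSpace AtomicRadon := ⟨rfl⟩

open Classical in
/-- A measure on `[0, ∞)` as an element of `AtomicRadon`; measures that are not Radon and atomic
are sent to `0` (for the random measures below this has probability zero). -/
def toAtomicRadon (ν : Measure ℝ≥0) : AtomicRadon :=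
  if h : IsLocallyFiniteMeasure ν ∧ ∃ S : Set ℝ≥0, S.Countable ∧ ν Sᶜ = 0 then ⟨ν, h⟩
  else ⟨0, inferInstance, ∅, Set.countable_empty, by simp⟩

/-- The Rare Event Point Process `N_A^γ = ∑_{k ≥ 1} δ_{γ(μ(A)) r_A^{(k)}}` (times equal to `+∞`
give no point of `[0, ∞)`). -/
def REPP {X : Type*} [MeasurableSpace X] (μ : Measure X) (T : X → X) (γ : ℝ≥0 → ℝ≥0) (A : Set X)
    (x : X) : AtomicRadon :=
  toAtomicRadon (Measure.sum fun k : ℕ =>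
    if returnTime T A (k + 1) x = ⊤ then 0
    else Measure.dirac (γ (μ A).toNNReal * ((returnTime T A (k + 1) x).toNat : ℝ≥0)))

/-- The sum `∑ᵢ mᵢ δ_{Tᵢ}` where `T₀ = w₀` and `Tᵢ₊₁ - Tᵢ = wᵢ₊₁`. -/
def pointsOfWaitingTimes (w : ℕ → ℝ≥0) (m : ℕ → ℕ) : AtomicRadon :=
  toAtomicRadon (Measure.sum fun i : ℕ =>
    (m i : ℝ≥0∞) • Measure.dirac (∑ k ∈ Finset.range (i + 1), w k))

/-- The law of the renewal point process with i.i.d. waiting times of law `η`. -/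
def RPP (η : ProbabilityMeasure ℝ≥0) : Measure AtomicRadon :=
  (Measure.infinitePi fun _ : ℕ => (η : Measure ℝ≥0)).map
    fun w => pointsOfWaitingTimes w fun _ => 1

/-- The law of the compound point process of multiplicity `π` associated to the renewal point
process with i.i.d. waiting times of law `η`: the multiplicities are i.i.d. of law `π` and
independent of the waiting times. -/
def compoundRPP (η : ProbabilityMeasure ℝ≥0) (π : ProbabilityMeasure ℕ) : Measure AtomicRadon :=
  ((Measure.infinitePi fun _ : ℕ => (η : Measure ℝ≥0)).prod
    (Measure.infinitePi fun _ : ℕ => (π : Measure ℕ))).map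
    fun p => pointsOfWaitingTimes p.1 p.2

/-- `H` is the Mittag-Leffler law of the first type with parameters `α` and `lam`, i.e. the law on
`[0, ∞)` with Laplace transform `lam / (lam + s ^ α)`. -/
def IsMittagLeffler (α lam : ℝ) (H : ProbabilityMeasure ℝ≥0) : Prop :=
  ∀ s : ℝ, 0 ≤ s →
    ∫ x : ℝ≥0, Real.exp (-(s * (x : ℝ))) ∂(H : Measure ℝ≥0) = lam / (lam + s ^ α)

/-- The Mittag-Leffler law `H_α(lam)`, the law characterized by `IsMittagLeffler α lam`. -/
def mittagLeffler (α lam : ℝ) : ProbabilityMeasure ℝ≥0 :=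
  Classical.epsilon (IsMittagLeffler α lam)

/-- The fractional Poisson process `FPP_α(lam)`. -/
def FPP (α lam : ℝ) : Measure AtomicRadon := RPP (mittagLeffler α lam)

/-- The compound fractional Poisson process `CFPP_α(lam, π)`. -/
def CFPP (α lam : ℝ) (π : ProbabilityMeasure ℕ) : Measure AtomicRadon :=
  compoundRPP (mittagLeffler α lam) π

/-- The positive geometric law: for `θ ≠ 0`, `k ≥ 1` has mass `θ (1 - θ) ^ (k - 1)`. -/
def positiveGeometric (θ : unitInterval) : ProbabilityMeasure ℕ :=
  ⟨(geometricMeasure θ).map Nat.succ,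
    Measure.isProbabilityMeasure_map (measurable_of_countable _).aemeasurable⟩

/-- The law `W_{α,θ}(lam) = (1 - θ) δ₀ + θ H_α(lam)`. -/
def waitingLaw (α lam : ℝ) (θ : unitInterval) : ProbabilityMeasure ℝ≥0 :=
  ⟨ENNReal.ofReal (1 - θ) • Measure.dirac 0
      + ENNReal.ofReal θ • (mittagLeffler α lam : Measure ℝ≥0),
    ⟨by
      rw [Measure.add_apply, Measure.smul_apply, Measure.smul_apply, measure_univ, measure_univ,
        smul_eq_mul, smul_eq_mul, mul_one, mul_one,
        ← ENNReal.ofReal_add (sub_nonneg.2 θ.2.2) θ.2.1]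
      simp⟩⟩

/-! ### Convergence in law -/

/-- Convergence in law: the random variables `Zₙ`, considered under `Pₙ`, converge in law to `Λ`,
i.e. `(Zₙ)_# Pₙ → Λ` weakly. -/
def ConvergesInLaw {Ω E : Type*} [MeasurableSpace Ω] [TopologicalSpace E] [MeasurableSpace E]
    (Z : ℕ → Ω → E) (P : ℕ → Measure Ω) (Λ : Measure E) : Prop :=
  (∀ n, AEMeasurable (Z n) (P n)) ∧
    ∀ F : E →ᵇ ℝ, Tendsto (fun n => ∫ ω, F (Z n ω) ∂(P n)) atTop (𝓝 (∫ z, F z ∂Λ))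

/-- Strong convergence in law: convergence in law under every probability measure that is
absolutely continuous with respect to `μ`. -/
def ConvergesStronglyInLaw {Ω E : Type*} [MeasurableSpace Ω] [TopologicalSpace E]
    [MeasurableSpace E] (Z : ℕ → Ω → E) (μ : Measure Ω) (Λ : Measure E) : Prop :=
  ∀ ν : Measure Ω, IsProbabilityMeasure ν → ν ≪ μ → ConvergesInLaw Z (fun _ => ν) Λ

/-! ### The assumptions on the rare events -/

section Assumptions

variable {X : Type*} [MeasurableSpace X]

/-- A sequence of asymptotically rare events: measurable sets of positive measure (so that the
conditional probabilities make sense) whose measure tends to `0`. -/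
structure IsRareSequence (μ : Measure X) (B : ℕ → Set X) : Prop where
  measurableSet : ∀ n, MeasurableSet (B n)
  measure_ne_zero : ∀ n, μ (B n) ≠ 0
  tendsto_zero : Tendsto (fun n => μ (B n)) atTop (𝓝 0)

/-- The assumptions `(A)_α` for given `Y`, `U(Bₙ)`, `Q(Bₙ)`, `τₙ` (of which only the values on `Bₙ`
matter) and `𝒰`. Measure zero differences are ignored in `Bₙ = U(Bₙ) ⊔ Q(Bₙ)`, and the last two
conditions concern only the `n` for which `U(Bₙ)` is non-empty modulo null sets. -/
structure AssumptionsFor (μ : Measure X) (T : X → X) (α θ : ℝ) (a : ℕ → ℝ≥0) (b : ℝ≥0 → ℝ≥0)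
    (B : ℕ → Set X) (Y : Set X) (U Q : ℕ → Set X) (τ : ℕ → X → ℕ) (𝒰 : Set (Lp ℝ 1 μ)) :
    Prop where
  uniformSet : IsUniformSet μ T Y a
  regularlyVarying : IsRegularlyVarying a α
  subset_uniformSet : ∀ n, B n ⊆ Y
  measurableSet_U : ∀ n, MeasurableSet (U n)
  measurableSet_Q : ∀ n, MeasurableSet (Q n)
  decomposition : ∀ n, 1 ≤ n → B n =ᵐ[μ] (U n ∪ Q n : Set X) ∧ AEDisjoint μ (U n) (Q n)
  extremalIndex : Tendsto (fun n => μ.real (Q n) / μ.real (B n)) atTop (𝓝 θ)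
  measurable_τ : ∀ n, Measurable (τ n)
  isCompact : IsCompact 𝒰
  goodDensity : ∀ n, 1 ≤ n → ∃ v ∈ 𝒰,
    v =ᵐ[μ] transferOp μ (fun x => T^[τ n x] x) ((Q n).indicator fun _ => 1 / μ.real (Q n))
  τ_negligible : ConvergesInLaw (fun n x => scaling b (μ (B n)).toNNReal * (τ n x : ℝ≥0))
    (fun n => cond μ (B n)) (Measure.dirac 0)
  no_cluster_from_Q :
    Tendsto (fun n => cond μ (Q n) {x | returnTime T (B n) 1 x < (τ n x : ℕ∞)}) atTop (𝓝 0)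
  cluster_from_U :
    Tendsto (fun n => cond μ (U n) {x | (τ n x : ℕ∞) < returnTime T (B n) 1 x})
      (atTop ⊓ 𝓟 {n | μ (U n) ≠ 0}) (𝓝 0)
  geometric_compatibility :
    Tendsto (fun n => eLpNorm (fun x =>
        transferOp (cond μ (B n)) (inducedMap T (B n))
            ((U n).indicator fun _ => 1 / μ.real (U n)) x
          - (B n).indicator (fun _ => 1 / μ.real (B n)) x) ∞ (cond μ (B n)))
      (atTop ⊓ 𝓟 {n | μ (U n) ≠ 0}) (𝓝 0)

/-- The assumptions `(A)_α` with extremal index `θ`. -/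
def SatisfiesA (μ : Measure X) (T : X → X) (α θ : ℝ) (a : ℕ → ℝ≥0) (b : ℝ≥0 → ℝ≥0)
    (B : ℕ → Set X) : Prop :=
  ∃ (Y : Set X) (U Q : ℕ → Set X) (τ : ℕ → X → ℕ) (𝒰 : Set (Lp ℝ 1 μ)),
    AssumptionsFor μ T α θ a b B Y U Q τ 𝒰

end Assumptions

end

end RareEvents

namespace RareEvents

/-! ### Transfer operator, recurrence and the filling scheme -/

section Transfer

variable {X : Type*} [MeasurableSpace X] {μ : Measure X} {T : X → X}

/-! Write γₙ = γ(μ(Bₙ)), and for measurable 0 ≤ g ≤ 1 put Ψₙ = exp(-s γₙ r) · g ∘ T_{Bₙ}, where r is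
the first return time to Bₙ and Ψₙ = 0 where r = ∞ (`discounted`). The proof is about three numbers:
mₙ, the mean of g over Bₙ; Rₙ, the mean of Ψₙ over Bₙ (return functional); Hₙ, the integral of Ψₙ
against a probability density (hitting functional). They satisfy two asymptotic linear relations.

The first, `IsUniformSet.exists_tendsto_hitting_sub_return`, is Hₙ ≈ c (mₙ - Rₙ) with c = Γ(1+α)
s^(-α), for s > 0. Decomposing the visits to Bₙ at the last one gives an exact identity between Hₙ
and a discounted sum of visits weighted by g - Ψₙ. On a uniform set the partial sums of T̂ᵏ f are
essentially constant, so that this sum is governed by the normalizing sequence alone, and Karamata's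
theorem evaluates its Laplace transform.

The second, `AssumptionsFor.tendsto_return_sub_mixture`, is Rₙ ≈ (1-θ) mₙ + θ Hₙ. From U(Bₙ) the
orbit comes back at once, at a point almost uniformly distributed in Bₙ. From Q(Bₙ) it is carried by
T^τ to a density in a compact set, without spending time on the scale 1/γₙ. From there Ψₙ has nearly
the same integral as under any fixed probability density: Ψₙ is asymptotically T-invariant, and in a
conservative ergodic system the filling scheme shows that bounded asymptotically invariant functions
do not distinguish densities, uniformly on compact sets.

Eliminating Rₙ gives Hₙ ≈ φ(s) mₙ with φ(s) = λ/(λ + s^α) and λ = θ Γ(1+α), hence Rₙ ≈ ((1-θ) + θ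
φ(s)) mₙ. Since g may depend on n, it can be chosen as the same functional of the later waiting
times. Induction yields the joint Laplace transforms of all waiting times: under μ_{Bₙ} they are
asymptotically i.i.d. with transform (1-θ) + θφ, and under ν ≪ μ only the first one differs, having
transform φ.

To pass to point processes, x ↦ e⁻ˣ embeds sequences of waiting times into the Hilbert cube, where
Laplace transforms at integers are moments and Stone-Weierstrass applies. The map from waiting times
to point measures is vaguely continuous on sequences with divergent sum, a set of full measure for
the limit laws (`tendsto_integral_of_tendsto_laplace`). The compound process is read as a simple
list of points by repeating each atom, that is, by inserting zero waiting times; memorylessness of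
the geometric law shows that its transforms are those found above. The existence of the
Mittag-Leffler law comes from the dynamics: it is a limit of laws of rescaled hitting times. -/

theorem transferOp_nonneg (μ : Measure X) [SigmaFinite μ] (S : X → X) {f : X → ℝ}
    (hf : 0 ≤ᵐ[μ] f) : 0 ≤ᵐ[μ] transferOp μ S f := by
  have h0 : (μ.withDensity fun y => ENNReal.ofReal (-f y)) = 0 := by
    rw [← withDensity_zero (μ := μ)]
    refine withDensity_congr_ae ?_
    filter_upwards [hf] with x hx
    simpa using hx
  have h1 : (((μ.withDensity fun y => ENNReal.ofReal (-f y)).map S).rnDeriv μ) =ᵐ[μ] 0 := by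
    rw [h0, Measure.map_zero]
    exact Measure.rnDeriv_zero μ
  filter_upwards [h1] with x hx
  simp [transferOp, hx]

theorem transferOp_iterate_integrable [SigmaFinite μ] (hT : Measure.QuasiMeasurePreserving T μ μ)
    {f : X → ℝ} (hf : Integrable f μ) (k : ℕ) : Integrable ((transferOp μ T)^[k] f) μ := by
  induction k with
  | zero => exact hf
  | succ k ih =>
    rw [Function.iterate_succ_apply']
    exact (transferOp_duality μ hT ih (g := 0) measurable_const (C := 0) (by simp)).1

theorem transferOp_iterate_nonneg [SigmaFinite μ] {f : X → ℝ} (hf : 0 ≤ᵐ[μ] f) (k : ℕ) :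
    0 ≤ᵐ[μ] (transferOp μ T)^[k] f := by
  induction k with
  | zero => exact hf
  | succ k ih =>
    rw [Function.iterate_succ_apply']
    exact transferOp_nonneg μ T ih

theorem integral_transferOp_iterate [SigmaFinite μ] (hT : Measure.QuasiMeasurePreserving T μ μ)
    {f : X → ℝ} (hf : Integrable f μ) (k : ℕ) {g : X → ℝ} (hg : Measurable g) {C : ℝ}
    (hC : ∀ x, |g x| ≤ C) :
    ∫ x, f x * g (T^[k] x) ∂μ = ∫ x, (transferOp μ T)^[k] f x * g x ∂μ := by
  induction k generalizing g with
  | zero => rfl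
  | succ k ih =>
    rw [Function.iterate_succ_apply',
      ← (transferOp_duality μ hT (transferOp_iterate_integrable hT hf k) hg hC).2,
      ← ih (g := fun x => g (T x)) (hg.comp hT.measurable) (fun x => hC _)]
    simp only [Function.iterate_succ_apply']

/-- Almost every point of a conservative ergodic system visits every set of positive measure. -/
theorem IsCEMPT.ae_exists_visit [SigmaFinite μ] (hT : IsCEMPT μ T) {E : Set X}
    (hE : MeasurableSet E) (hμE : μ E ≠ 0) : ∀ᵐ x ∂μ, ∃ k, 1 ≤ k ∧ T^[k] x ∈ E := by
  have hTm := hT.measurePreserving.measurable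
  have hTq := hT.measurePreserving.quasiMeasurePreserving
  set F : Set X := {x | ∀ k, 1 ≤ k → T^[k] x ∉ E} with hF
  have hFm : MeasurableSet F := by
    have : F = ⋂ k, ⋂ (_ : 1 ≤ k), (T^[k] ⁻¹' E)ᶜ := by ext x; simp [hF]
    rw [this]
    exact .iInter fun k => .iInter fun _ => ((hTm.iterate k) hE).compl
  by_contra hcon
  have hFpos : μ F ≠ 0 := by
    intro h0
    apply hcon
    rw [ae_iff]
    convert h0 using 2
    ext x
    simp [hF]
  obtain ⟨F', hF'F, hF'm, hF'0, hF'fin⟩ :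
      ∃ F' ⊆ F, MeasurableSet F' ∧ μ F' ≠ 0 ∧ μ F' < ∞ := by
    obtain ⟨t, ht, ht1, ht2, ht3⟩ :=
      Measure.exists_subset_measure_lt_top hFm (pos_iff_ne_zero.2 hFpos)
    exact ⟨t, ht1, ht, ht2.ne', ht3⟩
  set u : X → ℝ := F'.indicator fun _ => 1 with hu
  have hui : Integrable u μ := (integrable_indicator_iff hF'm).2 (by simp [hF'fin])
  have hu0 : 0 ≤ᵐ[μ] u := ae_of_all _ fun x => indicator_nonneg (fun _ _ => zero_le_one) x
  have hupos : 0 < ∫ x, u x ∂μ := by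
    rw [hu, integral_indicator_const _ hF'm]
    simp [Measure.real, ENNReal.toReal_pos hF'0 hF'fin.ne]
  have hsum := hT.sum_eq_top u hui hu0 hupos
  -- By duality the integral of T̂ᵏ 1_{F'} over E is μ(F' ∩ T⁻ᵏE), which vanishes for k ≥ 1. Only
  -- the finite term k = 0 is left, whereas conservativity makes the sum infinite.
  have key : ∀ k, ∫⁻ x in E, ENNReal.ofReal ((transferOp μ T)^[k] u x) ∂μ
      = ENNReal.ofReal (∫ x, u x * E.indicator (fun _ => 1) (T^[k] x) ∂μ) := by
    intro k
    rw [integral_transferOp_iterate hTq hui k (measurable_const.indicator hE) (C := 1)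
      (fun x => by by_cases hx : x ∈ E <;> simp [hx])]
    rw [← ofReal_integral_eq_lintegral_ofReal (transferOp_iterate_integrable hTq hui k).restrict
      (ae_restrict_of_ae (transferOp_iterate_nonneg hu0 k)), ← integral_indicator hE]
    congr 2
    ext x
    by_cases hx : x ∈ E <;> simp [hx]
  have h1 : ∫⁻ x in E, ∑' k : ℕ, ENNReal.ofReal ((transferOp μ T)^[k] u x) ∂μ = ∞ := by
    rw [setLIntegral_congr_fun_ae (g := fun _ => ∞) hE (by filter_upwards [hsum] with x hx _ using hx)]
    simp [hμE]
  rw [lintegral_tsum fun k => ((transferOp_iterate_integrable hTq hui k).aestronglyMeasurable.aemeasurable.restrict.ennreal_ofReal)]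
    at h1
  rw [tsum_eq_single 0] at h1
  · rw [key] at h1
    exact ENNReal.ofReal_ne_top h1
  · intro k hk
    rw [key]
    have : (fun x => u x * E.indicator (fun _ => (1 : ℝ)) (T^[k] x)) = 0 := by
      ext x
      by_cases hx : x ∈ F'
      · have := hF'F hx k (Nat.one_le_iff_ne_zero.2 hk)
        simp [this]
      · simp [hu, hx]
    simp [this]

theorem IsCEMPT.ae_frequently_visit [SigmaFinite μ] (hT : IsCEMPT μ T) {E : Set X}
    (hE : MeasurableSet E) (hμE : μ E ≠ 0) : ∀ᵐ x ∂μ, ∀ n, ∃ k, n < k ∧ T^[k] x ∈ E := by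
  rw [ae_all_iff]
  intro n
  filter_upwards [(hT.measurePreserving.iterate n).quasiMeasurePreserving.ae
    (hT.ae_exists_visit hE hμE)] with x hx
  obtain ⟨k, hk, hkE⟩ := hx
  exact ⟨k + n, by omega, by rwa [Function.iterate_add_apply]⟩

/-- The transfer operator on nonnegative extended real functions. -/
noncomputable def transferENN (μ : Measure X) (T : X → X) (f : X → ℝ≥0∞) : X → ℝ≥0∞ :=
  ((μ.withDensity f).map T).rnDeriv μ

theorem measurable_transferENN (f : X → ℝ≥0∞) : Measurable (transferENN μ T f) :=
  Measure.measurable_rnDeriv _ _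

theorem lintegral_transferENN_mul [SigmaFinite μ] (hT : Measure.QuasiMeasurePreserving T μ μ)
    {f g : X → ℝ≥0∞} (hf : Measurable f) (hfi : ∫⁻ x, f x ∂μ ≠ ∞) (hg : Measurable g) :
    ∫⁻ x, transferENN μ T f x * g x ∂μ = ∫⁻ x, f x * g (T x) ∂μ := by
  have : IsFiniteMeasure (μ.withDensity f) := isFiniteMeasure_withDensity hfi
  have hac : (μ.withDensity f).map T ≪ μ :=
    ((withDensity_absolutelyContinuous μ _).map hT.measurable).trans hT.absolutelyContinuous
  rw [transferENN, lintegral_rnDeriv_mul hac hg.aemeasurable, lintegral_map hg hT.measurable,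
    lintegral_withDensity_eq_lintegral_mul _ hf (g := fun x => g (T x)) (hg.comp hT.measurable)]
  rfl

/-- The filling scheme: `f` is transported by one step and fills the holes `g`. -/
noncomputable def filling (μ : Measure X) (T : X → X) (f g : X → ℝ≥0∞) :
    ℕ → (X → ℝ≥0∞) × (X → ℝ≥0∞)
  | 0 => (f, g)
  | k + 1 => (fun x => transferENN μ T (filling μ T f g k).1 x - (filling μ T f g k).2 x,
      fun x => (filling μ T f g k).2 x - transferENN μ T (filling μ T f g k).1 x)

variable {f g : X → ℝ≥0∞}

theorem measurable_filling (hf : Measurable f) (hg : Measurable g) (k : ℕ) :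
    Measurable (filling μ T f g k).1 ∧ Measurable (filling μ T f g k).2 := by
  induction k with
  | zero => exact ⟨hf, hg⟩
  | succ k ih =>
    exact ⟨(measurable_transferENN _).sub ih.2, ih.2.sub (measurable_transferENN _)⟩

theorem lintegral_transferENN [SigmaFinite μ] (hT : Measure.QuasiMeasurePreserving T μ μ)
    (hf : Measurable f) (hfi : ∫⁻ x, f x ∂μ ≠ ∞) :
    ∫⁻ x, transferENN μ T f x ∂μ = ∫⁻ x, f x ∂μ := by
  simpa using lintegral_transferENN_mul hT hf hfi (g := 1) measurable_const

theorem filling_snd_le (k : ℕ) (x : X) :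
    (filling μ T f g (k + 1)).2 x ≤ (filling μ T f g k).2 x := tsub_le_self

theorem filling_fst_le (k : ℕ) (x : X) :
    (filling μ T f g (k + 1)).1 x ≤ transferENN μ T (filling μ T f g k).1 x := tsub_le_self

theorem lintegral_filling_fst_ne_top [SigmaFinite μ] (hT : Measure.QuasiMeasurePreserving T μ μ)
    (hf : Measurable f) (hg : Measurable g) (hfi : ∫⁻ x, f x ∂μ ≠ ∞) (k : ℕ) :
    ∫⁻ x, (filling μ T f g k).1 x ∂μ ≠ ∞ := by
  induction k with
  | zero => exact hfi
  | succ k ih =>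
    refine ne_top_of_le_ne_top ih ((lintegral_mono (filling_fst_le k)).trans_eq ?_)
    exact lintegral_transferENN hT (measurable_filling hf hg k).1 ih

theorem lintegral_filling_snd_ne_top (hgi : ∫⁻ x, g x ∂μ ≠ ∞) (k : ℕ) :
    ∫⁻ x, (filling μ T f g k).2 x ∂μ ≠ ∞ := by
  induction k with
  | zero => exact hgi
  | succ k ih => exact ne_top_of_le_ne_top ih (lintegral_mono (filling_snd_le k))

/-- One step of the filling scheme, tested against a function `h`. -/
theorem lintegral_filling_succ [SigmaFinite μ] (hT : Measure.QuasiMeasurePreserving T μ μ)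
    (hf : Measurable f) (hg : Measurable g) (hfi : ∫⁻ x, f x ∂μ ≠ ∞)
    {h : X → ℝ≥0∞} (hh : Measurable h) (k : ℕ) :
    ∃ c : ℝ≥0∞, c ≤ ∫⁻ x, (filling μ T f g k).2 x * h x ∂μ ∧
      ∫⁻ x, (filling μ T f g (k + 1)).1 x * h x ∂μ + c
        = ∫⁻ x, (filling μ T f g k).1 x * h (T x) ∂μ ∧
      ∫⁻ x, (filling μ T f g (k + 1)).2 x * h x ∂μ + c
        = ∫⁻ x, (filling μ T f g k).2 x * h x ∂μ := by
  obtain ⟨h1, h2⟩ := measurable_filling (μ := μ) (T := T) hf hg k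
  obtain ⟨h1', h2'⟩ := measurable_filling (μ := μ) (T := T) hf hg (k + 1)
  have hm : Measurable fun x =>
      min (transferENN μ T (filling μ T f g k).1 x) ((filling μ T f g k).2 x) * h x :=
    ((measurable_transferENN _).min h2).mul hh
  -- The constant c is the mass that falls into the holes at this step. Both identities are (p - q)
  -- + min p q = p for truncated subtraction.
  refine ⟨∫⁻ x, min (transferENN μ T (filling μ T f g k).1 x) ((filling μ T f g k).2 x) * h x ∂μ,
    lintegral_mono fun x => by gcongr; exact min_le_right _ _, ?_, ?_⟩
  · rw [← lintegral_transferENN_mul hT h1 (lintegral_filling_fst_ne_top hT hf hg hfi k) hh,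
      ← lintegral_add_right _ hm]
    refine lintegral_congr fun x => ?_
    rw [← add_mul]
    congr 1
    exact tsub_add_min
  · rw [← lintegral_add_right _ hm]
    refine lintegral_congr fun x => ?_
    rw [← add_mul]
    congr 1
    rw [min_comm]
    exact tsub_add_min

/-- Each step removes the same mass from the transported function and from the holes. -/
theorem lintegral_filling_eq [SigmaFinite μ] (hT : Measure.QuasiMeasurePreserving T μ μ)
    (hf : Measurable f) (hg : Measurable g) (hfi : ∫⁻ x, f x ∂μ ≠ ∞)
    (hfg : ∫⁻ x, f x ∂μ = ∫⁻ x, g x ∂μ) (k : ℕ) :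
    ∫⁻ x, (filling μ T f g k).1 x ∂μ = ∫⁻ x, (filling μ T f g k).2 x ∂μ := by
  induction k with
  | zero => exact hfg
  | succ k ih =>
    obtain ⟨c, hc, h1, h2⟩ := lintegral_filling_succ hT hf hg hfi (h := 1) measurable_const k
    simp only [Pi.one_apply, mul_one] at hc h1 h2
    rw [ih, ← h2] at h1
    refine (ENNReal.add_left_inj ?_).1 h1
    exact ne_top_of_le_ne_top (lintegral_filling_snd_ne_top (hfg ▸ hfi) k) hc

/-- The filling scheme exhausts the mass. -/
theorem IsCEMPT.tendsto_lintegral_filling [SigmaFinite μ] (hT : IsCEMPT μ T)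
    (hf : Measurable f) (hg : Measurable g) (hfi : ∫⁻ x, f x ∂μ ≠ ∞)
    (hfg : ∫⁻ x, f x ∂μ = ∫⁻ x, g x ∂μ) :
    Tendsto (fun k => ∫⁻ x, (filling μ T f g k).1 x ∂μ) atTop (𝓝 0) := by
  have hTq := hT.measurePreserving.quasiMeasurePreserving
  have hTm := hTq.measurable
  have hanti : ∀ x, Antitone fun k => (filling μ T f g k).2 x := fun x =>
    antitone_nat_of_succ_le fun k => filling_snd_le k x
  have hlim : ∀ x, Tendsto (fun k => (filling μ T f g k).2 x) atTop
      (𝓝 (⨅ k, (filling μ T f g k).2 x)) := fun x => tendsto_atTop_iInf (hanti x)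
  set G : X → ℝ≥0∞ := fun x => ⨅ k, (filling μ T f g k).2 x with hG
  have hGm : Measurable G := .iInf fun k => (measurable_filling hf hg k).2
  set E : Set X := {x | G x ≠ 0} with hE
  have hEm : MeasurableSet E := (hGm (measurableSet_singleton 0)).compl
  -- E is the set of holes that are never completely filled. If it is null, the mass of the holes
  -- tends to 0, and so does the equal mass still in transport.
  by_cases hE0 : μ E = 0
  · have h1 : Tendsto (fun k => ∫⁻ x, (filling μ T f g k).2 x ∂μ) atTop (𝓝 (∫⁻ x, G x ∂μ)) := by
      refine tendsto_lintegral_of_dominated_convergence g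
        (fun k => (measurable_filling hf hg k).2) (fun k => ae_of_all _ fun x => ?_) (hfg ▸ hfi)
        (ae_of_all _ hlim)
      exact hanti x (zero_le)
    have h2 : ∫⁻ x, G x ∂μ = 0 := by
      rw [lintegral_eq_zero_iff hGm]
      exact hE0
    rw [h2] at h1
    simpa only [lintegral_filling_eq hTq hf hg hfi hfg] using h1
  -- A hole that is never completely filled absorbs everything that reaches it, so nothing in
  -- transport ever survives on E.
  · have hzero : ∀ k, ∀ x ∈ E, (filling μ T f g (k + 1)).1 x = 0 := by
      intro k x hx
      have h1 : (filling μ T f g (k + 1)).2 x ≠ 0 := fun h0 =>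
        hx (le_antisymm ((iInf_le _ (k + 1)).trans h0.le) zero_le)
      have h2 : transferENN μ T (filling μ T f g k).1 x < (filling μ T f g k).2 x := by
        by_contra hcon
        exact h1 (tsub_eq_zero_of_le (not_lt.1 hcon))
      exact tsub_eq_zero_of_le h2.le
    -- Mass still in transport after k steps comes from points whose orbit avoided E at times 1, …,
    -- k. By recurrence almost no point does so forever.
    have hbound : ∀ k, ∀ h : X → ℝ≥0∞, Measurable h → ∫⁻ x, (filling μ T f g k).1 x * h x ∂μ ≤
        ∫⁻ x, f x * ((⋂ j ∈ Finset.Icc 1 k, (T^[j] ⁻¹' Eᶜ)).indicator (fun x => h (T^[k] x)) x)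
          ∂μ := by
      intro k
      induction k with
      | zero => intro h _; simp [filling]
      | succ k ih =>
        intro h hh
        calc ∫⁻ x, (filling μ T f g (k + 1)).1 x * h x ∂μ
            = ∫⁻ x, (filling μ T f g (k + 1)).1 x * Eᶜ.indicator h x ∂μ := by
              refine lintegral_congr fun x => ?_
              by_cases hx : x ∈ E
              · simp [hzero k x hx]
              · rw [indicator_of_mem (show x ∈ Eᶜ from hx)]
          _ ≤ ∫⁻ x, transferENN μ T (filling μ T f g k).1 x * Eᶜ.indicator h x ∂μ :=
              lintegral_mono fun x => by gcongr; exact filling_fst_le k x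
          _ = ∫⁻ x, (filling μ T f g k).1 x * Eᶜ.indicator h (T x) ∂μ :=
              lintegral_transferENN_mul hTq (measurable_filling hf hg k).1
                (lintegral_filling_fst_ne_top hTq hf hg hfi k) (hh.indicator hEm.compl)
          _ ≤ _ := ih _ ((hh.indicator hEm.compl).comp hTm)
          _ ≤ _ := by
              refine lintegral_mono fun x => ?_
              gcongr
              by_cases hx : x ∈ ⋂ j ∈ Finset.Icc 1 k, (T^[j] ⁻¹' Eᶜ)
              · rw [indicator_of_mem hx]
                rw [← Function.iterate_succ_apply' T k x]
                by_cases hx2 : T^[k + 1] x ∈ Eᶜ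
                · have hmem : x ∈ ⋂ j ∈ Finset.Icc 1 (k + 1), (T^[j] ⁻¹' Eᶜ) := by
                    simp only [mem_iInter, Finset.mem_Icc] at hx ⊢
                    rintro j ⟨hj1, hj2⟩
                    rcases Nat.lt_or_eq_of_le hj2 with h3 | rfl
                    · exact hx j ⟨hj1, by omega⟩
                    · exact hx2
                  rw [indicator_of_mem hx2, indicator_of_mem hmem]
                · rw [indicator_of_notMem hx2]
                  exact zero_le
              · rw [indicator_of_notMem hx]
                exact zero_le
    have hlim2 : Tendsto (fun k => ∫⁻ x, f x *
        ((⋂ j ∈ Finset.Icc 1 k, (T^[j] ⁻¹' Eᶜ)).indicator (fun _ => 1) x) ∂μ) atTop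
        (𝓝 (∫⁻ x, 0 ∂μ)) := by
      refine tendsto_lintegral_of_dominated_convergence f (fun k => hf.mul
        (measurable_const.indicator (.biInter (Finset.countable_toSet _) fun j _ =>
          (hTm.iterate j) hEm.compl))) (fun k => ae_of_all _ fun x => ?_) hfi ?_
      · exact (mul_le_mul_right (indicator_le_self' (fun _ _ => zero_le) _) _).trans (by simp)
      · filter_upwards [hT.ae_exists_visit hEm hE0] with x hx
        obtain ⟨j, hj, hjE⟩ := hx
        refine tendsto_const_nhds.congr' ?_
        filter_upwards [eventually_ge_atTop j] with k hk
        rw [indicator_of_notMem, mul_zero]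
        simp only [mem_iInter, Finset.mem_Icc, not_forall]
        exact ⟨j, ⟨hj, hk⟩, fun h => h hjE⟩
    rw [lintegral_zero] at hlim2
    refine tendsto_of_tendsto_of_tendsto_of_le_of_le tendsto_const_nhds hlim2
      (fun _ => zero_le) fun k => ?_
    simpa using hbound k 1 measurable_const

end Transfer


/-! ### Asymptotically invariant functions do not see the density -/

section AsymptoticInvariance

variable {X : Type*} [MeasurableSpace X] {μ : Measure X} {T : X → X}

theorem toReal_lintegral_mul_ofReal {f : X → ℝ≥0∞} (hf : Measurable f)
    (hfi : ∫⁻ x, f x ∂μ ≠ ∞) {ψ : X → ℝ} (hψ : Measurable ψ) (h0 : ∀ x, 0 ≤ ψ x) :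
    (∫⁻ x, f x * ENNReal.ofReal (ψ x) ∂μ).toReal = ∫ x, (f x).toReal * ψ x ∂μ := by
  rw [integral_eq_lintegral_of_nonneg_ae (ae_of_all _ fun x => by have := h0 x; positivity)
    (show Measurable fun x => (f x).toReal * ψ x from
      hf.ennreal_toReal.mul hψ).aestronglyMeasurable]
  congr 1
  refine lintegral_congr_ae ?_
  filter_upwards [ae_lt_top hf hfi] with x hx
  rw [ENNReal.ofReal_mul ENNReal.toReal_nonneg, ENNReal.ofReal_toReal hx.ne]

theorem lintegral_mul_ofReal_le {f : X → ℝ≥0∞} {ψ : X → ℝ} (h1 : ∀ x, ψ x ≤ 1) :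
    ∫⁻ x, f x * ENNReal.ofReal (ψ x) ∂μ ≤ ∫⁻ x, f x ∂μ :=
  lintegral_mono fun x => mul_le_of_le_one_right zero_le (ENNReal.ofReal_le_one.2 (h1 x))

/-- A bounded asymptotically invariant sequence of functions does not distinguish densities. -/
theorem IsCEMPT.tendsto_integral_mul_of_asymptotically_invariant [SigmaFinite μ]
    (hT : IsCEMPT μ T) {ψ : ℕ → X → ℝ} (hψ : ∀ n, Measurable (ψ n)) (h0 : ∀ n x, 0 ≤ ψ n x)
    (h1 : ∀ n x, ψ n x ≤ 1)
    (hinv : ∀ w : X → ℝ, Integrable w μ →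
      Tendsto (fun n => ∫ x, w x * (ψ n (T x) - ψ n x) ∂μ) atTop (𝓝 0))
    {u : X → ℝ} (hu : Integrable u μ) (hu0 : ∫ x, u x ∂μ = 0) :
    Tendsto (fun n => ∫ x, u x * ψ n x ∂μ) atTop (𝓝 0) := by
  have hTq := hT.measurePreserving.quasiMeasurePreserving
  obtain ⟨u', hu'm, huu'⟩ := hu.aestronglyMeasurable
  have hu'i : Integrable u' μ := hu.congr huu'
  replace hu'm := hu'm.measurable
  set f : X → ℝ≥0∞ := fun x => ENNReal.ofReal (u' x) with hf
  set g : X → ℝ≥0∞ := fun x => ENNReal.ofReal (-u' x) with hg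
  have hfm : Measurable f := hu'm.ennreal_ofReal
  have hgm : Measurable g := hu'm.neg.ennreal_ofReal
  have hfi : ∫⁻ x, f x ∂μ ≠ ∞ := hu'i.lintegral_lt_top.ne
  have hgi : ∫⁻ x, g x ∂μ ≠ ∞ := hu'i.neg.lintegral_lt_top.ne
  have hfg : ∫⁻ x, f x ∂μ = ∫⁻ x, g x ∂μ := by
    rw [integral_congr_ae huu', integral_eq_lintegral_pos_part_sub_lintegral_neg_part hu'i,
      sub_eq_zero] at hu0
    exact (ENNReal.toReal_eq_toReal_iff' hfi hgi).1 hu0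
  have hfk := fun k => measurable_filling (μ := μ) (T := T) hfm hgm k
  have hfki := fun k => lintegral_filling_fst_ne_top hTq hfm hgm hfi k
  have hgki := fun k => lintegral_filling_snd_ne_top (T := T) (f := f) hgi k
  -- D k n is the integral of ψₙ against the k-th stage of the filling scheme applied to u⁺ and u⁻.
  -- Its size is at most the mass still in transport, uniformly in n, and D 0 n is the quantity to
  -- be estimated.
  set D : ℕ → ℕ → ℝ := fun k n =>
    (∫⁻ x, (filling μ T f g k).1 x * ENNReal.ofReal (ψ n x) ∂μ).toReal
      - (∫⁻ x, (filling μ T f g k).2 x * ENNReal.ofReal (ψ n x) ∂μ).toReal with hD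
  have hD0 : ∀ n, D 0 n = ∫ x, u x * ψ n x ∂μ := by
    intro n
    have hb : ∀ᵐ x ∂μ, ‖ψ n x‖ ≤ 1 := ae_of_all _ fun x => by
      rw [Real.norm_of_nonneg (h0 n x)]; exact h1 n x
    simp only [hD, filling]
    rw [toReal_lintegral_mul_ofReal hfm hfi (hψ n) (h0 n),
      toReal_lintegral_mul_ofReal hgm hgi (hψ n) (h0 n), ← integral_sub]
    · refine integral_congr_ae ?_
      filter_upwards [huu'] with x hx
      rw [hx, ← sub_mul]
      congr 1
      simp only [hf, hg, ENNReal.toReal_ofReal']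
      exact max_zero_sub_max_neg_zero_eq_self _
    · exact (integrable_toReal_of_lintegral_ne_top hfm.aemeasurable hfi).mul_bdd (c := 1)
        (hψ n).aestronglyMeasurable hb
    · exact (integrable_toReal_of_lintegral_ne_top hgm.aemeasurable hgi).mul_bdd (c := 1)
        (hψ n).aestronglyMeasurable hb
  have hDabs : ∀ k n, |D k n| ≤ (∫⁻ x, (filling μ T f g k).1 x ∂μ).toReal := by
    intro k n
    have e1 := ENNReal.toReal_mono (hfki k) (lintegral_mul_ofReal_le (μ := μ)
      (f := (filling μ T f g k).1) (h1 n))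
    have e2 := ENNReal.toReal_mono (hgki k) (lintegral_mul_ofReal_le (μ := μ)
      (f := (filling μ T f g k).2) (h1 n))
    rw [← lintegral_filling_eq hTq hfm hgm hfi hfg k] at e2
    have e3 := ENNReal.toReal_nonneg
      (a := ∫⁻ x, (filling μ T f g k).1 x * ENNReal.ofReal (ψ n x) ∂μ)
    have e4 := ENNReal.toReal_nonneg
      (a := ∫⁻ x, (filling μ T f g k).2 x * ENNReal.ofReal (ψ n x) ∂μ)
    rw [abs_le]
    constructor <;> simp only [hD] <;> linarith
  -- The difference of the two components at stage k + 1 is T̂ fₖ - gₖ, whose integral against ψₙ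
  -- differs from that of fₖ - gₖ only by moving ψₙ to ψₙ ∘ T. For fixed k this costs nothing as n →
  -- ∞.
  have hDstep : ∀ k n, D (k + 1) n - D k n
      = ∫ x, ((filling μ T f g k).1 x).toReal * (ψ n (T x) - ψ n x) ∂μ := by
    intro k n
    obtain ⟨c, hc, e1, e2⟩ := lintegral_filling_succ hTq hfm hgm hfi
      (h := fun x => ENNReal.ofReal (ψ n x)) (hψ n).ennreal_ofReal k
    have hcfin : c ≠ ∞ := ne_top_of_le_ne_top
      (ne_top_of_le_ne_top (hgki k) (lintegral_mul_ofReal_le (h1 n))) hc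
    have a1 := ne_top_of_le_ne_top (hfki (k + 1)) (lintegral_mul_ofReal_le (μ := μ)
      (f := (filling μ T f g (k + 1)).1) (h1 n))
    have a2 := ne_top_of_le_ne_top (hgki (k + 1)) (lintegral_mul_ofReal_le (μ := μ)
      (f := (filling μ T f g (k + 1)).2) (h1 n))
    have e1' := congrArg ENNReal.toReal e1
    have e2' := congrArg ENNReal.toReal e2
    rw [ENNReal.toReal_add a1 hcfin, toReal_lintegral_mul_ofReal (hfk k).1 (hfki k)
      (ψ := fun x => ψ n (T x)) ((hψ n).comp hTq.measurable) (fun x => h0 n _)] at e1'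
    rw [ENNReal.toReal_add a2 hcfin] at e2'
    have hint := integrable_toReal_of_lintegral_ne_top (hfk k).1.aemeasurable (hfki k)
    have e3 : ∫ x, ((filling μ T f g k).1 x).toReal * (ψ n (T x) - ψ n x) ∂μ
        = ∫ x, ((filling μ T f g k).1 x).toReal * ψ n (T x) ∂μ
          - ∫ x, ((filling μ T f g k).1 x).toReal * ψ n x ∂μ := by
      rw [← integral_sub]
      · simp only [mul_sub]
      · exact hint.mul_bdd (c := 1) ((hψ n).comp hTq.measurable).aestronglyMeasurable
          (ae_of_all _ fun x => by
            rw [Real.norm_of_nonneg (h0 n _)]; exact h1 n _)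
      · exact hint.mul_bdd (c := 1) (hψ n).aestronglyMeasurable
          (ae_of_all _ fun x => by rw [Real.norm_of_nonneg (h0 n _)]; exact h1 n _)
    rw [e3, ← toReal_lintegral_mul_ofReal (hfk k).1 (hfki k) (hψ n) (h0 n)]
    simp only [hD]
    linarith
  have hDlim : ∀ k, Tendsto (fun n => D k n - D 0 n) atTop (𝓝 0) := by
    intro k
    induction k with
    | zero => simp
    | succ k ih =>
      have := (hinv _ (integrable_toReal_of_lintegral_ne_top (hfk k).1.aemeasurable
        (hfki k))).add ih
      rw [zero_add] at this
      refine this.congr fun n => ?_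
      rw [← hDstep]
      ring
  simp only [← hD0]
  rw [Metric.tendsto_atTop']
  intro ε hε
  have hlim := (ENNReal.tendsto_toReal ENNReal.zero_ne_top).comp
    (hT.tendsto_lintegral_filling hfm hgm hfi hfg)
  obtain ⟨k, hk⟩ := (hlim.eventually (gt_mem_nhds (show (0 : ℝ≥0∞).toReal < ε / 2 by simpa))).exists
  obtain ⟨N, hN⟩ := Metric.tendsto_atTop'.1 (hDlim k) (ε / 2) (by positivity)
  refine ⟨N, fun n hn => ?_⟩
  have h3 := hN n hn
  have h4 := hDabs k n
  simp only [Function.comp] at hk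
  rw [Real.dist_eq, sub_zero] at h3 ⊢
  rw [abs_lt] at h3 ⊢
  rw [abs_le] at h4
  constructor <;> linarith

/-- Weak convergence to zero in `L¹` of bounded functions is uniform on compact sets. -/
theorem tendsto_integral_mul_of_isCompact {𝒰 : Set (Lp ℝ 1 μ)} (h𝒰 : IsCompact 𝒰)
    {ψ : ℕ → X → ℝ} (hψ : ∀ n, Measurable (ψ n)) {C : ℝ} (hC : ∀ n x, |ψ n x| ≤ C)
    (hlim : ∀ w : X → ℝ, Integrable w μ → Tendsto (fun n => ∫ x, w x * ψ n x ∂μ) atTop (𝓝 0))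
    {v : ℕ → Lp ℝ 1 μ} (hv : ∀ n, v n ∈ 𝒰) :
    Tendsto (fun n => ∫ x, v n x * ψ n x ∂μ) atTop (𝓝 0) := by
  -- Along a subsequence v converges in L¹ to some w. Replacing v by w costs at most C ‖v - w‖, and
  -- for the fixed w the hypothesis applies.
  refine tendsto_of_subseq_tendsto fun ns hns => ?_
  obtain ⟨w, -, ms, hms, hw⟩ := h𝒰.tendsto_subseq (fun n => hv (ns n))
  refine ⟨ms, ?_⟩
  have hL := (hlim w (L1.integrable_coeFn w)).comp (hns.comp hms.tendsto_atTop)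
  have hint : ∀ (y : Lp ℝ 1 μ) n, Integrable (fun x => y x * ψ n x) μ := fun y n =>
    (L1.integrable_coeFn y).mul_bdd (c := C) (hψ n).aestronglyMeasurable (ae_of_all _ fun x => hC n x)
  have hdiff : Tendsto (fun k => ∫ x, v (ns (ms k)) x * ψ (ns (ms k)) x ∂μ
      - ∫ x, w x * ψ (ns (ms k)) x ∂μ) atTop (𝓝 0) := by
    have h2 : Tendsto (fun k => ‖v (ns (ms k)) - w‖ * C) atTop (𝓝 0) := by
      have := (tendsto_iff_norm_sub_tendsto_zero.1 hw).mul_const C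
      simpa using this
    refine squeeze_zero_norm (fun k => ?_) h2
    rw [← integral_sub (hint _ _) (hint _ _), L1.norm_eq_integral_norm, ← integral_mul_const]
    refine (norm_integral_le_integral_norm _).trans ?_
    refine integral_mono_ae ((hint _ _).sub (hint _ _)).norm
      ((L1.integrable_coeFn _).norm.mul_const C) ?_
    filter_upwards [Lp.coeFn_sub (v (ns (ms k))) w] with x hx
    rw [hx, Pi.sub_apply, ← sub_mul, norm_mul]
    exact mul_le_mul_of_nonneg_left (hC _ x) (norm_nonneg _)
  have := hdiff.add hL
  rw [add_zero] at this
  exact this.congr fun k => by simp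

end AsymptoticInvariance


/-! ### Abelian theorem for monotone regularly varying sequences -/

section Karamata

variable {A : ℕ → ℝ} {α : ℝ}

/-- Where A vanishes, the quotient for y = 1 is 0 by the convention on division, although it has to
tend to 1. -/
theorem eventually_pos_of_regularlyVarying (hA0 : ∀ n, 0 ≤ A n)
    (hRV : ∀ y : ℝ, 0 < y → Tendsto (fun x : ℝ => A ⌊x * y⌋₊ / A ⌊x⌋₊) atTop (𝓝 (y ^ α))) :
    ∀ᶠ x : ℝ in atTop, 0 < A ⌊x⌋₊ := by
  have h := hRV 1 one_pos
  rw [Real.one_rpow] at h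
  filter_upwards [h.eventually (lt_mem_nhds one_half_lt_one)] with x hx
  refine lt_of_le_of_ne (hA0 _) fun h0 => ?_
  rw [← h0, div_zero] at hx
  norm_num at hx

/-- A crude Potter bound. -/
theorem eventually_le_of_regularlyVarying (hA : Monotone A) (hA0 : ∀ n, 0 ≤ A n) (hα : α ≤ 1)
    (hRV : ∀ y : ℝ, 0 < y → Tendsto (fun x : ℝ => A ⌊x * y⌋₊ / A ⌊x⌋₊) atTop (𝓝 (y ^ α))) :
    ∀ᶠ x : ℝ in atTop, ∀ y : ℝ, 0 < y → A ⌊x * y⌋₊ ≤ (4 * y ^ 2 + 1) * A ⌊x⌋₊ := by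
  -- Any constant above 2 ≥ 2^α would do for doubling. With 4 the resulting bound is the polynomial
  -- 4y² + 1, because 4ᵏ = (2ᵏ)².
  have h2 : (2 : ℝ) ^ α < 4 := by
    calc (2 : ℝ) ^ α ≤ 2 ^ (1 : ℝ) := Real.rpow_le_rpow_of_exponent_le (by norm_num) hα
      _ < 4 := by norm_num
  have hev := ((hRV 2 two_pos).eventually (gt_mem_nhds h2)).and
    (eventually_pos_of_regularlyVarying hA0 hRV)
  obtain ⟨x₀, hx₀⟩ := eventually_atTop.1 hev
  have hdouble : ∀ x, x₀ ≤ x → A ⌊x * 2⌋₊ ≤ 4 * A ⌊x⌋₊ := fun x hx =>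
    ((div_lt_iff₀ (hx₀ x hx).2).1 (hx₀ x hx).1).le
  filter_upwards [eventually_ge_atTop x₀, eventually_ge_atTop 0] with x hx hx0 y hy
  have hpow : ∀ k : ℕ, A ⌊x * 2 ^ k⌋₊ ≤ 4 ^ k * A ⌊x⌋₊ := by
    intro k
    induction k with
    | zero => simp
    | succ k ih =>
      have hge : x₀ ≤ x * 2 ^ k :=
        hx.trans (le_mul_of_one_le_right hx0 (one_le_pow₀ (by norm_num)))
      calc A ⌊x * 2 ^ (k + 1)⌋₊ = A ⌊x * 2 ^ k * 2⌋₊ := by rw [pow_succ, mul_assoc]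
        _ ≤ 4 * A ⌊x * 2 ^ k⌋₊ := hdouble _ hge
        _ ≤ 4 * (4 ^ k * A ⌊x⌋₊) := by gcongr
        _ = 4 ^ (k + 1) * A ⌊x⌋₊ := by ring
  rcases le_total y 1 with hy1 | hy1
  · calc A ⌊x * y⌋₊ ≤ A ⌊x⌋₊ := hA (Nat.floor_mono (mul_le_of_le_one_right hx0 hy1))
      _ ≤ (4 * y ^ 2 + 1) * A ⌊x⌋₊ := le_mul_of_one_le_left (hA0 _) (by nlinarith [sq_nonneg y])
  · obtain ⟨k, hk1, hk2⟩ := exists_nat_pow_near hy1 (show (1 : ℝ) < 2 by norm_num)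
    calc A ⌊x * y⌋₊ ≤ A ⌊x * 2 ^ (k + 1)⌋₊ := hA (Nat.floor_mono (by gcongr))
      _ ≤ 4 ^ (k + 1) * A ⌊x⌋₊ := hpow _
      _ ≤ (4 * y ^ 2 + 1) * A ⌊x⌋₊ := by
        refine mul_le_mul_of_nonneg_right ?_ (hA0 _)
        have : (4 : ℝ) ^ (k + 1) = 4 * (2 ^ k) ^ 2 := by
          rw [pow_succ, ← pow_mul, mul_comm k 2, pow_mul]; norm_num; ring
        rw [this]
        have := pow_le_pow_left₀ (by positivity) hk1 2
        linarith

theorem integrableOn_exp_neg_mul_sq :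
    IntegrableOn (fun y : ℝ => Real.exp (-y) * (4 * y ^ 2 + 1)) (Ioi 0) := by
  have h3 := Real.GammaIntegral_convergent (s := 3) (by norm_num)
  have h1 := Real.GammaIntegral_convergent (s := 1) (by norm_num)
  refine ((h3.const_mul 4).add h1).congr ?_
  refine ae_of_all _ fun y => ?_
  simp only [Pi.add_apply]
  norm_num
  ring

theorem measurable_exp_neg_mul_floor (A : ℕ → ℝ) (x : ℝ) :
    Measurable fun y : ℝ => Real.exp (-y) * A ⌊x * y⌋₊ :=
  (Real.measurable_exp.comp measurable_neg).mul
    ((measurable_from_nat (f := A)).comp (Nat.measurable_floor.comp (measurable_const_mul x)))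

/-- Dominated convergence: the Potter bound dominates A(xy)/A(x) by 4y² + 1, which is integrable
against e⁻ʸ. -/
theorem tendsto_integral_exp_mul_of_regularlyVarying (hA : Monotone A) (hA0 : ∀ n, 0 ≤ A n)
    (hα : α ≤ 1)
    (hRV : ∀ y : ℝ, 0 < y → Tendsto (fun x : ℝ => A ⌊x * y⌋₊ / A ⌊x⌋₊) atTop (𝓝 (y ^ α))) :
    Tendsto (fun x : ℝ => (∫ y in Ioi (0 : ℝ), Real.exp (-y) * A ⌊x * y⌋₊) / A ⌊x⌋₊) atTop
      (𝓝 (∫ y in Ioi (0 : ℝ), Real.exp (-y) * y ^ α)) := by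
  have heq : ∀ x : ℝ, (∫ y in Ioi (0 : ℝ), Real.exp (-y) * A ⌊x * y⌋₊) / A ⌊x⌋₊
      = ∫ y in Ioi (0 : ℝ), Real.exp (-y) * A ⌊x * y⌋₊ / A ⌊x⌋₊ :=
    fun x => (integral_div _ _).symm
  simp only [heq]
  refine tendsto_integral_filter_of_dominated_convergence
    (fun y => Real.exp (-y) * (4 * y ^ 2 + 1)) ?_ ?_ integrableOn_exp_neg_mul_sq ?_
  · exact Eventually.of_forall fun x =>
      ((measurable_exp_neg_mul_floor A x).div_const _).aestronglyMeasurable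
  · filter_upwards [eventually_le_of_regularlyVarying hA hA0 hα hRV,
      eventually_pos_of_regularlyVarying hA0 hRV] with x hx hx0
    filter_upwards [ae_restrict_mem measurableSet_Ioi] with y hy
    rw [Real.norm_of_nonneg (by have := hA0 ⌊x * y⌋₊; positivity), mul_div_assoc]
    gcongr
    exact (div_le_iff₀ hx0).2 (hx y hy)
  · filter_upwards [ae_restrict_mem measurableSet_Ioi] with y hy
    simp only [mul_div_assoc]
    exact (hRV y hy).const_mul _

theorem iUnion_Ico_mul_eq_Ici {σ : ℝ} (hσ : 0 < σ) :
    ⋃ m : ℕ, Ico (m * σ) ((m + 1) * σ) = Ici 0 := by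
  ext y
  simp only [mem_iUnion, mem_Ico, mem_Ici]
  constructor
  · rintro ⟨m, h1, -⟩
    exact (by positivity : (0 : ℝ) ≤ m * σ).trans h1
  · intro hy
    refine ⟨⌊y / σ⌋₊, ?_, ?_⟩
    · rw [← le_div_iff₀ hσ]; exact Nat.floor_le (by positivity)
    · rw [← div_lt_iff₀ hσ]; exact Nat.lt_floor_add_one _

/-- The step function y ↦ A(⌊xy⌋) equals Aₘ on [m/x, (m+1)/x), an interval of mass (1 - e^(-1/x))
e^(-m/x) for e⁻ʸ dy. This turns a power series into an integral to which dominated convergence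
applies. -/
theorem hasSum_exp_mul_eq_integral {x : ℝ} (hx : 0 < x)
    (hint : IntegrableOn (fun y : ℝ => Real.exp (-y) * A ⌊x * y⌋₊) (Ioi 0)) :
    HasSum (fun m : ℕ => (1 - Real.exp (-(1 / x))) * (Real.exp (-(1 / x)) ^ m * A m))
      (∫ y in Ioi (0 : ℝ), Real.exp (-y) * A ⌊x * y⌋₊) := by
  have hσ : 0 < 1 / x := by positivity
  rw [← integral_Ici_eq_integral_Ioi, ← iUnion_Ico_mul_eq_Ici hσ]
  have hdisj : Pairwise (Function.onFun Disjoint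
      fun m : ℕ => Ico ((m : ℝ) * (1 / x)) ((m + 1) * (1 / x))) := by
    intro i j hij
    refine Set.disjoint_left.2 fun y hy1 hy2 => hij ?_
    have key : ∀ m : ℕ, y ∈ Ico ((m : ℝ) * (1 / x)) ((m + 1) * (1 / x)) → ⌊y / (1 / x)⌋₊ = m := by
      intro m hm
      rw [Nat.floor_eq_iff (div_nonneg ((by positivity : (0 : ℝ) ≤ m * (1 / x)).trans hm.1) hσ.le)]
      exact ⟨(le_div_iff₀ hσ).2 hm.1, (div_lt_iff₀ hσ).2 hm.2⟩
    rw [← key i hy1, ← key j hy2]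
  have h := hasSum_integral_iUnion (μ := volume) (f := fun y : ℝ => Real.exp (-y) * A ⌊x * y⌋₊)
    (fun m : ℕ => measurableSet_Ico (a := (m : ℝ) * (1 / x)) (b := (m + 1) * (1 / x))) hdisj
    (by rwa [iUnion_Ico_mul_eq_Ici hσ, integrableOn_Ici_iff_integrableOn_Ioi])
  refine h.congr_fun fun m => ?_
  have hle : (m : ℝ) * (1 / x) ≤ (m + 1) * (1 / x) := by gcongr; linarith
  rw [setIntegral_congr_fun (g := fun y => Real.exp (-y) * A m) measurableSet_Ico]
  · rw [integral_mul_const, integral_Ico_eq_integral_Ioc, ← intervalIntegral.integral_of_le hle,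
      intervalIntegral.integral_comp_neg (fun y => Real.exp y), integral_exp, ← Real.exp_nat_mul]
    have : Real.exp (-(((m : ℝ) + 1) * (1 / x)))
        = Real.exp (m * -(1 / x)) * Real.exp (-(1 / x)) := by
      rw [← Real.exp_add]; congr 1; ring
    rw [this, show -((m : ℝ) * (1 / x)) = m * -(1 / x) by ring]
    ring
  · intro y hy
    have : ⌊x * y⌋₊ = m := by
      rw [Nat.floor_eq_iff (mul_nonneg hx.le ((by positivity : (0 : ℝ) ≤ m * (1 / x)).trans hy.1))]
      have h1 := hy.1
      have h2 := hy.2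
      rw [mul_one_div] at h1 h2
      rw [div_le_iff₀ hx] at h1
      rw [lt_div_iff₀ hx] at h2
      exact ⟨by linarith, by linarith⟩
    simp only [this]

/-- The Abelian half of Karamata's theorem for monotone sequences. -/
theorem tendsto_laplace_of_regularlyVarying (hA : Monotone A) (hA0 : ∀ n, 0 ≤ A n)
    (hα₀ : 0 < α) (hα : α ≤ 1)
    (hRV : ∀ y : ℝ, 0 < y → Tendsto (fun x : ℝ => A ⌊x * y⌋₊ / A ⌊x⌋₊) atTop (𝓝 (y ^ α))) :
    (∀ᶠ x : ℝ in atTop, Summable fun m : ℕ => Real.exp (-(1 / x)) ^ m * A m) ∧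
    Tendsto (fun x : ℝ => (1 - Real.exp (-(1 / x)))
      * (∑' m : ℕ, Real.exp (-(1 / x)) ^ m * A m) / A ⌊x⌋₊) atTop (𝓝 (Real.Gamma (1 + α))) := by
  have hsum : ∀ᶠ x : ℝ in atTop,
      HasSum (fun m : ℕ => (1 - Real.exp (-(1 / x))) * (Real.exp (-(1 / x)) ^ m * A m))
      (∫ y in Ioi (0 : ℝ), Real.exp (-y) * A ⌊x * y⌋₊) := by
    filter_upwards [eventually_le_of_regularlyVarying hA hA0 hα hRV,
      eventually_gt_atTop 0] with x hx hx0
    refine hasSum_exp_mul_eq_integral hx0 ?_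
    refine (integrableOn_exp_neg_mul_sq.mul_const (A ⌊x⌋₊)).mono'
      (measurable_exp_neg_mul_floor A x).aestronglyMeasurable ?_
    filter_upwards [ae_restrict_mem measurableSet_Ioi] with y hy
    rw [Real.norm_of_nonneg (by have := hA0 ⌊x * y⌋₊; positivity), mul_assoc]
    gcongr
    exact hx y hy
  have hne : ∀ x : ℝ, 0 < x → 1 - Real.exp (-(1 / x)) ≠ 0 := by
    intro x hx
    have : Real.exp (-(1 / x)) < 1 := Real.exp_lt_one_iff.2 (by simp [hx])
    linarith
  constructor
  · filter_upwards [hsum, eventually_gt_atTop 0] with x hx hx0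
    exact (summable_mul_left_iff (hne x hx0)).1 hx.summable
  · have hlim := tendsto_integral_exp_mul_of_regularlyVarying hA hA0 hα hRV
    rw [Real.Gamma_eq_integral (by linarith)]
    simp only [add_sub_cancel_left]
    refine hlim.congr' ?_
    filter_upwards [hsum] with x hx
    rw [← hx.tsum_eq, tsum_mul_left]

end Karamata


/-! ### Normalizing sequences of uniform sets, asymptotic inverses, Abel summation -/

section Uniform

variable {X : Type*} [MeasurableSpace X] {μ : Measure X} {T : X → X}

/-- If b(s) ≤ C, then a(b(s)) is one of finitely many values, hence bounded, while a(b(s)) > s/2 for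
large s. -/
theorem IsAsymptoticInverse.tendsto_atTop {a : ℕ → ℝ≥0} {b : ℝ≥0 → ℝ≥0}
    (hab : IsAsymptoticInverse a b) : Tendsto b atTop atTop := by
  rw [Filter.tendsto_atTop]
  intro C
  set M : ℝ≥0 := ∑ j ∈ Finset.range (⌊C⌋₊ + 1), a j with hM
  filter_upwards [hab.left.eventually (lt_mem_nhds (show (1 / 2 : ℝ≥0) < 1 by
    rw [← NNReal.coe_lt_coe]; norm_num)), eventually_gt_atTop (2 * M)] with s hs1 hs2
  by_contra hcon
  rw [not_le] at hcon
  have hle : a ⌊b s⌋₊ ≤ M := by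
    refine Finset.single_le_sum (f := a) (fun _ _ => zero_le) ?_
    rw [Finset.mem_range, Nat.lt_succ_iff]
    exact Nat.floor_mono hcon.le
  have hspos : 0 < s := lt_of_le_of_lt zero_le hs2
  rw [lt_div_iff₀ hspos] at hs1
  have h3 : (1 / 2 : ℝ≥0) * s < M := hs1.trans_le hle
  rw [← NNReal.coe_lt_coe] at h3 hs2
  push_cast at h3 hs2
  linarith

/-- Regular variation is inherited by every sequence asymptotic to a. This allows a to be replaced
by a monotone sequence, as the Potter bound requires. -/
theorem IsRegularlyVarying.real {a : ℕ → ℝ≥0} {α : ℝ} (ha : IsRegularlyVarying a α) {A : ℕ → ℝ}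
    (hA : Tendsto (fun n => A n / a n) atTop (𝓝 1)) {y : ℝ} (hy : 0 < y) :
    Tendsto (fun x : ℝ => A ⌊x * y⌋₊ / A ⌊x⌋₊) atTop (𝓝 (y ^ α)) := by
  have hy' : 0 < y.toNNReal := Real.toNNReal_pos.2 hy
  have h1 : Tendsto (fun x : ℝ => ((a ⌊x * y⌋₊ : ℝ) / a ⌊x⌋₊)) atTop (𝓝 (y ^ α)) := by
    have := (NNReal.tendsto_coe.2 (ha y.toNNReal hy')).comp Real.tendsto_toNNReal_atTop
    rw [NNReal.coe_rpow, Real.coe_toNNReal y hy.le] at this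
    refine this.congr' ?_
    filter_upwards [eventually_ge_atTop 0] with x hx
    simp only [Function.comp, NNReal.coe_div]
    have e : ∀ r : ℝ, 0 ≤ r → ⌊r.toNNReal⌋₊ = ⌊r⌋₊ := fun r hr => by
      conv_rhs => rw [← Real.coe_toNNReal r hr]
      exact (Nonneg.nat_floor_coe (α := ℝ) r.toNNReal).symm
    rw [← Real.toNNReal_mul hx, e x hx, e _ (by positivity)]
  have hfl : Tendsto (fun x : ℝ => ⌊x⌋₊) atTop atTop := tendsto_nat_floor_atTop
  have hfl2 : Tendsto (fun x : ℝ => ⌊x * y⌋₊) atTop atTop :=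
    tendsto_nat_floor_atTop.comp (tendsto_id.atTop_mul_const hy)
  have h2 := ((hA.comp hfl2).mul h1).div (hA.comp hfl) one_ne_zero
  rw [one_mul, div_one] at h2
  have hne : ∀ᶠ n in atTop, (a n : ℝ) ≠ 0 := by
    filter_upwards [hA.eventually (lt_mem_nhds one_half_lt_one)] with n hn h0
    rw [h0, div_zero] at hn
    norm_num at hn
  refine h2.congr' ?_
  filter_upwards [hfl.eventually hne, hfl2.eventually hne] with x hx1 hx2
  simp only [Function.comp, Pi.div_apply]
  field_simp

/-- A uniform set admits a monotone normalizing sequence. -/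
theorem IsUniformSet.exists_monotone [SigmaFinite μ] (hT : Measure.QuasiMeasurePreserving T μ μ)
    {Y : Set X} {a : ℕ → ℝ≥0} (hY : IsUniformSet μ T Y a) :
    ∃ (f : X → ℝ) (A : ℕ → ℝ), Integrable f μ ∧ 0 ≤ᵐ[μ] f ∧ 0 < ∫ x, f x ∂μ ∧ Monotone A ∧
      (∀ n, 0 ≤ A n) ∧ Tendsto (fun n => A n / a n) atTop (𝓝 1) ∧
      ∀ ε > 0, ∀ᶠ m in atTop, ∀ᵐ x ∂(μ.restrict Y),
        |∑ k ∈ Finset.range m, (transferOp μ T)^[k] f x - (∫ y, f y ∂μ) * A m| ≤ ε * A m := by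
  obtain ⟨f, hfi, hf0, hI, hunif⟩ := hY.exists_uniform
  set I := ∫ x, f x ∂μ with hIdef
  obtain ⟨Y', hY'm, hY'Y, hY'0, hY'fin⟩ :=
    Measure.exists_subset_measure_lt_top hY.measurableSet hY.measure_pos
  have hrpos : 0 < μ.real Y' := ENNReal.toReal_pos hY'0.ne' hY'fin.ne
  have hTm := hT.measurable
  set x : ℕ → ℝ := fun k => ∫ y, f y * Y'.indicator (fun _ => (1 : ℝ)) (T^[k] y) ∂μ with hx
  have hx0 : ∀ k, 0 ≤ x k := fun k => integral_nonneg_of_ae (by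
    filter_upwards [hf0] with y hy
    exact mul_nonneg hy (indicator_nonneg (fun _ _ => zero_le_one) _))
  -- The averages of the Birkhoff sums over a subset Y' of Y with positive finite measure,
  -- normalized by the integral of f. They increase with m since f ≥ 0, and uniform convergence on
  -- Y' makes them asymptotic to a.
  set A : ℕ → ℝ := fun m => (∑ k ∈ Finset.range m, x k) / (μ.real Y' * I) with hA
  have hden : 0 < μ.real Y' * I := mul_pos hrpos hI
  have hAmono : Monotone A := by
    refine monotone_nat_of_le_succ fun m => ?_
    simp only [hA]
    rw [Finset.sum_range_succ]
    gcongr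
    linarith [hx0 m]
  have hA0 : ∀ n, 0 ≤ A n := fun n => div_nonneg (Finset.sum_nonneg fun k _ => hx0 k) hden.le
  have hSint : ∀ m, Integrable (fun y => ∑ k ∈ Finset.range m, (transferOp μ T)^[k] f y) μ :=
    fun m => integrable_finsetSum _ fun k _ => transferOp_iterate_integrable hT hfi k
  have hSA : ∀ m, ∫ y in Y', ∑ k ∈ Finset.range m, (transferOp μ T)^[k] f y ∂μ
      = μ.real Y' * I * A m := by
    intro m
    rw [integral_finsetSum _ fun k _ => (transferOp_iterate_integrable hT hfi k).restrict]
    simp only [hA]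
    rw [mul_div_cancel₀ _ hden.ne']
    refine Finset.sum_congr rfl fun k _ => ?_
    simp only [hx]
    rw [integral_transferOp_iterate hT hfi k (measurable_const.indicator hY'm) (C := 1)
      (fun x => by by_cases hx : x ∈ Y' <;> simp [hx]), ← integral_indicator hY'm]
    congr 1
    ext y
    by_cases hy : y ∈ Y' <;> simp [hy]
  have hunif' : ∀ ε > 0, ∀ᶠ m in atTop, 0 < (a m : ℝ) ∧ ∀ᵐ x ∂(μ.restrict Y),
      |∑ k ∈ Finset.range m, (transferOp μ T)^[k] f x - I * a m| ≤ ε * a m := by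
    intro ε hε
    -- The bound I/2 forces a m > 0: if a m were 0, the average would be 0 by the convention on
    -- division, at distance I from its limit.
    set δ := min ε (I / 2) with hδ
    have hδpos : 0 < δ := lt_min hε (by positivity)
    filter_upwards [hunif.eventually (gt_mem_nhds (ENNReal.ofReal_pos.2 hδpos))] with m hm
    rw [eLpNorm_exponent_top] at hm
    have hae : ∀ᵐ x ∂(μ.restrict Y), |dualAverage μ T a f m x - I| ≤ δ := by
      filter_upwards [ae_le_eLpNormEssSup (f := fun x => dualAverage μ T a f m x - I)
        (μ := μ.restrict Y)] with x hx
      have := hx.trans hm.le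
      rw [← ofReal_norm] at this
      exact (ENNReal.ofReal_le_ofReal_iff hδpos.le).1 this
    have hapos : 0 < (a m : ℝ) := by
      refine lt_of_le_of_ne (a m).2 fun h0 => ?_
      have hne : (ae (μ.restrict Y)).NeBot := by
        rw [ae_neBot, Ne, Measure.restrict_eq_zero]
        exact hY.measure_pos.ne'
      obtain ⟨x, hx⟩ := hae.exists
      rw [dualAverage, ← h0] at hx
      simp only [div_zero, zero_mul, zero_sub, abs_neg, abs_of_pos hI] at hx
      have := hx.trans (min_le_right _ _)
      linarith
    refine ⟨hapos, ?_⟩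
    filter_upwards [hae] with x hx
    have e : ∑ k ∈ Finset.range m, (transferOp μ T)^[k] f x - I * a m
        = (dualAverage μ T a f m x - I) * a m := by
      rw [dualAverage]; field_simp
    rw [e, abs_mul, abs_of_pos hapos]
    gcongr
    exact hx.trans (min_le_left _ _)
  have hAa : ∀ ε > 0, ∀ᶠ m in atTop, |A m - a m| ≤ ε * a m := by
    intro ε hε
    filter_upwards [hunif' (ε * I) (by positivity)] with m hm
    have h1 : |∫ y in Y', (∑ k ∈ Finset.range m, (transferOp μ T)^[k] f y - I * a m) ∂μ|
        ≤ ε * I * a m * μ.real Y' := by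
      rw [← Real.norm_eq_abs]
      refine norm_setIntegral_le_of_norm_le_const_ae hY'fin ?_
      exact ae_restrict_of_ae_restrict_of_subset hY'Y hm.2
    rw [integral_sub (hSint m).restrict (integrableOn_const hY'fin.ne), hSA,
      setIntegral_const, smul_eq_mul] at h1
    rw [show μ.real Y' * I * A m - μ.real Y' * (I * a m) = μ.real Y' * I * (A m - a m) by ring,
      abs_mul, abs_of_pos hden] at h1
    refine le_of_mul_le_mul_left ?_ hden
    linarith
  refine ⟨f, A, hfi, hf0, hI, hAmono, hA0, ?_, fun ε hε => ?_⟩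
  · rw [Metric.tendsto_nhds]
    intro ε hε
    filter_upwards [hAa (ε / 2) (by positivity), hunif' 1 one_pos] with m h1 h2
    rw [Real.dist_eq, div_sub_one h2.1.ne', abs_div, abs_of_pos h2.1]
    refine lt_of_le_of_lt ((div_le_iff₀ h2.1).2 h1) (by linarith)
  -- The value 1/2 gives a m ≤ 2 A m. The other one absorbs the error η (1 + I) a m of replacing a m
  -- by A m.
  · set η := min (1 / 2) (ε / (2 * (1 + I))) with hη
    have hηpos : 0 < η := lt_min (by norm_num) (by positivity)
    filter_upwards [hAa η hηpos, hunif' η hηpos] with m h1 h2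
    filter_upwards [h2.2] with x hx
    have h3 : (a m : ℝ) ≤ 2 * A m := by
      have := (abs_le.1 h1).1
      have h4 : η * a m ≤ 1 / 2 * a m := by gcongr; exact min_le_left _ _
      linarith
    have h5 : η * (1 + I) * 2 ≤ ε := by
      have := min_le_right (1 / 2) (ε / (2 * (1 + I)))
      rw [← hη, le_div_iff₀ (by positivity)] at this
      linarith
    calc |∑ k ∈ Finset.range m, (transferOp μ T)^[k] f x - I * A m|
        = |(∑ k ∈ Finset.range m, (transferOp μ T)^[k] f x - I * a m) - I * (A m - a m)| := by
          congr 1; ring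
      _ ≤ |∑ k ∈ Finset.range m, (transferOp μ T)^[k] f x - I * a m| + |I * (A m - a m)| :=
          abs_sub _ _
      _ ≤ η * a m + I * (η * a m) := by
          rw [abs_mul, abs_of_pos hI]
          gcongr
      _ = η * (1 + I) * a m := by ring
      _ ≤ η * (1 + I) * (2 * A m) := by gcongr
      _ = η * (1 + I) * 2 * A m := by ring
      _ ≤ ε * A m := by gcongr; exact hA0 m

/-- Abel summation for power series. -/
theorem mul_tsum_pow_mul {x : ℕ → ℝ} {C : ℝ} (hx : ∀ k, |x k| ≤ C) {z : ℝ} (hz0 : 0 < z)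
    (hz1 : z < 1) :
    Summable (fun k => z ^ k * x k) ∧ Summable (fun m => z ^ m * ∑ k ∈ Finset.range m, x k) ∧
    z * ∑' k, z ^ k * x k = (1 - z) * ∑' m, z ^ m * ∑ k ∈ Finset.range m, x k := by
  have hS1 : Summable (fun k => z ^ k * x k) := by
    refine Summable.of_norm_bounded ((summable_geometric_of_lt_one hz0.le hz1).mul_right C)
      fun k => ?_
    rw [norm_mul, Real.norm_of_nonneg (by positivity)]
    gcongr
    exact hx k
  have hS2 : Summable (fun m => z ^ m * ∑ k ∈ Finset.range m, x k) := by
    have := (summable_pow_mul_geometric_of_norm_lt_one 1 (r := z)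
      (by rwa [Real.norm_of_nonneg hz0.le])).mul_right C
    refine Summable.of_norm_bounded this fun m => ?_
    rw [norm_mul, Real.norm_of_nonneg (by positivity)]
    calc z ^ m * ‖∑ k ∈ Finset.range m, x k‖ ≤ z ^ m * (m * C) := by
          gcongr
          refine (norm_sum_le _ _).trans ((Finset.sum_le_sum fun k _ => hx k).trans ?_)
          simp
      _ = _ := by simp; ring
  refine ⟨hS1, hS2, ?_⟩
  -- The partial sum for m = 0 is empty, so the series can be shifted by one. This shift is the
  -- origin of the extra factor z on the left of the identity.
  have h1 : ∑' m, z ^ m * ∑ k ∈ Finset.range m, x k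
      = ∑' m, z ^ (m + 1) * ∑ k ∈ Finset.range (m + 1), x k := by
    rw [hS2.tsum_eq_zero_add]; simp
  have h2 : ∑' m, z ^ (m + 1) * ∑ k ∈ Finset.range (m + 1), x k
      = z * ∑' m, z ^ m * ∑ k ∈ Finset.range m, x k + z * ∑' k, z ^ k * x k := by
    rw [← tsum_mul_left, ← tsum_mul_left, ← (hS2.mul_left z).tsum_add (hS1.mul_left z)]
    refine tsum_congr fun m => ?_
    rw [Finset.sum_range_succ]
    ring
  linarith

end Uniform


/-! ### Discounted number of visits to rare subsets of a uniform set -/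

section Discounted

variable {X : Type*} [MeasurableSpace X] {μ : Measure X} {T : X → X}

theorem IsRareSequence.tendsto_real {B : ℕ → Set X} (hB : IsRareSequence μ B) :
    Tendsto (fun n => μ.real (B n)) atTop (𝓝 0) := by
  have h := (ENNReal.tendsto_toReal ENNReal.zero_ne_top).comp hB.tendsto_zero
  rw [ENNReal.toReal_zero] at h
  exact h

theorem IsRareSequence.eventually_lt_top {B : ℕ → Set X} (hB : IsRareSequence μ B) :
    ∀ᶠ n in atTop, μ (B n) < ∞ :=
  hB.tendsto_zero.eventually (gt_mem_nhds ENNReal.zero_lt_top)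

theorem IsRareSequence.eventually_real_pos {B : ℕ → Set X} (hB : IsRareSequence μ B) :
    ∀ᶠ n in atTop, 0 < μ.real (B n) := by
  filter_upwards [hB.eventually_lt_top] with n hn
  exact ENNReal.toReal_pos (hB.measure_ne_zero n) hn.ne

theorem IsRareSequence.tendsto_one_div {B : ℕ → Set X} (hB : IsRareSequence μ B) :
    Tendsto (fun n => 1 / (μ (B n)).toNNReal) atTop atTop := by
  rw [← NNReal.tendsto_coe_atTop]
  simp only [one_div, NNReal.coe_inv]
  refine tendsto_inv_nhdsGT_zero.comp (tendsto_nhdsWithin_iff.2 ⟨hB.tendsto_real, ?_⟩)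
  exact hB.eventually_real_pos

variable {B : ℕ → Set X} {a : ℕ → ℝ≥0} {b : ℝ≥0 → ℝ≥0} {α : ℝ}

theorem coe_scaling (b : ℝ≥0 → ℝ≥0) (s : ℝ≥0) : (scaling b s : ℝ) = (b (1 / s) : ℝ)⁻¹ := by
  rw [scaling, NNReal.coe_div, NNReal.coe_one]
  exact one_div _

theorem IsRareSequence.tendsto_asymptoticInverse (hB : IsRareSequence μ B)
    (hab : IsAsymptoticInverse a b) :
    Tendsto (fun n => (b (1 / (μ (B n)).toNNReal) : ℝ)) atTop atTop :=
  NNReal.tendsto_coe_atTop.2 (hab.tendsto_atTop.comp hB.tendsto_one_div)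

theorem IsRareSequence.eventually_scaling_pos (hB : IsRareSequence μ B)
    (hab : IsAsymptoticInverse a b) :
    ∀ᶠ n in atTop, 0 < scaling b (μ (B n)).toNNReal := by
  filter_upwards [(hB.tendsto_asymptoticInverse hab).eventually_gt_atTop 0] with n hn
  rw [scaling]
  exact one_div_pos.2 (NNReal.coe_pos.1 hn)

theorem IsRareSequence.tendsto_scaling (hB : IsRareSequence μ B)
    (hab : IsAsymptoticInverse a b) :
    Tendsto (fun n => (scaling b (μ (B n)).toNNReal : ℝ)) atTop (𝓝 0) := by
  simp only [coe_scaling]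
  exact tendsto_inv_atTop_zero.comp (hB.tendsto_asymptoticInverse hab)

/-- Duality moves the iterates from q to f. Since q lives on D ⊆ Y, the uniform estimate on Y
applies and the error is proportional to μ(D), which is needed because the main term itself is of
order μ(D). -/
theorem abs_sum_sub_le [SigmaFinite μ] (hT : Measure.QuasiMeasurePreserving T μ μ)
    {f : X → ℝ} (hf : Integrable f μ) {Y D : Set X} (hDm : MeasurableSet D) (hDY : D ⊆ Y)
    (hDfin : μ D < ∞) {m : ℕ} {c ε : ℝ}
    (h : ∀ᵐ x ∂(μ.restrict Y), |∑ k ∈ Finset.range m, (transferOp μ T)^[k] f x - c| ≤ ε)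
    {q : X → ℝ} (hq : Measurable q) (hq1 : ∀ x, |q x| ≤ 1) (hqD : ∀ x, x ∉ D → q x = 0) :
    |∑ k ∈ Finset.range m, ∫ x, f x * q (T^[k] x) ∂μ - c * ∫ x, q x ∂μ| ≤ ε * μ.real D := by
  have hqi : Integrable q μ := by
    refine Integrable.mono' (g := D.indicator fun _ => (1 : ℝ))
      ((integrable_indicator_iff hDm).2 (integrableOn_const hDfin.ne)) hq.aestronglyMeasurable
      (ae_of_all _ fun x => ?_)
    by_cases hx : x ∈ D
    · simpa [hx] using hq1 x
    · simp [hx, hqD x hx]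
  have hSi : ∀ k, Integrable (fun x => (transferOp μ T)^[k] f x * q x) μ := fun k =>
    (transferOp_iterate_integrable hT hf k).mul_bdd (c := 1) hq.aestronglyMeasurable
      (ae_of_all _ hq1)
  have e1 : ∑ k ∈ Finset.range m, ∫ x, f x * q (T^[k] x) ∂μ - c * ∫ x, q x ∂μ
      = ∫ x in D, (∑ k ∈ Finset.range m, (transferOp μ T)^[k] f x - c) * q x ∂μ := by
    rw [setIntegral_eq_integral_of_forall_compl_eq_zero fun x hx => by simp [hqD x hx]]
    simp only [sub_mul, Finset.sum_mul]
    rw [integral_sub (integrable_finsetSum _ fun k _ => hSi k) (hqi.const_mul c),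
      integral_finsetSum _ fun k _ => hSi k, integral_const_mul]
    congr 1
    exact Finset.sum_congr rfl fun k _ => integral_transferOp_iterate hT hf k hq hq1
  rw [e1, ← Real.norm_eq_abs]
  refine norm_setIntegral_le_of_norm_le_const_ae hDfin ?_
  filter_upwards [ae_restrict_of_ae_restrict_of_subset hDY h] with x hx
  rw [norm_mul]
  exact (mul_le_of_le_one_right (norm_nonneg _) (hq1 x)).trans hx

theorem abs_integral_mul_comp_le {f : X → ℝ} (hf : Integrable f μ)
    (hf0 : 0 ≤ᵐ[μ] f) {q : X → ℝ} (hq1 : ∀ x, |q x| ≤ 1) (k : ℕ) :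
    |∫ x, f x * q (T^[k] x) ∂μ| ≤ ∫ x, f x ∂μ := by
  rw [← Real.norm_eq_abs]
  refine norm_integral_le_of_norm_le hf ?_
  filter_upwards [hf0] with x hx
  rw [norm_mul, Real.norm_of_nonneg hx]
  exact mul_le_of_le_one_right hx (hq1 _)

/-- The Laplace transform of the visits of `q` compared to the one of a normalizing sequence. -/
theorem abs_tsum_sub_le [SigmaFinite μ] (hT : MeasurePreserving T μ μ)
    {f : X → ℝ} (hf : Integrable f μ) (hf0 : 0 ≤ᵐ[μ] f) {A : ℕ → ℝ} (hA0 : ∀ n, 0 ≤ A n)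
    {Y D : Set X} (hDm : MeasurableSet D) (hDY : D ⊆ Y)
    (hD1 : μ D < 1) {M : ℕ} {ε : ℝ} (hε : 0 ≤ ε)
    (h : ∀ m, M ≤ m → ∀ᵐ x ∂(μ.restrict Y),
      |∑ k ∈ Finset.range m, (transferOp μ T)^[k] f x - (∫ y, f y ∂μ) * A m| ≤ ε * A m)
    {q : X → ℝ} (hq : Measurable q) (hq1 : ∀ x, |q x| ≤ 1) (hqD : ∀ x, x ∉ D → q x = 0)
    {z : ℝ} (hz0 : 0 < z) (hz1 : z < 1) (hzA : Summable fun m => z ^ m * A m) :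
    |z * ∑' k, z ^ k * ∫ x, f x * q (T^[k] x) ∂μ
        - (∫ y, f y ∂μ) * ((1 - z) * ∑' m, z ^ m * A m) * ∫ x, q x ∂μ|
      ≤ ε * (((1 - z) * ∑' m, z ^ m * A m) * μ.real D)
        + (1 - z) * ∑ m ∈ Finset.range M, (∫ y, f y ∂μ) * (m + A m) := by
  set I := ∫ y, f y ∂μ with hI
  have hI0 : 0 ≤ I := integral_nonneg_of_ae hf0
  have hDfin : μ D < ∞ := hD1.trans ENNReal.one_lt_top
  have hDr : μ.real D ≤ 1 := by
    rw [measureReal_def, ← ENNReal.toReal_one]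
    exact ENNReal.toReal_mono ENNReal.one_ne_top hD1.le
  set x : ℕ → ℝ := fun k => ∫ x, f x * q (T^[k] x) ∂μ with hx
  have hxI : ∀ k, |x k| ≤ I := abs_integral_mul_comp_le hf hf0 hq1
  obtain ⟨-, hS, hE⟩ := mul_tsum_pow_mul hxI hz0 hz1
  set R := ∫ x, q x ∂μ with hR
  have hRle : |R| ≤ μ.real D := by
    rw [hR, ← setIntegral_eq_integral_of_forall_compl_eq_zero hqD, ← Real.norm_eq_abs]
    simpa using norm_setIntegral_le_of_norm_le_const (C := 1) (f := q) hDfin (fun x _ => hq1 x)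
  rw [hE, show (1 - z) * ∑' m, z ^ m * ∑ k ∈ Finset.range m, x k
      - I * ((1 - z) * ∑' m, z ^ m * A m) * R
      = (1 - z) * (∑' m, z ^ m * ∑ k ∈ Finset.range m, x k - I * R * ∑' m, z ^ m * A m) by ring,
    ← tsum_mul_left, ← hS.tsum_sub (hzA.mul_left _), abs_mul, abs_of_pos (sub_pos.2 hz1)]
  -- For m ≥ M the uniform estimate applies. The finitely many other terms are bounded crudely, with
  -- no factor μ(D), and become harmless once multiplied by 1 - z.
  have hterm : ∀ m, ‖z ^ m * ∑ k ∈ Finset.range m, x k - I * R * (z ^ m * A m)‖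
      ≤ ε * μ.real D * (z ^ m * A m) + if m ∈ Finset.range M then I * (m + A m) else 0 := by
    intro m
    have hzm : 0 ≤ z ^ m := by positivity
    rw [show z ^ m * ∑ k ∈ Finset.range m, x k - I * R * (z ^ m * A m)
      = z ^ m * (∑ k ∈ Finset.range m, x k - I * A m * R) by ring, norm_mul,
      Real.norm_of_nonneg hzm, Real.norm_eq_abs]
    by_cases hm : m < M
    · rw [if_pos (Finset.mem_range.2 hm)]
      have h1 : |∑ k ∈ Finset.range m, x k - I * A m * R| ≤ I * (m + A m) := by
        refine (abs_sub _ _).trans ?_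
        have h2 : |∑ k ∈ Finset.range m, x k| ≤ m * I := by
          refine (Finset.abs_sum_le_sum_abs _ _).trans ((Finset.sum_le_sum fun k _ => hxI k).trans ?_)
          simp
        have h3 : |I * A m * R| ≤ I * A m := by
          rw [abs_mul, abs_of_nonneg (mul_nonneg hI0 (hA0 m))]
          exact mul_le_of_le_one_right (mul_nonneg hI0 (hA0 m)) (hRle.trans hDr)
        linarith
      have h4 : z ^ m * |∑ k ∈ Finset.range m, x k - I * A m * R| ≤ I * (m + A m) :=
        (mul_le_of_le_one_left (abs_nonneg _) (pow_le_one₀ hz0.le hz1.le)).trans h1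
      have h5 : 0 ≤ ε * μ.real D * (z ^ m * A m) := by have := hA0 m; positivity
      linarith
    · rw [if_neg (by simpa using hm), add_zero]
      have := abs_sum_sub_le hT.quasiMeasurePreserving hf hDm hDY hDfin
        (h m (not_lt.1 hm)) hq hq1 hqD
      calc z ^ m * |∑ k ∈ Finset.range m, x k - I * A m * R| ≤ z ^ m * (ε * A m * μ.real D) := by
            gcongr
        _ = _ := by ring
  have hsum1 : Summable fun m => ε * μ.real D * (z ^ m * A m) := hzA.mul_left _
  have hfin := hasSum_sum_of_ne_finset_zero (s := Finset.range M)
    (L := SummationFilter.unconditional ℕ)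
    (f := fun m : ℕ => if m ∈ Finset.range M then I * (m + A m) else 0)
    (fun m hm => if_neg hm)
  have hbd := tsum_of_norm_bounded (hsum1.hasSum.add hfin) hterm
  rw [Real.norm_eq_abs, tsum_mul_left] at hbd
  rw [Finset.sum_congr rfl fun m hm => if_pos hm] at hbd
  calc _ ≤ (1 - z) * _ := mul_le_mul_of_nonneg_left hbd (sub_pos.2 hz1).le
    _ = _ := by ring

/-- In a system with a uniform set `Y`, the discounted number of visits to small subsets of `Y`. -/
theorem IsUniformSet.exists_tendsto_discounted_visits [SigmaFinite μ] (hT : MeasurePreserving T μ μ)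
    {Y : Set X} (hY : IsUniformSet μ T Y a) (hα₀ : 0 < α) (hα₁ : α ≤ 1)
    (ha : IsRegularlyVarying a α) (hab : IsAsymptoticInverse a b) (hB : IsRareSequence μ B)
    (hBY : ∀ n, B n ⊆ Y) :
    ∃ f : X → ℝ, Integrable f μ ∧ 0 ≤ᵐ[μ] f ∧ ∫ x, f x ∂μ = 1 ∧
      ∀ s : ℝ, 0 < s → ∀ q : ℕ → X → ℝ, (∀ n, Measurable (q n)) → (∀ n x, |q n x| ≤ 1) →
        (∀ n x, x ∉ B n → q n x = 0) →
        Tendsto (fun n => ∑' k : ℕ, Real.exp (-(s * scaling b (μ (B n)).toNNReal)) ^ k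
            * ∫ x, f x * q n (T^[k] x) ∂μ
          - Real.Gamma (1 + α) * s ^ (-α) * ((∫ x, q n x ∂μ) / μ.real (B n))) atTop (𝓝 0) := by
  obtain ⟨f, A, hfi, hf0, hI, hAm, hA0, hAa, hunif⟩ :=
    hY.exists_monotone hT.quasiMeasurePreserving
  set I := ∫ x, f x ∂μ with hIdef
  have hRV : ∀ y : ℝ, 0 < y → Tendsto (fun x : ℝ => A ⌊x * y⌋₊ / A ⌊x⌋₊) atTop (𝓝 (y ^ α)) :=
    fun y hy => ha.real hAa hy
  obtain ⟨hsummable, hlap⟩ := tendsto_laplace_of_regularlyVarying hAm hA0 hα₀ hα₁ hRV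
  refine ⟨fun x => f x / I, hfi.div_const I, ?_, by rw [integral_div, div_self hI.ne'], ?_⟩
  · filter_upwards [hf0] with x hx
    exact div_nonneg hx hI.le
  intro s hs q hq hq1 hqB
  set β : ℕ → ℝ := fun n => b (1 / (μ (B n)).toNNReal) with hβ
  have hβlim : Tendsto β atTop atTop := hB.tendsto_asymptoticInverse hab
  have hxlim : Tendsto (fun n => β n / s) atTop atTop := hβlim.atTop_div_const hs
  set z : ℕ → ℝ := fun n => Real.exp (-(s * scaling b (μ (B n)).toNNReal)) with hz
  have hzx : ∀ n, Real.exp (-(1 / (β n / s))) = z n := by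
    intro n
    simp only [hz, hβ, coe_scaling, one_div, inv_div]
    rfl
  have hzlim : Tendsto z atTop (𝓝 1) := by
    have := (Real.continuous_exp.tendsto _).comp ((hB.tendsto_scaling hab).const_mul s).neg
    rw [mul_zero, neg_zero, Real.exp_zero] at this
    exact this
  have hz0 : ∀ n, 0 < z n := fun n => Real.exp_pos _
  have hz1 : ∀ᶠ n in atTop, z n < 1 := by
    filter_upwards [hB.eventually_scaling_pos hab] with n hn
    exact Real.exp_lt_one_iff.2 (neg_neg_iff_pos.2 (mul_pos hs hn))
  set K : ℕ → ℝ := fun n => (1 - z n) * ∑' m, z n ^ m * A m with hK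
  set c := Real.Gamma (1 + α) * s ^ (-α) with hc
  -- The discount exp(-sγₙ) is exp(-1/x) at x = β/s with β = b(1/μ(Bₙ)). Hence K ∼ Γ(1+α) A(β/s) ∼
  -- Γ(1+α) s^(-α) A(β), and A(β) ∼ a(β) ∼ 1/μ(Bₙ) because b is an asymptotic inverse of a.
  have hKlim : Tendsto (fun n => K n * μ.real (B n)) atTop (𝓝 c) := by
    have h1 : Tendsto (fun n => K n / A ⌊β n / s⌋₊) atTop (𝓝 (Real.Gamma (1 + α))) := by
      refine (hlap.comp hxlim).congr fun n => ?_
      simp only [Function.comp, hzx, hK]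
    have h2 : Tendsto (fun n => A ⌊β n / s⌋₊ / A ⌊β n⌋₊) atTop (𝓝 (s ^ (-α))) := by
      have := (hRV s⁻¹ (inv_pos.2 hs)).comp hβlim
      rw [Real.inv_rpow hs.le, ← Real.rpow_neg hs.le] at this
      exact this
    have h3 : Tendsto (fun n => (a ⌊β n⌋₊ : ℝ) * μ.real (B n)) atTop (𝓝 1) := by
      have := NNReal.tendsto_coe.2 (hab.left.comp hB.tendsto_one_div)
      refine this.congr fun n => ?_
      simp only [Function.comp, one_div, div_inv_eq_mul, NNReal.coe_mul, hβ]
      congr 3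
    have h4 : Tendsto (fun n => A ⌊β n⌋₊ / a ⌊β n⌋₊) atTop (𝓝 1) :=
      hAa.comp (tendsto_nat_floor_atTop.comp hβlim)
    have hprod := ((h1.mul h2).mul h4).mul h3
    rw [mul_one, mul_one] at hprod
    refine hprod.congr' ?_
    have e1 := eventually_pos_of_regularlyVarying hA0 hRV
    filter_upwards [hxlim.eventually e1, hβlim.eventually e1,
      h4.eventually (lt_mem_nhds one_half_lt_one)] with n g1 g2 g3
    have g4 : (a ⌊β n⌋₊ : ℝ) ≠ 0 := fun h0 => by
      rw [h0, div_zero] at g3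
      norm_num at g3
    field_simp
  set S : ℕ → ℝ := fun n => ∑' k : ℕ, z n ^ k * ∫ x, f x * q n (T^[k] x) ∂μ with hS
  set R : ℕ → ℝ := fun n => ∫ x, q n x ∂μ with hR
  have hmain : Tendsto (fun n => z n * S n - I * K n * R n) atTop (𝓝 0) := by
    rw [Metric.tendsto_nhds]
    intro ε hε
    have hc0 : 0 ≤ c := mul_nonneg (Real.Gamma_pos_of_pos (by linarith)).le (by positivity)
    set η := ε / (2 * (c + 1)) with hη
    have hηpos : 0 < η := by positivity
    obtain ⟨M, hM⟩ := eventually_atTop.1 (hunif η hηpos)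
    set C := ∑ m ∈ Finset.range M, I * (m + A m) with hC
    have hlim : Tendsto (fun n => η * (K n * μ.real (B n)) + (1 - z n) * C) atTop
        (𝓝 (η * c + (1 - 1) * C)) :=
      (hKlim.const_mul η).add ((hzlim.const_sub 1).mul_const C)
    have hlt : η * c + (1 - 1) * C < ε := by
      have : η * (2 * (c + 1)) = ε := div_mul_cancel₀ _ (by positivity)
      nlinarith
    filter_upwards [hlim.eventually (gt_mem_nhds hlt), hz1, hxlim.eventually hsummable,
      hB.tendsto_zero.eventually (gt_mem_nhds one_pos)] with n g1 g2 g3 g4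
    rw [dist_zero_right, Real.norm_eq_abs]
    refine lt_of_le_of_lt ?_ g1
    rw [hzx] at g3
    exact abs_tsum_sub_le hT hfi hf0 hA0 (hB.measurableSet n) (hBY n) g4 hηpos.le hM (hq n)
      (hq1 n) (hqB n) (hz0 n) g2 g3
  set ρ : ℕ → ℝ := fun n => R n / μ.real (B n) with hρ
  have hρ1 : ∀ᶠ n in atTop, |ρ n| ≤ 1 := by
    filter_upwards [hB.eventually_lt_top, hB.eventually_real_pos] with n g1 g2
    rw [hρ, abs_div, abs_of_pos g2, div_le_one g2, hR]
    dsimp only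
    rw [← setIntegral_eq_integral_of_forall_compl_eq_zero (hqB n), ← Real.norm_eq_abs]
    simpa using norm_setIntegral_le_of_norm_le_const (C := 1) (f := q n) g1 (fun x _ => hq1 n x)
  -- The normalized integral ρ need not converge, but it is eventually bounded by 1; this is why the
  -- statement asserts that a difference tends to 0.
  have hbddmul : ∀ w : ℕ → ℝ, Tendsto w atTop (𝓝 0) →
      Tendsto (fun n => w n * ρ n) atTop (𝓝 0) := by
    intro w hw
    refine squeeze_zero_norm' ?_ (by simpa using hw.norm)
    filter_upwards [hρ1] with n hn
    rw [norm_mul]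
    exact mul_le_of_le_one_right (norm_nonneg _) hn
  have h5 : Tendsto (fun n => (K n * μ.real (B n) - c) * ρ n) atTop (𝓝 0) :=
    hbddmul _ (by simpa using hKlim.sub_const c)
  have h6 : Tendsto (fun n => (1 - z n) * ρ n) atTop (𝓝 0) :=
    hbddmul _ (by simpa using hzlim.const_sub 1)
  have h7 : Tendsto (fun n => ((z n * S n - I * K n * R n) / I
      + (K n * μ.real (B n) - c) * ρ n + c * ((1 - z n) * ρ n)) / z n) atTop (𝓝 0) := by
    have := (((hmain.div_const I).add h5).add (h6.const_mul c)).div hzlim one_ne_zero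
    rw [zero_div, mul_zero, add_zero, add_zero, zero_div] at this
    exact this
  refine h7.congr' ?_
  filter_upwards [hB.eventually_real_pos] with n hn
  have e1 : ∀ k : ℕ, z n ^ k * ∫ x, f x / I * q n (T^[k] x) ∂μ
      = z n ^ k * (∫ x, f x * q n (T^[k] x) ∂μ) / I := by
    intro k
    rw [mul_div_assoc, ← integral_div]
    congr 2
    ext x
    ring
  have e2 : ∑' k : ℕ, z n ^ k * ∫ x, f x / I * q n (T^[k] x) ∂μ = S n / I := by
    rw [tsum_congr e1, tsum_div_const]
  refine Eq.trans ?_ (congrArg (fun y => y - c * (R n / μ.real (B n))) e2).symm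
  dsimp only [ρ]
  have hzn := (hz0 n).ne'
  field_simp
  ring

end Discounted


/-! ### Combinatorics and measurability of return times and induced maps -/

section ReturnTime

variable {X : Type*} {T : X → X} {A : Set X}

/-- Removes the infimum in `ℕ∞` once and for all; the facts on finite return times below rest on
this form. -/
theorem returnTime_succ_eq_coe_iff {k : ℕ} {x : X} {m : ℕ} :
    returnTime T A (k + 1) x = m ↔ returnTime T A k x < m ∧ T^[m] x ∈ A ∧
      ∀ j : ℕ, returnTime T A k x < j → T^[j] x ∈ A → m ≤ j := by
  set S : Set ℕ∞ := {n : ℕ∞ | returnTime T A k x < n ∧ ∃ m : ℕ, n = m ∧ T^[m] x ∈ A} with hS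
  change sInf S = m ↔ _
  constructor
  · intro h
    have hne : S.Nonempty := by
      by_contra hcon
      rw [not_nonempty_iff_eq_empty.1 hcon, sInf_empty] at h
      exact ENat.top_ne_natCast m h
    obtain ⟨h1, m', h2, h3⟩ := csInf_mem hne
    rw [h] at h1 h2
    rw [← Nat.cast_inj.1 h2] at h3
    refine ⟨h1, h3, fun j hj1 hj2 => ?_⟩
    have : sInf S ≤ j := sInf_le ⟨hj1, j, rfl, hj2⟩
    rw [h] at this
    exact_mod_cast this
  · rintro ⟨h1, h2, h3⟩
    refine le_antisymm (sInf_le ⟨h1, m, rfl, h2⟩) (le_sInf ?_)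
    rintro n ⟨hn1, j, rfl, hj⟩
    exact_mod_cast h3 j hn1 hj

theorem returnTime_succ_eq_top_iff {k : ℕ} {x : X} :
    returnTime T A (k + 1) x = ⊤ ↔ ∀ j : ℕ, returnTime T A k x < j → T^[j] x ∉ A := by
  set S : Set ℕ∞ := {n : ℕ∞ | returnTime T A k x < n ∧ ∃ m : ℕ, n = m ∧ T^[m] x ∈ A} with hS
  change sInf S = ⊤ ↔ _
  rw [sInf_eq_top]
  constructor
  · intro h j hj1 hj2
    exact ENat.natCast_ne_top j (h j ⟨hj1, j, rfl, hj2⟩)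
  · rintro h n ⟨hn1, j, rfl, hj⟩
    exact absurd hj (h j hn1)

theorem returnTime_one_eq_coe_iff {x : X} {m : ℕ} :
    returnTime T A 1 x = m ↔ 0 < m ∧ T^[m] x ∈ A ∧ ∀ j : ℕ, 0 < j → T^[j] x ∈ A → m ≤ j := by
  rw [returnTime_succ_eq_coe_iff]
  simp [returnTime]

theorem returnTime_one_eq_top_iff {x : X} :
    returnTime T A 1 x = ⊤ ↔ ∀ j : ℕ, 0 < j → T^[j] x ∉ A := by
  rw [returnTime_succ_eq_top_iff]
  simp [returnTime]

theorem coe_lt_returnTime_one_iff {x : X} {m : ℕ} :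
    (m : ℕ∞) < returnTime T A 1 x ↔ ∀ j : ℕ, 0 < j → j ≤ m → T^[j] x ∉ A := by
  rcases eq_or_ne (returnTime T A 1 x) ⊤ with h | h
  · rw [h]
    simp only [ENat.natCast_lt_top, true_iff]
    exact fun j hj _ => returnTime_one_eq_top_iff.1 h j hj
  · obtain ⟨n, hn⟩ := ENat.ne_top_iff_exists.1 h
    rw [← hn, Nat.cast_lt]
    obtain ⟨h1, h2, h3⟩ := returnTime_one_eq_coe_iff.1 hn.symm
    constructor
    · intro hmn j hj hjm hjA
      have := h3 j hj hjA
      omega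
    · intro hall
      by_contra hcon
      exact hall n h1 (not_lt.1 hcon) h2

/-- Before the first return, the return time decreases along the orbit. -/
theorem returnTime_one_eq_add {x : X} {m : ℕ} (h : (m : ℕ∞) < returnTime T A 1 x) :
    returnTime T A 1 x = returnTime T A 1 (T^[m] x) + m := by
  have hm := coe_lt_returnTime_one_iff.1 h
  rcases eq_or_ne (returnTime T A 1 (T^[m] x)) ⊤ with h' | h'
  · rw [h', top_add, returnTime_one_eq_top_iff]
    rw [returnTime_one_eq_top_iff] at h'
    intro j hj
    rcases le_or_gt j m with hjm | hjm
    · exact hm j hj hjm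
    · have := h' (j - m) (by omega)
      rwa [← Function.iterate_add_apply, Nat.sub_add_cancel hjm.le] at this
  · obtain ⟨n, hn⟩ := ENat.ne_top_iff_exists.1 h'
    obtain ⟨h1, h2, h3⟩ := returnTime_one_eq_coe_iff.1 hn.symm
    rw [← hn, ← Nat.cast_add, returnTime_one_eq_coe_iff]
    rw [← Function.iterate_add_apply] at h2
    refine ⟨by omega, h2, fun j hj hjA => ?_⟩
    rcases le_or_gt j m with hjm | hjm
    · exact absurd hjA (hm j hj hjm)
    · have := h3 (j - m) (by omega) (by
        rwa [← Function.iterate_add_apply, Nat.sub_add_cancel hjm.le])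
      omega

theorem inducedMap_eq_of_lt {x : X} {m : ℕ} (h : (m : ℕ∞) < returnTime T A 1 x)
    (hfin : returnTime T A 1 x ≠ ⊤) : inducedMap T A x = inducedMap T A (T^[m] x) := by
  have hadd := returnTime_one_eq_add h
  have hfin' : returnTime T A 1 (T^[m] x) ≠ ⊤ := fun h' => hfin (by rw [hadd, h', top_add])
  obtain ⟨n, hn⟩ := ENat.ne_top_iff_exists.1 hfin'
  rw [inducedMap, inducedMap, hadd, ← hn, ← Nat.cast_add, ENat.toNat_natCast, ENat.toNat_natCast,
    Function.iterate_add_apply]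

theorem returnTime_one_of_mem {x : X} (h : T x ∈ A) : returnTime T A 1 x = 1 := by
  have := (returnTime_one_eq_coe_iff (T := T) (A := A) (x := x) (m := 1)).2
    ⟨one_pos, h, fun j hj _ => hj⟩
  simpa using this

theorem inducedMap_of_mem {x : X} (h : T x ∈ A) : inducedMap T A x = T x := by
  rw [inducedMap, returnTime_one_of_mem h]
  rfl

theorem inducedMap_mem {x : X} (h : returnTime T A 1 x ≠ ⊤) : inducedMap T A x ∈ A := by
  obtain ⟨n, hn⟩ := ENat.ne_top_iff_exists.1 h
  rw [inducedMap, ← hn, ENat.toNat_natCast]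
  exact (returnTime_one_eq_coe_iff.1 hn.symm).2.1

/-- Successive return times are the return times of the induced map. -/
theorem returnTime_succ_eq_add {x : X} (h : returnTime T A 1 x ≠ ⊤) (k : ℕ) :
    returnTime T A (k + 1) x = returnTime T A 1 x + returnTime T A k (inducedMap T A x) := by
  obtain ⟨n, hn⟩ := ENat.ne_top_iff_exists.1 h
  have hT : inducedMap T A x = T^[n] x := by rw [inducedMap, ← hn, ENat.toNat_natCast]
  rw [hT]
  induction k with
  | zero => simp [returnTime]
  | succ k ih =>
    have hlt : ∀ j : ℕ, returnTime T A k (T^[n] x) < j ↔ returnTime T A (k + 1) x < (j + n : ℕ) := by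
      intro j
      rw [ih, ← hn, Nat.cast_add, add_comm (n : ℕ∞)]
      exact (ENat.add_lt_add_iff_right (ENat.natCast_ne_top n)).symm
    have hge : ∀ j : ℕ, returnTime T A (k + 1) x < j → n < j := by
      intro j hj
      rw [ih, ← hn] at hj
      exact_mod_cast lt_of_le_of_lt le_self_add hj
    rcases eq_or_ne (returnTime T A (k + 1) (T^[n] x)) ⊤ with h' | h'
    · rw [h', add_top, returnTime_succ_eq_top_iff]
      rw [returnTime_succ_eq_top_iff] at h'
      intro j hj
      have hnj := hge j hj
      have := h' (j - n) ((hlt _).2 (by rwa [Nat.sub_add_cancel hnj.le]))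
      rwa [← Function.iterate_add_apply, Nat.sub_add_cancel hnj.le] at this
    · obtain ⟨m, hm⟩ := ENat.ne_top_iff_exists.1 h'
      obtain ⟨h1, h2, h3⟩ := returnTime_succ_eq_coe_iff.1 hm.symm
      rw [← Function.iterate_add_apply] at h2
      rw [← hm, ← hn, ← Nat.cast_add, returnTime_succ_eq_coe_iff, add_comm n m]
      refine ⟨(hlt m).1 h1, h2, fun j hj hjA => ?_⟩
      have hnj := hge j hj
      have := h3 (j - n) ((hlt _).2 (by rwa [Nat.sub_add_cancel hnj.le]))
        (by rwa [← Function.iterate_add_apply, Nat.sub_add_cancel hnj.le])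
      omega

theorem returnTime_ne_top {x : X} (h : ∀ n, ∃ k, n < k ∧ T^[k] x ∈ A) (k : ℕ) :
    returnTime T A k x ≠ ⊤ := by
  induction k with
  | zero => simp [returnTime]
  | succ k ih =>
    obtain ⟨m, hm⟩ := ENat.ne_top_iff_exists.1 ih
    obtain ⟨j, hj, hjA⟩ := h m
    intro htop
    exact returnTime_succ_eq_top_iff.1 htop j (by rw [← hm]; exact_mod_cast hj) hjA

theorem frequently_visit_iterate {x : X} (h : ∀ n, ∃ k, n < k ∧ T^[k] x ∈ A) (m : ℕ) :
    ∀ n, ∃ k, n < k ∧ T^[k] (T^[m] x) ∈ A := by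
  intro n
  obtain ⟨k, hk, hkA⟩ := h (n + m)
  exact ⟨k - m, by omega, by rwa [← Function.iterate_add_apply, Nat.sub_add_cancel (by omega)]⟩

theorem returnTime_lt_succ {x : X} {k : ℕ} (h : returnTime T A (k + 1) x ≠ ⊤) :
    returnTime T A k x < returnTime T A (k + 1) x := by
  obtain ⟨m, hm⟩ := ENat.ne_top_iff_exists.1 h
  rw [← hm]
  exact (returnTime_succ_eq_coe_iff.1 hm.symm).1

/-! ### Measurability -/

variable [MeasurableSpace X]

theorem measurable_returnTime (hT : Measurable T) (hA : MeasurableSet A) (k : ℕ) :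
    Measurable (returnTime T A k) := by
  induction k with
  | zero => exact measurable_const
  | succ k ih =>
    have hlt : ∀ j : ℕ, MeasurableSet {x | returnTime T A k x < j} := fun j =>
      ih (to_countable _).measurableSet
    have hcoe : ∀ m : ℕ, MeasurableSet (returnTime T A (k + 1) ⁻¹' {(m : ℕ∞)}) := by
      intro m
      have : returnTime T A (k + 1) ⁻¹' {(m : ℕ∞)} = {x | returnTime T A k x < m} ∩ (T^[m] ⁻¹' A) ∩
          ⋂ j : ℕ, ({x | returnTime T A k x < j} ∩ (T^[j] ⁻¹' A) ∩ {_x | j < m})ᶜ := by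
        ext x
        simp only [mem_preimage, mem_singleton_iff, returnTime_succ_eq_coe_iff, mem_inter_iff,
          mem_ofPred_eq, mem_iInter, mem_compl_iff, not_and, not_lt, and_assoc]
      rw [this]
      exact ((hlt m).inter (hT.iterate m hA)).inter (.iInter fun j =>
        (((hlt j).inter (hT.iterate j hA)).inter (.const _)).compl)
    refine measurable_to_countable' fun n => ?_
    induction n using ENat.recTopCoe with
    | coe m => exact hcoe m
    | top =>
      have : returnTime T A (k + 1) ⁻¹' {(⊤ : ℕ∞)}
          = (⋃ m : ℕ, returnTime T A (k + 1) ⁻¹' {(m : ℕ∞)})ᶜ := by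
        ext x
        simp only [mem_preimage, mem_singleton_iff, mem_compl_iff, mem_iUnion, not_exists]
        rw [← not_iff_not, not_forall_not]
        exact ENat.ne_top_iff_exists.trans ⟨fun ⟨m, h⟩ => ⟨m, h.symm⟩, fun ⟨m, h⟩ => ⟨m, h.symm⟩⟩
      rw [this]
      exact (MeasurableSet.iUnion hcoe).compl

theorem measurable_iterate_apply (hT : Measurable T) {n : X → ℕ} (hn : Measurable n) :
    Measurable fun x => T^[n x] x := by
  intro S hS
  have : (fun x => T^[n x] x) ⁻¹' S = ⋃ k : ℕ, (n ⁻¹' {k}) ∩ (T^[k] ⁻¹' S) := by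
    ext x
    simp
  rw [this]
  exact .iUnion fun k => (hn (measurableSet_singleton k)).inter (hT.iterate k hS)

/-- The preimage of a set S under a random iterate is contained in the countable union of the T⁻ᵏS.
-/
theorem quasiMeasurePreserving_iterate_apply {μ : Measure X}
    (hT : Measure.QuasiMeasurePreserving T μ μ) {n : X → ℕ} (hn : Measurable n) :
    Measure.QuasiMeasurePreserving (fun x => T^[n x] x) μ μ := by
  refine ⟨measurable_iterate_apply hT.measurable hn, Measure.AbsolutelyContinuous.mk
    fun S hS hS0 => ?_⟩
  rw [Measure.map_apply (measurable_iterate_apply hT.measurable hn) hS]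
  refine measure_mono_null (t := ⋃ k : ℕ, T^[k] ⁻¹' S) (fun x hx => mem_iUnion.2 ⟨n x, hx⟩) ?_
  exact measure_iUnion_null fun k => (hT.iterate k).preimage_null hS0

theorem measurable_inducedMap (hT : Measurable T) (hA : MeasurableSet A) :
    Measurable (inducedMap T A) :=
  measurable_iterate_apply hT ((measurable_of_countable ENat.toNat).comp
    (measurable_returnTime hT hA 1))

end ReturnTime

/-! ### Discounted functionals of the first return -/

section DiscountedReturn

variable {X : Type*} {T : X → X} {A : Set X}

open Classical in
/-- The functional `exp (-σ r_A) · g ∘ T_A`, set to `0` where `r_A = ∞`. -/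
noncomputable def discounted (T : X → X) (A : Set X) (σ : ℝ) (g : X → ℝ) (x : X) : ℝ :=
  if returnTime T A 1 x = ⊤ then 0
  else Real.exp (-(σ * (returnTime T A 1 x).toNat)) * g (inducedMap T A x)

variable {σ : ℝ} {g : X → ℝ}

theorem measurable_discounted [MeasurableSpace X] (hT : Measurable T) (hA : MeasurableSet A) (hg : Measurable g) :
    Measurable (discounted T A σ g) := by
  have h1 := measurable_returnTime hT hA 1
  refine Measurable.ite (h1 (measurableSet_singleton _)) measurable_const ?_
  exact ((measurable_of_countable fun n : ℕ∞ => Real.exp (-(σ * n.toNat))).comp h1).mul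
    (hg.comp (measurable_inducedMap hT hA))

theorem discounted_nonneg (hg : ∀ x, 0 ≤ g x) (x : X) : 0 ≤ discounted T A σ g x := by
  rw [discounted]
  split_ifs
  · exact le_rfl
  · exact mul_nonneg (Real.exp_pos _).le (hg _)

theorem discounted_le_one (hσ : 0 ≤ σ) (hg : ∀ x, 0 ≤ g x) (hg1 : ∀ x, g x ≤ 1) (x : X) :
    discounted T A σ g x ≤ 1 := by
  rw [discounted]
  split_ifs
  · exact zero_le_one
  · exact mul_le_one₀ (Real.exp_le_one_iff.2 (neg_nonpos.2 (by positivity))) (hg _) (hg1 _)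

/-- Before the first return, moving along the orbit only restarts the clock: the induced map is
unchanged and the return time drops by m. -/
theorem discounted_of_lt {x : X} {m : ℕ} (h : (m : ℕ∞) < returnTime T A 1 x) :
    discounted T A σ g x = Real.exp (-(σ * m)) * discounted T A σ g (T^[m] x) := by
  have hadd := returnTime_one_eq_add h
  by_cases hfin : returnTime T A 1 x = ⊤
  · have : returnTime T A 1 (T^[m] x) = ⊤ := by
      by_contra h'
      obtain ⟨n, hn⟩ := ENat.ne_top_iff_exists.1 h'
      rw [hfin, ← hn, ← Nat.cast_add] at hadd
      exact ENat.top_ne_natCast _ hadd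
    simp [discounted, hfin, this]
  · have hfin' : returnTime T A 1 (T^[m] x) ≠ ⊤ := fun h' => hfin (by rw [hadd, h', top_add])
    obtain ⟨n, hn⟩ := ENat.ne_top_iff_exists.1 hfin'
    rw [discounted, discounted, if_neg hfin, if_neg hfin', inducedMap_eq_of_lt h hfin, hadd, ← hn,
      ← Nat.cast_add, ENat.toNat_natCast, ENat.toNat_natCast, ← mul_assoc, ← Real.exp_add]
    congr 2
    push_cast
    ring

theorem discounted_of_mem {x : X} (h : T x ∈ A) :
    discounted T A σ g x = Real.exp (-σ) * g (T x) := by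
  rw [discounted, returnTime_one_of_mem h, inducedMap_of_mem h, if_neg ENat.one_ne_top]
  simp

theorem discounted_of_notMem {x : X} (h : T x ∉ A) :
    discounted T A σ g x = Real.exp (-σ) * discounted T A σ g (T x) := by
  have h1 : ((1 : ℕ) : ℕ∞) < returnTime T A 1 x := by
    rw [coe_lt_returnTime_one_iff]
    intro j hj hj1
    obtain rfl : j = 1 := by omega
    exact h
  simpa using discounted_of_lt (σ := σ) (g := g) h1

end DiscountedReturn


/-! ### First relation: hitting functional against return functional -/

section Relation

variable {X : Type*} [MeasurableSpace X] {μ : Measure X} {T : X → X}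

theorem integrable_mul_of_mem_Icc {f ψ : X → ℝ} (hf : Integrable f μ) (hψ : Measurable ψ)
    (h0 : ∀ x, 0 ≤ ψ x) (h1 : ∀ x, ψ x ≤ 1) : Integrable (fun x => f x * ψ x) μ :=
  hf.mul_bdd (c := 1) hψ.aestronglyMeasurable
    (ae_of_all _ fun x => by rw [Real.norm_of_nonneg (h0 x)]; exact h1 x)

/-- The visits to `A`, decomposed with respect to the last one. -/
theorem integral_discounted_add [SigmaFinite μ] (hT : MeasurePreserving T μ μ) {f : X → ℝ}
    (hf : Integrable f μ) (hf0 : 0 ≤ᵐ[μ] f) {A : Set X} (hA : MeasurableSet A) {σ : ℝ} (hσ : 0 < σ)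
    {g : X → ℝ} (hg : Measurable g) (hg0 : ∀ x, 0 ≤ g x) (hg1 : ∀ x, g x ≤ 1) :
    ∫ x, f x * discounted T A σ g x ∂μ
        + ∫ x, f x * A.indicator (fun y => g y - discounted T A σ g y) x ∂μ
      = ∑' k : ℕ, Real.exp (-σ) ^ k
          * ∫ x, f x * A.indicator (fun y => g y - discounted T A σ g y) (T^[k] x) ∂μ := by
  set Ψ := discounted T A σ g with hΨ
  have hTm := hT.measurable
  have hΨm : Measurable Ψ := measurable_discounted hTm hA hg
  have hΨ0 : ∀ x, 0 ≤ Ψ x := discounted_nonneg hg0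
  have hΨ1 : ∀ x, Ψ x ≤ 1 := discounted_le_one hσ.le hg0 hg1
  set q := A.indicator (fun y => g y - Ψ y) with hq
  have hqm : Measurable q := (hg.sub hΨm).indicator hA
  have hq1 : ∀ x, |q x| ≤ 1 := by
    intro x
    by_cases hx : x ∈ A
    · rw [hq, indicator_of_mem hx, abs_le]
      constructor <;> linarith [hg0 x, hg1 x, hΨ0 x, hΨ1 x]
    · simp [hq, hx]
  set z := Real.exp (-σ) with hz
  have hz0 : 0 < z := Real.exp_pos _
  have hz1 : z < 1 := Real.exp_lt_one_iff.2 (by linarith)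
  have hqi : ∀ k, Integrable (fun x => f x * q (T^[k] x)) μ := fun k =>
    hf.mul_bdd (c := 1) (hqm.comp (hTm.iterate k)).aestronglyMeasurable
      (ae_of_all _ fun x => hq1 _)
  have hΨi : ∀ k, Integrable (fun x => f x * Ψ (T^[k] x)) μ := fun k =>
    integrable_mul_of_mem_Icc hf (hΨm.comp (hTm.iterate k)) (fun x => hΨ0 _) (fun x => hΨ1 _)
  -- One step of the orbit costs a factor z. If T x lies in A the functional stops with the value g,
  -- which is q + Ψ there; outside A, q vanishes. Iterating this single formula produces the
  -- discounted sum of visits.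
  have hstep : ∀ x, Ψ x = z * (q (T x) + Ψ (T x)) := by
    intro x
    by_cases hx : T x ∈ A
    · rw [hΨ, discounted_of_mem hx, hq, indicator_of_mem hx]; simp [hΨ, hz]
    · rw [hΨ, discounted_of_notMem hx, hq, indicator_of_notMem hx, hz]; simp
  have hiter : ∀ K : ℕ, ∫ x, f x * Ψ x ∂μ + ∫ x, f x * q x ∂μ
      = ∑ k ∈ Finset.range K, z ^ k * ∫ x, f x * q (T^[k] x) ∂μ
        + z ^ K * (∫ x, f x * Ψ (T^[K] x) ∂μ + ∫ x, f x * q (T^[K] x) ∂μ) := by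
    intro K
    induction K with
    | zero => simp
    | succ K ih =>
      have e1 : ∫ x, f x * Ψ (T^[K] x) ∂μ
          = z * (∫ x, f x * Ψ (T^[K + 1] x) ∂μ + ∫ x, f x * q (T^[K + 1] x) ∂μ) := by
        rw [← integral_add (hΨi _) (hqi _), ← integral_const_mul]
        congr 1
        ext x
        rw [hstep (T^[K] x), Function.iterate_succ_apply']
        ring
      rw [ih, Finset.sum_range_succ, e1]
      ring
  have hxI : ∀ k, |∫ x, f x * q (T^[k] x) ∂μ| ≤ ∫ x, f x ∂μ :=
    abs_integral_mul_comp_le hf hf0 hq1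
  have hsum := (mul_tsum_pow_mul hxI hz0 hz1).1
  refine tendsto_nhds_unique (f := fun K : ℕ =>
    ∑ k ∈ Finset.range K, z ^ k * ∫ x, f x * q (T^[k] x) ∂μ
        + z ^ K * (∫ x, f x * Ψ (T^[K] x) ∂μ + ∫ x, f x * q (T^[K] x) ∂μ)) (l := atTop) ?_ ?_
  · exact tendsto_const_nhds.congr hiter
  · have hb : ∀ K, |∫ x, f x * Ψ (T^[K] x) ∂μ + ∫ x, f x * q (T^[K] x) ∂μ|
        ≤ ∫ x, f x ∂μ + ∫ x, f x ∂μ := fun K =>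
      (abs_add_le _ _).trans (add_le_add (abs_integral_mul_comp_le hf hf0
        (fun x => by rw [abs_of_nonneg (hΨ0 x)]; exact hΨ1 x) K) (hxI K))
    have h0 : Tendsto (fun K : ℕ =>
        z ^ K * (∫ x, f x * Ψ (T^[K] x) ∂μ + ∫ x, f x * q (T^[K] x) ∂μ)) atTop (𝓝 0) := by
      refine squeeze_zero_norm (a := fun K : ℕ => z ^ K * (∫ x, f x ∂μ + ∫ x, f x ∂μ))
        (fun K => ?_) ?_
      · rw [norm_mul, Real.norm_of_nonneg (by positivity)]
        gcongr
        exact hb K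
      · simpa using (tendsto_pow_atTop_nhds_zero_of_lt_one hz0.le hz1).mul_const _
    simpa using hsum.hasSum.tendsto_sum_nat.add h0

variable {B : ℕ → Set X} {a : ℕ → ℝ≥0} {b : ℝ≥0 → ℝ≥0} {α : ℝ}

/-- Absolute continuity of the integral of |f| over sets whose measure tends to 0. -/
theorem IsRareSequence.tendsto_integral_mul_indicator [SigmaFinite μ] (hB : IsRareSequence μ B)
    {f : X → ℝ} (hf : Integrable f μ) {q : ℕ → X → ℝ} (hq1 : ∀ n x, |q n x| ≤ 1)
    (hqB : ∀ n x, x ∉ B n → q n x = 0) :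
    Tendsto (fun n => ∫ x, f x * q n x ∂μ) atTop (𝓝 0) := by
  refine squeeze_zero_norm (fun n => ?_)
    (hf.norm.tendsto_setIntegral_nhds_zero hB.tendsto_zero)
  rw [← integral_indicator (hB.measurableSet n)]
  refine norm_integral_le_of_norm_le (hf.norm.indicator (hB.measurableSet n))
    (ae_of_all _ fun x => ?_)
  by_cases hx : x ∈ B n
  · rw [indicator_of_mem hx, norm_mul]
    exact mul_le_of_le_one_right (norm_nonneg _) (hq1 n x)
  · rw [hqB n x hx, mul_zero, norm_zero, indicator_of_notMem hx]

/-- The relation between the hitting and the return functionals. -/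
theorem IsUniformSet.exists_tendsto_hitting_sub_return [SigmaFinite μ]
    (hT : MeasurePreserving T μ μ)
    {Y : Set X} (hY : IsUniformSet μ T Y a) (hα₀ : 0 < α) (hα₁ : α ≤ 1)
    (ha : IsRegularlyVarying a α) (hab : IsAsymptoticInverse a b) (hB : IsRareSequence μ B)
    (hBY : ∀ n, B n ⊆ Y) :
    ∃ f : X → ℝ, Integrable f μ ∧ 0 ≤ᵐ[μ] f ∧ ∫ x, f x ∂μ = 1 ∧
      ∀ s : ℝ, 0 < s → ∀ g : ℕ → X → ℝ, (∀ n, Measurable (g n)) → (∀ n x, 0 ≤ g n x) →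
        (∀ n x, g n x ≤ 1) →
        Tendsto (fun n =>
          ∫ x, f x * discounted T (B n) (s * scaling b (μ (B n)).toNNReal) (g n) x ∂μ
          - Real.Gamma (1 + α) * s ^ (-α) * ((∫ x in B n, g n x ∂μ) / μ.real (B n)
            - (∫ x in B n, discounted T (B n) (s * scaling b (μ (B n)).toNNReal) (g n) x ∂μ)
              / μ.real (B n))) atTop (𝓝 0) := by
  obtain ⟨f, hf, hf0, hf1, hmain⟩ :=
    hY.exists_tendsto_discounted_visits hT hα₀ hα₁ ha hab hB hBY
  refine ⟨f, hf, hf0, hf1, fun s hs g hg hg0 hg1 => ?_⟩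
  set Ψ : ℕ → X → ℝ := fun n => discounted T (B n) (s * scaling b (μ (B n)).toNNReal) (g n)
    with hΨ
  have hσ : ∀ n, 0 ≤ s * (scaling b (μ (B n)).toNNReal : ℝ) := fun n => by positivity
  have hΨm : ∀ n, Measurable (Ψ n) := fun n =>
    measurable_discounted hT.measurable (hB.measurableSet n) (hg n)
  have hΨ0 : ∀ n x, 0 ≤ Ψ n x := fun n => discounted_nonneg (hg0 n)
  have hΨ1 : ∀ n x, Ψ n x ≤ 1 := fun n => discounted_le_one (hσ n) (hg0 n) (hg1 n)
  -- With this q, the integral of q divided by μ(Bₙ) is the mean of g minus the mean of Ψ. The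
  -- decomposition of visits expresses the hitting functional as the discounted sum for q minus its
  -- term at time 0, which tends to 0.
  set q : ℕ → X → ℝ := fun n => (B n).indicator fun y => g n y - Ψ n y with hq
  have hqm : ∀ n, Measurable (q n) := fun n =>
    ((hg n).sub (hΨm n)).indicator (hB.measurableSet n)
  have hqB : ∀ n x, x ∉ B n → q n x = 0 := fun n x hx => by simp [hq, hx]
  have hq1 : ∀ n x, |q n x| ≤ 1 := by
    intro n x
    by_cases hx : x ∈ B n
    · simp only [hq, indicator_of_mem hx]
      rw [abs_le]
      constructor <;> linarith [hg0 n x, hg1 n x, hΨ0 n x, hΨ1 n x]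
    · simp [hqB n x hx]
  have h1 := (hmain s hs q hqm hq1 hqB).sub (hB.tendsto_integral_mul_indicator hf hq1 hqB)
  rw [sub_zero] at h1
  refine h1.congr' ?_
  filter_upwards [hB.eventually_scaling_pos hab, hB.eventually_lt_top] with n hn hfin
  have e1 := integral_discounted_add hT hf hf0 (hB.measurableSet n)
    (mul_pos hs (NNReal.coe_pos.2 hn)) (hg n) (hg0 n) (hg1 n)
  have hint : ∀ h : X → ℝ, Measurable h → (∀ x, 0 ≤ h x) → (∀ x, h x ≤ 1) →
      IntegrableOn h (B n) μ := by
    intro h hm h0 h1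
    refine Measure.integrableOn_of_bounded (M := 1) hfin.ne hm.aestronglyMeasurable
      (ae_of_all _ fun x => ?_)
    rw [Real.norm_of_nonneg (h0 x)]
    exact h1 x
  have e2 : ∫ x, q n x ∂μ = ∫ x in B n, g n x ∂μ - ∫ x in B n, Ψ n x ∂μ := by
    rw [← integral_sub (hint _ (hg n) (hg0 n) (hg1 n)) (hint _ (hΨm n) (hΨ0 n) (hΨ1 n)),
      ← integral_indicator (hB.measurableSet n)]
  change (∑' k : ℕ, Real.exp (-(s * scaling b (μ (B n)).toNNReal)) ^ k
            * ∫ x, f x * q n (T^[k] x) ∂μ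
          - Real.Gamma (1 + α) * s ^ (-α) * ((∫ x, q n x ∂μ) / μ.real (B n)))
          - ∫ x, f x * q n x ∂μ = ∫ x, f x * Ψ n x ∂μ - _
  change ∫ x, f x * Ψ n x ∂μ + ∫ x, f x * q n x ∂μ = _ at e1
  rw [← sub_div, ← e2]
  have e3 : ∑' k : ℕ, Real.exp (-(s * scaling b (μ (B n)).toNNReal)) ^ k
            * ∫ x, f x * q n (T^[k] x) ∂μ = ∫ x, f x * Ψ n x ∂μ + ∫ x, f x * q n x ∂μ := e1.symm
  rw [e3]
  ring

/-- The hitting functionals are asymptotically invariant. -/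
theorem IsCEMPT.tendsto_integral_discounted [SigmaFinite μ] (hT : IsCEMPT μ T)
    (hab : IsAsymptoticInverse a b) (hB : IsRareSequence μ B) {s : ℝ} (hs : 0 ≤ s)
    {g : ℕ → X → ℝ} (hg : ∀ n, Measurable (g n)) (hg0 : ∀ n x, 0 ≤ g n x)
    (hg1 : ∀ n x, g n x ≤ 1) {u : X → ℝ} (hu : Integrable u μ) (hu0 : ∫ x, u x ∂μ = 0) :
    Tendsto (fun n =>
      ∫ x, u x * discounted T (B n) (s * scaling b (μ (B n)).toNNReal) (g n) x ∂μ)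
      atTop (𝓝 0) := by
  have hTm := hT.measurePreserving.measurable
  set σ : ℕ → ℝ := fun n => s * scaling b (μ (B n)).toNNReal with hσdef
  have hσ : ∀ n, 0 ≤ σ n := fun n => by positivity
  have hΨm : ∀ n, Measurable (discounted T (B n) (σ n) (g n)) := fun n =>
    measurable_discounted hTm (hB.measurableSet n) (hg n)
  have hΨ0 : ∀ n x, 0 ≤ discounted T (B n) (σ n) (g n) x := fun n => discounted_nonneg (hg0 n)
  have hΨ1 : ∀ n x, discounted T (B n) (σ n) (g n) x ≤ 1 := fun n =>
    discounted_le_one (hσ n) (hg0 n) (hg1 n)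
  refine hT.tendsto_integral_mul_of_asymptotically_invariant hΨm hΨ0 hΨ1 (fun w hw => ?_) hu hu0
  -- Off T⁻¹Bₙ, whose measure tends to 0, one has Ψ = e^(-σ) Ψ ∘ T with σ → 0. Hence Ψ is
  -- asymptotically invariant when tested against L¹ functions.
  have hpre : Tendsto (μ ∘ fun n => T ⁻¹' B n) atTop (𝓝 0) := by
    refine hB.tendsto_zero.congr fun n => ?_
    exact (hT.measurePreserving.measure_preimage (hB.measurableSet n).nullMeasurableSet).symm
  have hσlim : Tendsto (fun n => 1 - Real.exp (-σ n)) atTop (𝓝 0) := by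
    have := ((Real.continuous_exp.tendsto _).comp
      ((hB.tendsto_scaling hab).const_mul s).neg).const_sub 1
    rw [mul_zero, neg_zero, Real.exp_zero, sub_self] at this
    exact this
  have hbound : Tendsto (fun n => ∫ x in T ⁻¹' B n, ‖w x‖ ∂μ
      + (∫ x, ‖w x‖ ∂μ) * (1 - Real.exp (-σ n))) atTop (𝓝 0) := by
    have := (hw.norm.tendsto_setIntegral_nhds_zero hpre).add (hσlim.const_mul (∫ x, ‖w x‖ ∂μ))
    simpa using this
  refine squeeze_zero_norm (fun n => ?_) hbound
  have hmpre : MeasurableSet (T ⁻¹' B n) := hTm (hB.measurableSet n)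
  rw [← integral_indicator hmpre, ← integral_mul_const,
    ← integral_add (hw.norm.indicator hmpre) (hw.norm.mul_const _)]
  refine norm_integral_le_of_norm_le ((hw.norm.indicator hmpre).add (hw.norm.mul_const _))
    (ae_of_all _ fun x => ?_)
  have hexp : Real.exp (-σ n) ≤ 1 := Real.exp_le_one_iff.2 (by linarith [hσ n])
  rw [norm_mul]
  by_cases hx : T x ∈ B n
  · rw [indicator_of_mem (show x ∈ T ⁻¹' B n from hx)]
    have h1 : ‖discounted T (B n) (σ n) (g n) (T x) - discounted T (B n) (σ n) (g n) x‖ ≤ 1 := by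
      rw [Real.norm_eq_abs, abs_le]
      constructor <;> linarith [hΨ0 n x, hΨ1 n x, hΨ0 n (T x), hΨ1 n (T x)]
    have h2 : 0 ≤ ‖w x‖ * (1 - Real.exp (-σ n)) :=
      mul_nonneg (norm_nonneg _) (by linarith)
    linarith [mul_le_of_le_one_right (norm_nonneg (w x)) h1]
  · rw [indicator_of_notMem (show x ∉ T ⁻¹' B n from hx), zero_add]
    gcongr
    rw [discounted_of_notMem hx, Real.norm_eq_abs, abs_le]
    have := hΨ0 n (T x)
    have := hΨ1 n (T x)
    constructor <;> nlinarith

end Relation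


/-! ### Pointwise estimates for a delay t -/

section Pointwise

variable {X : Type*} {T : X → X} {A : Set X} {σ : ℝ} {g : X → ℝ}

/-- There are three cases. If the return is after t, only the discount up to t is lost. If it is
before t, the second term is 1. If it is exactly at t, then T^t x lies in A, a case that assumption
(A4) does not exclude and that the third term takes care of. -/
theorem abs_discounted_sub_iterate_le (hσ : 0 ≤ σ) (hg0 : ∀ x, 0 ≤ g x) (hg1 : ∀ x, g x ≤ 1)
    (x : X) (t : ℕ) :
    |discounted T A σ g x - discounted T A σ g (T^[t] x)| ≤ (1 - Real.exp (-(σ * t)))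
      + {x | returnTime T A 1 x < (t : ℕ∞)}.indicator (fun _ => 1) x
      + A.indicator (fun _ => 1) (T^[t] x) := by
  have a1 := discounted_nonneg (T := T) (A := A) (σ := σ) hg0 x
  have a2 := discounted_le_one (T := T) (A := A) hσ hg0 hg1 x
  have b1 := discounted_nonneg (T := T) (A := A) (σ := σ) hg0 (T^[t] x)
  have b2 := discounted_le_one (T := T) (A := A) hσ hg0 hg1 (T^[t] x)
  have he : Real.exp (-(σ * t)) ≤ 1 := Real.exp_le_one_iff.2 (neg_nonpos.2 (by positivity))
  have hd : |discounted T A σ g x - discounted T A σ g (T^[t] x)| ≤ 1 := by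
    rw [abs_le]
    constructor <;> linarith
  have i1 : 0 ≤ {x | returnTime T A 1 x < (t : ℕ∞)}.indicator (fun _ => (1 : ℝ)) x :=
    indicator_nonneg (fun _ _ => zero_le_one) _
  have i2 : 0 ≤ A.indicator (fun _ => (1 : ℝ)) (T^[t] x) :=
    indicator_nonneg (fun _ _ => zero_le_one) _
  rcases lt_trichotomy (returnTime T A 1 x) t with h | h | h
  · rw [indicator_of_mem (show x ∈ {x | returnTime T A 1 x < (t : ℕ∞)} from h)]
    linarith
  · rw [indicator_of_mem (returnTime_one_eq_coe_iff.1 h).2.1]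
    linarith
  · rw [discounted_of_lt h]
    have : |Real.exp (-(σ * t)) * discounted T A σ g (T^[t] x) - discounted T A σ g (T^[t] x)|
        ≤ 1 - Real.exp (-(σ * t)) := by
      rw [abs_le]
      constructor <;> nlinarith
    linarith

/-- If the return occurs no later than t, the functional differs from its undiscounted value by at
most the discount up to t. -/
theorem abs_discounted_sub_inducedMap_le (hσ : 0 ≤ σ) (hg0 : ∀ x, 0 ≤ g x) (hg1 : ∀ x, g x ≤ 1)
    (x : X) (t : ℕ) :
    |discounted T A σ g x - g (inducedMap T A x)| ≤ (1 - Real.exp (-(σ * t)))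
      + {x | (t : ℕ∞) < returnTime T A 1 x}.indicator (fun _ => 1) x := by
  have a1 := discounted_nonneg (T := T) (A := A) (σ := σ) hg0 x
  have a2 := discounted_le_one (T := T) (A := A) hσ hg0 hg1 x
  have b1 := hg0 (inducedMap T A x)
  have b2 := hg1 (inducedMap T A x)
  have he : Real.exp (-(σ * t)) ≤ 1 := Real.exp_le_one_iff.2 (neg_nonpos.2 (by positivity))
  rcases lt_or_ge (t : ℕ∞) (returnTime T A 1 x) with h | h
  · rw [indicator_of_mem (show x ∈ {x | (t : ℕ∞) < returnTime T A 1 x} from h), abs_le]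
    constructor <;> linarith
  · have hfin : returnTime T A 1 x ≠ ⊤ := ne_top_of_le_ne_top (ENat.natCast_ne_top t) h
    obtain ⟨n, hn⟩ := ENat.ne_top_iff_exists.1 hfin
    rw [indicator_of_notMem (show x ∉ {x | (t : ℕ∞) < returnTime T A 1 x} from not_lt.2 h),
      add_zero, discounted, if_neg hfin, ← hn, ENat.toNat_natCast]
    rw [← hn, Nat.cast_le] at h
    have h1 : Real.exp (-(σ * n)) ≤ 1 := Real.exp_le_one_iff.2 (neg_nonpos.2 (by positivity))
    have h2 : Real.exp (-(σ * t)) ≤ Real.exp (-(σ * n)) := by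
      rw [Real.exp_le_exp, neg_le_neg_iff]
      gcongr
    rw [abs_le]
    constructor <;> nlinarith

end Pointwise

/-! ### Second relation: contributions of Q(Bₙ) and U(Bₙ) to the return functional -/

namespace AssumptionsFor

variable {X : Type*} [MeasurableSpace X] {μ : Measure X} {T : X → X}
  {B : ℕ → Set X} {a : ℕ → ℝ≥0} {b : ℝ≥0 → ℝ≥0} {α θ : ℝ} {Y : Set X} {U Q : ℕ → Set X}
  {τ : ℕ → X → ℕ} {𝒰 : Set (Lp ℝ 1 μ)}

theorem eventually_Q_pos (h : AssumptionsFor μ T α θ a b B Y U Q τ 𝒰) (hθ : 0 < θ) :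
    ∀ᶠ n in atTop, 0 < μ.real (Q n) := by
  filter_upwards [h.extremalIndex.eventually (lt_mem_nhds hθ)] with n hn
  refine lt_of_le_of_ne measureReal_nonneg fun h0 => ?_
  rw [← h0, zero_div] at hn
  exact lt_irrefl _ hn

theorem restrict_eq (h : AssumptionsFor μ T α θ a b B Y U Q τ 𝒰) {n : ℕ} (hn : 1 ≤ n) :
    μ.restrict (B n) = μ.restrict (U n) + μ.restrict (Q n) := by
  rw [Measure.restrict_congr_set (h.decomposition n hn).1,
    Measure.restrict_union₀ (h.decomposition n hn).2 (h.measurableSet_Q n).nullMeasurableSet]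

theorem measure_eq (h : AssumptionsFor μ T α θ a b B Y U Q τ 𝒰) {n : ℕ} (hn : 1 ≤ n) :
    μ (B n) = μ (U n) + μ (Q n) := by
  rw [← Measure.restrict_apply_univ, h.restrict_eq hn]
  simp

theorem tendsto_U_div (h : AssumptionsFor μ T α θ a b B Y U Q τ 𝒰) (hB : IsRareSequence μ B) :
    Tendsto (fun n => μ.real (U n) / μ.real (B n)) atTop (𝓝 (1 - θ)) := by
  refine (h.extremalIndex.const_sub 1).congr' ?_
  filter_upwards [hB.eventually_lt_top, hB.eventually_real_pos, eventually_ge_atTop 1]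
    with n h1 h2 h3
  have e := h.measure_eq h3
  have hU : μ (U n) ≠ ∞ := ne_top_of_le_ne_top h1.ne (e ▸ le_self_add)
  have hQ : μ (Q n) ≠ ∞ := ne_top_of_le_ne_top h1.ne (e ▸ le_add_self)
  have : μ.real (B n) = μ.real (U n) + μ.real (Q n) := by
    rw [measureReal_def, e, ENNReal.toReal_add hU hQ]
    rfl
  rw [eq_div_iff h2.ne', sub_mul, div_mul_cancel₀ _ h2.ne']
  linarith

theorem integral_cond (μ : Measure X) (D : Set X) (φ : X → ℝ) :
    ∫ x, φ x ∂(cond μ D) = (∫ x in D, φ x ∂μ) / μ.real D := by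
  rw [ProbabilityTheory.cond, integral_smul_measure, ENNReal.toReal_inv, smul_eq_mul, inv_mul_eq_div]
  rfl

theorem toReal_cond_apply (μ : Measure X) {D S : Set X} (hD : MeasurableSet D) :
    (cond μ D S).toReal = μ.real (D ∩ S) / μ.real D := by
  rw [cond_apply hD, ENNReal.toReal_mul, ENNReal.toReal_inv, inv_mul_eq_div]
  rfl

/-- The hypothesis on γτ is tested with the bounded continuous function y ↦ 1 - e^(-sy), which
vanishes at 0. -/
theorem tendsto_integral_one_sub_exp (h : AssumptionsFor μ T α θ a b B Y U Q τ 𝒰)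
    {s : ℝ} (hs : 0 ≤ s) :
    Tendsto (fun n => (∫ x in B n,
      (1 - Real.exp (-(s * scaling b (μ (B n)).toNNReal * τ n x))) ∂μ) / μ.real (B n))
      atTop (𝓝 0) := by
  have hb : ∀ y : ℝ≥0, 0 ≤ 1 - Real.exp (-(s * y)) ∧ 1 - Real.exp (-(s * y)) ≤ 1 := fun y =>
    ⟨sub_nonneg.2 (Real.exp_le_one_iff.2 (neg_nonpos.2 (by positivity))),
      by linarith [Real.exp_pos (-(s * y))]⟩
  let F : ℝ≥0 →ᵇ ℝ := BoundedContinuousFunction.ofNormedAddCommGroup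
    (fun y : ℝ≥0 => 1 - Real.exp (-(s * y))) (by fun_prop) 1 (fun y => by
      rw [Real.norm_of_nonneg (hb y).1]; exact (hb y).2)
  have hlim := h.τ_negligible.2 F
  rw [integral_dirac] at hlim
  have h0 : F 0 = 0 := by simp [F]
  rw [h0] at hlim
  refine hlim.congr fun n => ?_
  rw [integral_cond]
  congr 2
  ext x
  simp only [F, BoundedContinuousFunction.coe_ofNormedAddCommGroup, NNReal.coe_mul,
    NNReal.coe_natCast]
  ring_nf

theorem measurableSet_lt_nat {ρ : X → ℕ∞} (hρ : Measurable ρ) {t : X → ℕ} (ht : Measurable t) :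
    MeasurableSet {x | ρ x < (t x : ℕ∞)} :=
  (hρ.prodMk ht) (to_countable {p : ℕ∞ × ℕ | p.1 < p.2}).measurableSet

theorem measurableSet_nat_lt {ρ : X → ℕ∞} (hρ : Measurable ρ) {t : X → ℕ} (ht : Measurable t) :
    MeasurableSet {x | (t x : ℕ∞) < ρ x} :=
  (hρ.prodMk ht) (to_countable {p : ℕ∞ × ℕ | p.2 < p.1}).measurableSet

theorem integrable_restrict_of_abs_le {D : Set X} (hD : μ D ≠ ∞) {φ : X → ℝ} (hφ : Measurable φ)
    {C : ℝ} (hC : ∀ x, |φ x| ≤ C) : Integrable φ (μ.restrict D) :=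
  Measure.integrableOn_of_bounded (M := C) hD hφ.aestronglyMeasurable (ae_of_all _ hC)

/-- Starting from `Q`, the hitting functional behaves as under a fixed density. -/
theorem tendsto_integral_Q [SigmaFinite μ] (hT : IsCEMPT μ T)
    (hab : IsAsymptoticInverse a b) (hB : IsRareSequence μ B)
    (h : AssumptionsFor μ T α θ a b B Y U Q τ 𝒰) (hθ : 0 < θ) {s : ℝ} (hs : 0 ≤ s)
    {g : ℕ → X → ℝ} (hg : ∀ n, Measurable (g n)) (hg0 : ∀ n x, 0 ≤ g n x)
    (hg1 : ∀ n x, g n x ≤ 1) {f : X → ℝ} (hf : Integrable f μ) (hf1 : ∫ x, f x ∂μ = 1) :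
    Tendsto (fun n =>
      (∫ x in Q n, discounted T (B n) (s * scaling b (μ (B n)).toNNReal) (g n) x ∂μ)
          / μ.real (Q n)
        - ∫ x, f x * discounted T (B n) (s * scaling b (μ (B n)).toNNReal) (g n) x ∂μ)
      atTop (𝓝 0) := by
  have hTq := hT.measurePreserving.quasiMeasurePreserving
  have hTm := hTq.measurable
  set σ : ℕ → ℝ := fun n => s * scaling b (μ (B n)).toNNReal with hσdef
  have hσ : ∀ n, 0 ≤ σ n := fun n => by positivity
  set Ψ : ℕ → X → ℝ := fun n => discounted T (B n) (σ n) (g n) with hΨ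
  have hΨm : ∀ n, Measurable (Ψ n) := fun n =>
    measurable_discounted hTm (hB.measurableSet n) (hg n)
  have hΨ0 : ∀ n x, 0 ≤ Ψ n x := fun n => discounted_nonneg (hg0 n)
  have hΨ1 : ∀ n x, Ψ n x ≤ 1 := fun n => discounted_le_one (hσ n) (hg0 n) (hg1 n)
  have hΨabs : ∀ n x, |Ψ n x| ≤ 1 := fun n x => by rw [abs_of_nonneg (hΨ0 n x)]; exact hΨ1 n x
  set c : ℕ → ℝ := fun n => ∫ x, f x * Ψ n x ∂μ with hc
  have hcabs : ∀ n, |c n| ≤ ∫ x, |f x| ∂μ := fun n => by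
    rw [← Real.norm_eq_abs]
    refine norm_integral_le_of_norm_le hf.abs (ae_of_all _ fun x => ?_)
    rw [norm_mul]
    exact mul_le_of_le_one_right (norm_nonneg _) (hΨabs n x)
  choose! v hv𝒰 hv using h.goodDensity
  -- The densities are only given for n ≥ 1. Replacing n by `max n 1` places every term of the
  -- sequence in the compact set.
  have hv' : ∀ n, v (max n 1) ∈ 𝒰 := fun n => hv𝒰 _ (le_max_right _ _)
  have hdual : ∀ n, 1 ≤ n → μ (Q n) < ∞ → ∀ φ : X → ℝ, Measurable φ → ∀ C, (∀ x, |φ x| ≤ C) →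
      (∫ x in Q n, φ (T^[τ n x] x) ∂μ) / μ.real (Q n) = ∫ x, v (max n 1) x * φ x ∂μ := by
    intro n hn hfin φ hφ C hC
    have hi : Integrable ((Q n).indicator fun _ => 1 / μ.real (Q n)) μ :=
      (integrable_indicator_iff (h.measurableSet_Q n)).2 (integrableOn_const hfin.ne)
    have := (transferOp_duality μ (quasiMeasurePreserving_iterate_apply hTq (h.measurable_τ n))
      hi hφ hC).2
    have hcongr : ∫ x, v n x * φ x ∂μ = ∫ x, transferOp μ (fun x => T^[τ n x] x)
        ((Q n).indicator fun _ => 1 / μ.real (Q n)) x * φ x ∂μ := by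
      refine integral_congr_ae ?_
      filter_upwards [hv n hn] with x hx
      rw [hx]
    rw [max_eq_left hn, hcongr, ← this, ← integral_div, ← integral_indicator (h.measurableSet_Q n)]
    congr 1
    ext x
    by_cases hx : x ∈ Q n
    · simp only [indicator_of_mem hx]; ring
    · simp only [indicator_of_notMem hx]; ring
  -- After pushing forward by T^τ, this is the probability of being in Bₙ at time τ exactly, that
  -- is, the third error term of the pointwise estimate.
  have hL1 : Tendsto (fun n => ∫ x, v (max n 1) x * (B n).indicator (fun _ => 1) x ∂μ)
      atTop (𝓝 0) := by
    have hi1 : ∀ n x, |(B n).indicator (fun _ => (1 : ℝ)) x| ≤ 1 := fun n x => by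
      by_cases hx : x ∈ B n <;> simp [hx]
    refine tendsto_integral_mul_of_isCompact h.isCompact (C := 1)
      (fun n => measurable_const.indicator (hB.measurableSet n)) hi1 (fun w hw => ?_) hv'
    exact hB.tendsto_integral_mul_indicator hw hi1 (fun n x hx => indicator_of_notMem hx _)
  -- Subtracting the constant c n makes the limit zero for each fixed w: the integral of w (Ψ - c)
  -- is that of (w - W f) Ψ, where w - W f has integral zero. Compactness then makes the convergence
  -- uniform.
  have hL2 : Tendsto (fun n => ∫ x, v (max n 1) x * (Ψ n x - c n) ∂μ) atTop (𝓝 0) := by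
    refine tendsto_integral_mul_of_isCompact h.isCompact (C := 1 + ∫ x, |f x| ∂μ)
      (fun n => (hΨm n).sub_const _)
      (fun n x => (abs_sub _ _).trans (add_le_add (hΨabs n x) (hcabs n))) (fun w hw => ?_) hv'
    set W := ∫ x, w x ∂μ with hW
    have hu : Integrable (fun x => w x - W * f x) μ := hw.sub (hf.const_mul W)
    have hu0 : ∫ x, (w x - W * f x) ∂μ = 0 := by
      rw [integral_sub hw (hf.const_mul W), integral_const_mul, hf1, mul_one, sub_self]
    refine (hT.tendsto_integral_discounted hab hB hs hg hg0 hg1 hu hu0).congr fun n => ?_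
    change ∫ x, (w x - W * f x) * Ψ n x ∂μ = _
    have i1 := integrable_mul_of_mem_Icc hw (hΨm n) (hΨ0 n) (hΨ1 n)
    have i2 := integrable_mul_of_mem_Icc hf (hΨm n) (hΨ0 n) (hΨ1 n)
    have e1 : ∫ x, (w x - W * f x) * Ψ n x ∂μ = ∫ x, w x * Ψ n x ∂μ - W * c n := by
      rw [hc, ← integral_const_mul, ← integral_sub i1 (i2.const_mul W)]
      congr 1
      ext x
      ring
    have e2 : ∫ x, w x * (Ψ n x - c n) ∂μ = ∫ x, w x * Ψ n x ∂μ - W * c n := by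
      rw [hW, ← integral_mul_const, ← integral_sub i1 (hw.mul_const _)]
      congr 1
      ext x
      ring
    rw [e1, e2]
  have hE := h.tendsto_integral_one_sub_exp hs
  have hE' : Tendsto (fun n => (∫ x in B n, (1 - Real.exp (-(σ n * τ n x))) ∂μ) / μ.real (B n)
      / (μ.real (Q n) / μ.real (B n))) atTop (𝓝 0) := by
    have := hE.div h.extremalIndex hθ.ne'
    rw [zero_div] at this
    exact this
  have hlt : Tendsto (fun n => μ.real (Q n ∩ {x | returnTime T (B n) 1 x < (τ n x : ℕ∞)})
      / μ.real (Q n)) atTop (𝓝 0) := by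
    have := (ENNReal.tendsto_toReal ENNReal.zero_ne_top).comp h.no_cluster_from_Q
    rw [ENNReal.toReal_zero] at this
    exact this.congr fun n => toReal_cond_apply μ (h.measurableSet_Q n)
  have hbound := ((hE'.add hlt).add hL1).add hL2.norm
  simp only [add_zero, norm_zero] at hbound
  refine squeeze_zero_norm' ?_ hbound
  filter_upwards [eventually_ge_atTop 1, hB.eventually_lt_top, hB.eventually_real_pos,
    h.eventually_Q_pos hθ] with n hn hBfin hBpos hQpos
  have hQB : μ (Q n) ≤ μ (B n) := by rw [h.measure_eq hn]; exact le_add_self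
  have hQfin : μ (Q n) < ∞ := hQB.trans_lt hBfin
  have hQres : μ.restrict (Q n) ≤ μ.restrict (B n) := by
    rw [h.restrict_eq hn]; exact Measure.le_add_left le_rfl
  set ind : X → ℝ := (B n).indicator fun _ => 1 with hind
  have hindm : Measurable ind := measurable_const.indicator (hB.measurableSet n)
  have hind1 : ∀ x, |ind x| ≤ 1 := fun x => by by_cases hx : x ∈ B n <;> simp [hind, hx]
  set E : X → ℝ := fun x => 1 - Real.exp (-(σ n * τ n x)) with hEdef
  have hτm : Measurable fun x => (τ n x : ℝ) := (measurable_of_countable _).comp (h.measurable_τ n)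
  have hEm : Measurable E :=
    measurable_const.sub (Real.measurable_exp.comp (measurable_const.mul hτm).neg)
  have hE0 : ∀ x, 0 ≤ E x := fun x =>
    sub_nonneg.2 (Real.exp_le_one_iff.2 (neg_nonpos.2 (mul_nonneg (hσ n) (Nat.cast_nonneg _))))
  have hE1 : ∀ x, |E x| ≤ 1 := fun x => by
    rw [abs_of_nonneg (hE0 x)]
    linarith [Real.exp_pos (-(σ n * τ n x))]
  set G : Set X := {x | returnTime T (B n) 1 x < (τ n x : ℕ∞)} with hG
  have hGm : MeasurableSet G :=
    measurableSet_lt_nat (measurable_returnTime hTm (hB.measurableSet n) 1) (h.measurable_τ n)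
  have hSm := measurable_iterate_apply hTm (h.measurable_τ n)
  have hdiff : |∫ x in Q n, (Ψ n x - Ψ n (T^[τ n x] x)) ∂μ|
      ≤ ∫ x in B n, E x ∂μ + μ.real (Q n ∩ G) + ∫ x in Q n, ind (T^[τ n x] x) ∂μ := by
    have iE : Integrable E (μ.restrict (Q n)) := integrable_restrict_of_abs_le hQfin.ne hEm hE1
    have iG : Integrable (G.indicator fun _ => (1 : ℝ)) (μ.restrict (Q n)) :=
      integrable_restrict_of_abs_le hQfin.ne (measurable_const.indicator hGm) (C := 1)
        fun x => by by_cases hx : x ∈ G <;> simp [hx]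
    have ii : Integrable (fun x => ind (T^[τ n x] x)) (μ.restrict (Q n)) :=
      integrable_restrict_of_abs_le hQfin.ne (hindm.comp hSm) (C := 1) fun x => hind1 _
    have hstep : |∫ x in Q n, (Ψ n x - Ψ n (T^[τ n x] x)) ∂μ|
        ≤ ∫ x in Q n, (E x + G.indicator (fun _ => 1) x + ind (T^[τ n x] x)) ∂μ := by
      rw [← Real.norm_eq_abs]
      refine norm_integral_le_of_norm_le ((iE.add iG).add ii) (ae_of_all _ fun x => ?_)
      exact abs_discounted_sub_iterate_le (hσ n) (hg0 n) (hg1 n) x (τ n x)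
    rw [integral_add (f := fun x => E x + G.indicator (fun _ => 1) x) (iE.add iG) ii, integral_add iE iG, integral_indicator_const _ hGm,
      measureReal_restrict_apply hGm, smul_eq_mul, mul_one, inter_comm G] at hstep
    refine hstep.trans ?_
    gcongr
    · exact ae_of_all _ hE0
    · exact integrable_restrict_of_abs_le hBfin.ne hEm hE1
  have hi1 : Integrable (Ψ n) (μ.restrict (Q n)) :=
    integrable_restrict_of_abs_le hQfin.ne (hΨm n) (hΨabs n)
  have hi2 : Integrable (fun x => Ψ n (T^[τ n x] x)) (μ.restrict (Q n)) :=
    integrable_restrict_of_abs_le hQfin.ne ((hΨm n).comp hSm) fun x => hΨabs n _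
  have hd1 := hdual n hn hQfin ind hindm 1 hind1
  have hd2 := hdual n hn hQfin (fun x => Ψ n x - c n) ((hΨm n).sub_const _) (1 + ∫ x, |f x| ∂μ)
    (fun x => (abs_sub _ _).trans (add_le_add (hΨabs n x) (hcabs n)))
  rw [integral_sub hi2 (integrableOn_const hQfin.ne), setIntegral_const, smul_eq_mul] at hd2
  rw [integral_sub hi1 hi2] at hdiff
  -- The deviation splits into the cost of waiting until τ, with three error terms, and the
  -- deviation of the density reached at time τ from the reference density.
  have hkey : (∫ x in Q n, Ψ n x ∂μ) / μ.real (Q n) - c n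
      = (∫ x in Q n, Ψ n x ∂μ - ∫ x in Q n, Ψ n (T^[τ n x] x) ∂μ) / μ.real (Q n)
        + ∫ x, v (max n 1) x * (Ψ n x - c n) ∂μ := by
    rw [← hd2]
    field_simp
    ring
  change ‖(∫ x in Q n, Ψ n x ∂μ) / μ.real (Q n) - c n‖ ≤ _
  rw [hkey]
  refine (norm_add_le _ _).trans ?_
  gcongr
  rw [← hd1, Real.norm_eq_abs, abs_div, abs_of_pos hQpos, div_div_div_cancel_right₀ hBpos.ne',
    ← add_div, ← add_div]
  gcongr

end AssumptionsFor


/-- Where the orbit never returns, the return time ⊤ becomes 0 under `toNat` and the induced map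
fixes the point, which is in A. So every point of A stays in A, and preimages lie in a countable
union of T⁻ᵏ(A ∩ S). -/
theorem quasiMeasurePreserving_inducedMap {X : Type*} [MeasurableSpace X] {μ : Measure X}
    {T : X → X} (hT : Measure.QuasiMeasurePreserving T μ μ) {A : Set X} (hA : MeasurableSet A)
    (hfin : μ A ≠ ∞) :
    Measure.QuasiMeasurePreserving (inducedMap T A) (cond μ A) (cond μ A) := by
  have hm := measurable_inducedMap hT.measurable hA
  refine ⟨hm, Measure.AbsolutelyContinuous.mk fun S hS hS0 => ?_⟩
  rw [Measure.map_apply hm hS]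
  have hzero : ∀ V : Set X, cond μ A V = 0 ↔ μ (A ∩ V) = 0 := by
    intro V
    rw [cond_apply hA, mul_eq_zero, ENNReal.inv_eq_zero]
    simp [hfin]
  rw [hzero] at hS0 ⊢
  refine measure_mono_null (t := ⋃ k : ℕ, T^[k] ⁻¹' (A ∩ S)) (fun x hx => ?_)
    (measure_iUnion_null fun k => (hT.iterate k).preimage_null hS0)
  refine mem_iUnion.2 ⟨(returnTime T A 1 x).toNat, ?_, hx.2⟩
  by_cases htop : returnTime T A 1 x = ⊤
  · rw [htop]
    exact hx.1
  · exact inducedMap_mem htop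

namespace AssumptionsFor

variable {X : Type*} [MeasurableSpace X] {μ : Measure X} {T : X → X}
  {B : ℕ → Set X} {a : ℕ → ℝ≥0} {b : ℝ≥0 → ℝ≥0} {α θ : ℝ} {Y : Set X} {U Q : ℕ → Set X}
  {τ : ℕ → X → ℕ} {𝒰 : Set (Lp ℝ 1 μ)}

/-- The induced map sends `U` to an approximately uniformly distributed point. -/
theorem tendsto_integral_inducedMap_U [SigmaFinite μ] (hT : IsCEMPT μ T)
    (hB : IsRareSequence μ B)
    (h : AssumptionsFor μ T α θ a b B Y U Q τ 𝒰)
    {g : ℕ → X → ℝ} (hg : ∀ n, Measurable (g n)) (hg0 : ∀ n x, 0 ≤ g n x)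
    (hg1 : ∀ n x, g n x ≤ 1) :
    Tendsto (fun n => (∫ x in U n, g n (inducedMap T (B n) x) ∂μ) / μ.real (B n)
        - μ.real (U n) / μ.real (B n) * ((∫ x in B n, g n x ∂μ) / μ.real (B n)))
      atTop (𝓝 0) := by
  have hTq := hT.measurePreserving.quasiMeasurePreserving
  -- When μ(U) = 0 the expression is exactly 0, so it suffices to take the limit along the indices
  -- that the assumption covers.
  rw [← tendsto_inf_principal_nhds_iff_of_forall_eq (s := {n | μ (U n) ≠ 0}) fun n hn => by
    have hn0 : μ (U n) = 0 := by simpa using hn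
    rw [Measure.restrict_eq_zero.2 hn0]
    simp [measureReal_def, hn0]]
  set e : ℕ → ℝ≥0∞ := fun n => eLpNorm (fun x =>
        transferOp (cond μ (B n)) (inducedMap T (B n))
            ((U n).indicator fun _ => 1 / μ.real (U n)) x
          - (B n).indicator (fun _ => 1 / μ.real (B n)) x) ∞ (cond μ (B n)) with he
  have hlim : Tendsto e (atTop ⊓ 𝓟 {n | μ (U n) ≠ 0}) (𝓝 0) := h.geometric_compatibility
  have hlim' : Tendsto (fun n => (e n).toReal * μ.real (B n)) (atTop ⊓ 𝓟 {n | μ (U n) ≠ 0})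
      (𝓝 0) := by
    have h1 := (ENNReal.tendsto_toReal ENNReal.zero_ne_top).comp hlim
    have := h1.mul (hB.tendsto_real.mono_left inf_le_left)
    rw [ENNReal.toReal_zero, zero_mul] at this
    exact this
  refine squeeze_zero_norm' ?_ hlim'
  have hev1 : ∀ᶠ n in atTop ⊓ 𝓟 {n | μ (U n) ≠ 0}, e n < ∞ :=
    hlim.eventually (gt_mem_nhds ENNReal.zero_lt_top)
  have hev2 : ∀ᶠ n in atTop ⊓ 𝓟 {n | μ (U n) ≠ 0}, 1 ≤ n ∧ μ (B n) < ∞ ∧ 0 < μ.real (B n) :=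
    ((eventually_ge_atTop 1).and (hB.eventually_lt_top.and hB.eventually_real_pos)).filter_mono
      inf_le_left
  have hev3 : ∀ᶠ n in atTop ⊓ 𝓟 {n | μ (U n) ≠ 0}, μ (U n) ≠ 0 :=
    (eventually_principal.2 fun n hn => hn).filter_mono inf_le_right
  filter_upwards [hev1, hev2, hev3] with n hen ⟨hn, hBfin, hBpos⟩ hU0
  have hgabs : ∀ x, |g n x| ≤ 1 := fun x => by rw [abs_of_nonneg (hg0 n x)]; exact hg1 n x
  have hUB : μ (U n) ≤ μ (B n) := by rw [h.measure_eq hn]; exact le_self_add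
  have hUfin : μ (U n) < ∞ := hUB.trans_lt hBfin
  have hUpos : 0 < μ.real (U n) := ENNReal.toReal_pos hU0 hUfin.ne
  have hP : IsProbabilityMeasure (cond μ (B n)) :=
    cond_isProbabilityMeasure_of_finite (hB.measure_ne_zero n) hBfin.ne
  have hi : Integrable ((U n).indicator fun _ => 1 / μ.real (U n)) (cond μ (B n)) :=
    (integrable_const _).indicator (h.measurableSet_U n)
  obtain ⟨hti, hdual⟩ := transferOp_duality (cond μ (B n))
    (quasiMeasurePreserving_inducedMap hTq (hB.measurableSet n) hBfin.ne) hi (hg n) hgabs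
  set t := transferOp (cond μ (B n)) (inducedMap T (B n))
    ((U n).indicator fun _ => 1 / μ.real (U n)) with ht
  have hbi : Integrable ((B n).indicator fun _ => 1 / μ.real (B n)) (cond μ (B n)) :=
    (integrable_const _).indicator (hB.measurableSet n)
  have hmul : ∀ φ : X → ℝ, Integrable φ (cond μ (B n)) →
      Integrable (fun x => φ x * g n x) (cond μ (B n)) := fun φ hφ =>
    hφ.mul_bdd (c := 1) (hg n).aestronglyMeasurable (ae_of_all _ hgabs)
  have hclose : |∫ x, t x * g n x ∂(cond μ (B n))
      - ∫ x, (B n).indicator (fun _ => 1 / μ.real (B n)) x * g n x ∂(cond μ (B n))|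
      ≤ (e n).toReal := by
    rw [← integral_sub (hmul _ hti) (hmul _ hbi), ← Real.norm_eq_abs]
    have hb : ∀ᵐ x ∂(cond μ (B n)), ‖t x * g n x
        - (B n).indicator (fun _ => 1 / μ.real (B n)) x * g n x‖ ≤ (e n).toReal := by
      filter_upwards [ae_le_eLpNormEssSup (μ := cond μ (B n))
        (f := fun x => t x - (B n).indicator (fun _ => 1 / μ.real (B n)) x)] with x hx
      rw [← sub_mul, norm_mul]
      refine (mul_le_of_le_one_right (norm_nonneg _) (hgabs x)).trans ?_
      rw [← eLpNorm_exponent_top, ← ofReal_norm] at hx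
      exact (ENNReal.ofReal_le_iff_le_toReal hen.ne).1 hx
    simpa using norm_integral_le_of_norm_le_const hb
  have e1 : ∫ x, (U n).indicator (fun _ => 1 / μ.real (U n)) x * g n (inducedMap T (B n) x)
      ∂(cond μ (B n))
      = (∫ x in U n, g n (inducedMap T (B n) x) ∂μ) / μ.real (U n) / μ.real (B n) := by
    rw [integral_cond]
    congr 1
    rw [← integral_div, ← integral_indicator (h.measurableSet_U n),
      ← integral_indicator (hB.measurableSet n)]
    refine integral_congr_ae ?_
    filter_upwards [(h.decomposition n hn).1] with x hx
    by_cases hxU : x ∈ U n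
    · have hxB : x ∈ B n := hx.mpr (Or.inl hxU)
      simp only [indicator_of_mem hxU, indicator_of_mem hxB]
      ring
    · by_cases hxB : x ∈ B n
      · simp only [indicator_of_notMem hxU, indicator_of_mem hxB, zero_mul]
      · simp only [indicator_of_notMem hxU, indicator_of_notMem hxB]
  have e2 : ∫ x, (B n).indicator (fun _ => 1 / μ.real (B n)) x * g n x ∂(cond μ (B n))
      = (∫ x in B n, g n x ∂μ) / μ.real (B n) / μ.real (B n) := by
    rw [integral_cond]
    congr 1
    rw [← integral_div]
    refine setIntegral_congr_fun (hB.measurableSet n) fun x hx => ?_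
    simp only [indicator_of_mem hx]
    ring
  rw [← hdual, e1, e2] at hclose
  -- Duality bounds the difference of the averages, still divided by μ(Bₙ), by the L^∞ distance.
  -- Multiplying by μ(U) ≤ μ(Bₙ) gives the final bound.
  have e3 : (∫ x in U n, g n (inducedMap T (B n) x) ∂μ) / μ.real (B n)
        - μ.real (U n) / μ.real (B n) * ((∫ x in B n, g n x ∂μ) / μ.real (B n))
      = μ.real (U n) * ((∫ x in U n, g n (inducedMap T (B n) x) ∂μ) / μ.real (U n) / μ.real (B n)
        - (∫ x in B n, g n x ∂μ) / μ.real (B n) / μ.real (B n)) := by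
    field_simp
  rw [e3, norm_mul, Real.norm_of_nonneg hUpos.le, mul_comm]
  refine mul_le_mul hclose ?_ hUpos.le ENNReal.toReal_nonneg
  exact ENNReal.toReal_mono hBfin.ne hUB

/-- Starting from `U`, the return is immediate and restarts the return process. -/
theorem tendsto_integral_U [SigmaFinite μ] (hT : IsCEMPT μ T) (hB : IsRareSequence μ B)
    (h : AssumptionsFor μ T α θ a b B Y U Q τ 𝒰) {s : ℝ} (hs : 0 ≤ s)
    {g : ℕ → X → ℝ} (hg : ∀ n, Measurable (g n)) (hg0 : ∀ n x, 0 ≤ g n x)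
    (hg1 : ∀ n x, g n x ≤ 1) :
    Tendsto (fun n =>
      (∫ x in U n, discounted T (B n) (s * scaling b (μ (B n)).toNNReal) (g n) x ∂μ)
          / μ.real (B n)
        - μ.real (U n) / μ.real (B n) * ((∫ x in B n, g n x ∂μ) / μ.real (B n)))
      atTop (𝓝 0) := by
  have hTq := hT.measurePreserving.quasiMeasurePreserving
  have hTm := hTq.measurable
  set σ : ℕ → ℝ := fun n => s * scaling b (μ (B n)).toNNReal with hσdef
  have hσ : ∀ n, 0 ≤ σ n := fun n => by positivity
  set Ψ : ℕ → X → ℝ := fun n => discounted T (B n) (σ n) (g n) with hΨ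
  have hΨm : ∀ n, Measurable (Ψ n) := fun n =>
    measurable_discounted hTm (hB.measurableSet n) (hg n)
  have hΨabs : ∀ n x, |Ψ n x| ≤ 1 := fun n x => by
    rw [abs_of_nonneg (discounted_nonneg (hg0 n) x)]
    exact discounted_le_one (hσ n) (hg0 n) (hg1 n) x
  have hE : Tendsto (fun n => (∫ x in B n, (1 - Real.exp (-(σ n * τ n x))) ∂μ) / μ.real (B n))
      atTop (𝓝 0) := h.tendsto_integral_one_sub_exp hs
  have hlt : Tendsto (fun n => μ.real (U n ∩ {x | (τ n x : ℕ∞) < returnTime T (B n) 1 x})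
      / μ.real (U n)) atTop (𝓝 0) := by
    rw [← tendsto_inf_principal_nhds_iff_of_forall_eq (s := {n | μ (U n) ≠ 0}) fun n hn => by
      have hn0 : μ (U n) = 0 := by simpa using hn
      simp [measureReal_def, hn0]]
    have := (ENNReal.tendsto_toReal ENNReal.zero_ne_top).comp h.cluster_from_U
    rw [ENNReal.toReal_zero] at this
    exact this.congr fun n => toReal_cond_apply μ (h.measurableSet_U n)
  have hind := h.tendsto_integral_inducedMap_U hT hB hg hg0 hg1
  have hbound := (hE.add hlt).add hind.norm
  simp only [add_zero, norm_zero] at hbound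
  refine squeeze_zero_norm' ?_ hbound
  filter_upwards [eventually_ge_atTop 1, hB.eventually_lt_top, hB.eventually_real_pos]
    with n hn hBfin hBpos
  have hUB : μ (U n) ≤ μ (B n) := by rw [h.measure_eq hn]; exact le_self_add
  have hUfin : μ (U n) < ∞ := hUB.trans_lt hBfin
  have hUres : μ.restrict (U n) ≤ μ.restrict (B n) := by
    rw [h.restrict_eq hn]; exact Measure.le_add_right le_rfl
  set E : X → ℝ := fun x => 1 - Real.exp (-(σ n * τ n x)) with hEdef
  have hτm : Measurable fun x => (τ n x : ℝ) := (measurable_of_countable _).comp (h.measurable_τ n)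
  have hEm : Measurable E :=
    measurable_const.sub (Real.measurable_exp.comp (measurable_const.mul hτm).neg)
  have hE0 : ∀ x, 0 ≤ E x := fun x =>
    sub_nonneg.2 (Real.exp_le_one_iff.2 (neg_nonpos.2 (mul_nonneg (hσ n) (Nat.cast_nonneg _))))
  have hE1 : ∀ x, |E x| ≤ 1 := fun x => by
    rw [abs_of_nonneg (hE0 x)]
    linarith [Real.exp_pos (-(σ n * τ n x))]
  set G : Set X := {x | (τ n x : ℕ∞) < returnTime T (B n) 1 x} with hG
  have hGm : MeasurableSet G :=
    measurableSet_nat_lt (measurable_returnTime hTm (hB.measurableSet n) 1) (h.measurable_τ n)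
  have hi1 : Integrable (Ψ n) (μ.restrict (U n)) :=
    integrable_restrict_of_abs_le hUfin.ne (hΨm n) (hΨabs n)
  have hi2 : Integrable (fun x => g n (inducedMap T (B n) x)) (μ.restrict (U n)) :=
    integrable_restrict_of_abs_le hUfin.ne
      ((hg n).comp (measurable_inducedMap hTm (hB.measurableSet n)))
      fun x => by rw [abs_of_nonneg (hg0 n _)]; exact hg1 n _
  have hdiff : |∫ x in U n, (Ψ n x - g n (inducedMap T (B n) x)) ∂μ|
      ≤ ∫ x in B n, E x ∂μ + μ.real (U n ∩ G) := by
    have iE : Integrable E (μ.restrict (U n)) := integrable_restrict_of_abs_le hUfin.ne hEm hE1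
    have iG : Integrable (G.indicator fun _ => (1 : ℝ)) (μ.restrict (U n)) :=
      integrable_restrict_of_abs_le hUfin.ne (measurable_const.indicator hGm) (C := 1)
        fun x => by by_cases hx : x ∈ G <;> simp [hx]
    have hstep : |∫ x in U n, (Ψ n x - g n (inducedMap T (B n) x)) ∂μ|
        ≤ ∫ x in U n, (E x + G.indicator (fun _ => 1) x) ∂μ := by
      rw [← Real.norm_eq_abs]
      refine norm_integral_le_of_norm_le (iE.add iG) (ae_of_all _ fun x => ?_)
      exact abs_discounted_sub_inducedMap_le (hσ n) (hg0 n) (hg1 n) x (τ n x)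
    rw [integral_add iE iG, integral_indicator_const _ hGm,
      measureReal_restrict_apply hGm, smul_eq_mul, mul_one, inter_comm G] at hstep
    refine hstep.trans ?_
    gcongr
    · exact ae_of_all _ hE0
    · exact integrable_restrict_of_abs_le hBfin.ne hEm hE1
  rw [integral_sub hi1 hi2] at hdiff
  -- For μ(U) = 0 the right side is 0 by convention, but so is the left side.
  have hG2 : μ.real (U n ∩ G) / μ.real (B n) ≤ μ.real (U n ∩ G) / μ.real (U n) := by
    rcases eq_or_ne (μ (U n)) 0 with h0 | h0
    · have : μ.real (U n ∩ G) = 0 := by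
        rw [measureReal_def, measure_mono_null inter_subset_left h0, ENNReal.toReal_zero]
      simp [this]
    · have hUpos : 0 < μ.real (U n) := ENNReal.toReal_pos h0 hUfin.ne
      have : μ.real (U n) ≤ μ.real (B n) := ENNReal.toReal_mono hBfin.ne hUB
      gcongr
  have hkey : (∫ x in U n, Ψ n x ∂μ) / μ.real (B n)
        - μ.real (U n) / μ.real (B n) * ((∫ x in B n, g n x ∂μ) / μ.real (B n))
      = (∫ x in U n, Ψ n x ∂μ - ∫ x in U n, g n (inducedMap T (B n) x) ∂μ) / μ.real (B n)
        + ((∫ x in U n, g n (inducedMap T (B n) x) ∂μ) / μ.real (B n)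
        - μ.real (U n) / μ.real (B n) * ((∫ x in B n, g n x ∂μ) / μ.real (B n))) := by
    ring
  change ‖(∫ x in U n, Ψ n x ∂μ) / μ.real (B n)
        - μ.real (U n) / μ.real (B n) * ((∫ x in B n, g n x ∂μ) / μ.real (B n))‖ ≤ _
  rw [hkey]
  refine (norm_add_le _ _).trans ?_
  gcongr
  rw [Real.norm_eq_abs, abs_div, abs_of_pos hBpos]
  calc _ ≤ (∫ x in B n, E x ∂μ + μ.real (U n ∩ G)) / μ.real (B n) := by gcongr
    _ = (∫ x in B n, E x ∂μ) / μ.real (B n) + μ.real (U n ∩ G) / μ.real (B n) := add_div _ _ _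
    _ ≤ _ := by gcongr

theorem abs_average_le {D : Set X} (hD : μ D < ∞) {φ : X → ℝ} (h1 : ∀ x, |φ x| ≤ 1) :
    |(∫ x in D, φ x ∂μ) / μ.real D| ≤ 1 := by
  rw [abs_div, abs_of_nonneg measureReal_nonneg]
  refine div_le_one_of_le₀ ?_ measureReal_nonneg
  rw [← Real.norm_eq_abs]
  simpa using norm_setIntegral_le_of_norm_le_const (C := 1) (f := φ) hD (fun x _ => h1 x)

/-- The return functional as a mixture. -/
theorem tendsto_return_sub_mixture [SigmaFinite μ] (hT : IsCEMPT μ T)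
    (hab : IsAsymptoticInverse a b) (hB : IsRareSequence μ B)
    (h : AssumptionsFor μ T α θ a b B Y U Q τ 𝒰) (hθ : 0 < θ) {s : ℝ} (hs : 0 ≤ s)
    {g : ℕ → X → ℝ} (hg : ∀ n, Measurable (g n)) (hg0 : ∀ n x, 0 ≤ g n x)
    (hg1 : ∀ n x, g n x ≤ 1) {f : X → ℝ} (hf : Integrable f μ) (hf0 : 0 ≤ᵐ[μ] f)
    (hf1 : ∫ x, f x ∂μ = 1) :
    Tendsto (fun n =>
      (∫ x in B n, discounted T (B n) (s * scaling b (μ (B n)).toNNReal) (g n) x ∂μ)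
          / μ.real (B n)
        - ((1 - θ) * ((∫ x in B n, g n x ∂μ) / μ.real (B n)) + θ *
          ∫ x, f x * discounted T (B n) (s * scaling b (μ (B n)).toNNReal) (g n) x ∂μ))
      atTop (𝓝 0) := by
  have hTm := hT.measurePreserving.measurable
  have hU := h.tendsto_integral_U hT hB hs hg hg0 hg1
  have hQ := h.tendsto_integral_Q hT hab hB hθ hs hg hg0 hg1 hf hf1
  have hUd := h.tendsto_U_div hB
  have hQd := h.extremalIndex
  set Ψ : ℕ → X → ℝ := fun n => discounted T (B n) (s * scaling b (μ (B n)).toNNReal) (g n)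
    with hΨ
  have hΨm : ∀ n, Measurable (Ψ n) := fun n =>
    measurable_discounted hTm (hB.measurableSet n) (hg n)
  have hΨabs : ∀ n x, |Ψ n x| ≤ 1 := fun n x => by
    rw [abs_of_nonneg (discounted_nonneg (hg0 n) x)]
    exact discounted_le_one (by positivity) (hg0 n) (hg1 n) x
  set m : ℕ → ℝ := fun n => (∫ x in B n, g n x ∂μ) / μ.real (B n) with hm
  set c : ℕ → ℝ := fun n => ∫ x, f x * Ψ n x ∂μ with hc
  have hm1 : ∀ᶠ n in atTop, |m n| ≤ 1 := by
    filter_upwards [hB.eventually_lt_top] with n hn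
    exact abs_average_le hn fun x => by rw [abs_of_nonneg (hg0 n x)]; exact hg1 n x
  have hc1 : ∀ n, |c n| ≤ 1 := fun n => by
    rw [← hf1]
    exact abs_integral_mul_comp_le (T := T) hf hf0 (hΨabs n) 0
  -- The proportions of U and Q may be replaced by their limits 1 - θ and θ, because they multiply
  -- quantities bounded by 1.
  have h1 : Tendsto (fun n => (μ.real (U n) / μ.real (B n) - (1 - θ)) * m n) atTop (𝓝 0) := by
    refine squeeze_zero_norm' ?_ (by simpa using (hUd.sub_const (1 - θ)).norm)
    filter_upwards [hm1] with n hn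
    rw [norm_mul]
    exact mul_le_of_le_one_right (norm_nonneg _) hn
  have h2 : Tendsto (fun n => (μ.real (Q n) / μ.real (B n) - θ) * c n) atTop (𝓝 0) := by
    refine squeeze_zero_norm (fun n => ?_) (by simpa using (hQd.sub_const θ).norm)
    rw [norm_mul]
    exact mul_le_of_le_one_right (norm_nonneg _) (hc1 n)
  have h3 := ((hU.add (hQd.mul hQ)).add h1).add h2
  rw [mul_zero, add_zero, add_zero, add_zero] at h3
  refine h3.congr' ?_
  filter_upwards [eventually_ge_atTop 1, hB.eventually_lt_top, hB.eventually_real_pos,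
    h.eventually_Q_pos hθ] with n hn hBfin hBpos hQpos
  have e := h.measure_eq hn
  have hUfin : μ (U n) ≠ ∞ := ne_top_of_le_ne_top hBfin.ne (e ▸ le_self_add)
  have hQfin : μ (Q n) ≠ ∞ := ne_top_of_le_ne_top hBfin.ne (e ▸ le_add_self)
  have hsplit : ∫ x in B n, Ψ n x ∂μ = ∫ x in U n, Ψ n x ∂μ + ∫ x in Q n, Ψ n x ∂μ := by
    rw [h.restrict_eq hn, integral_add_measure
      (integrable_restrict_of_abs_le hUfin (hΨm n) (hΨabs n))
      (integrable_restrict_of_abs_le hQfin (hΨm n) (hΨabs n))]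
  change (∫ x in U n, Ψ n x ∂μ) / μ.real (B n) - μ.real (U n) / μ.real (B n) * m n
    + μ.real (Q n) / μ.real (B n) * ((∫ x in Q n, Ψ n x ∂μ) / μ.real (Q n) - c n)
    + _ + _ = (∫ x in B n, Ψ n x ∂μ) / μ.real (B n) - ((1 - θ) * m n + θ * c n)
  rw [hsplit]
  field_simp
  ring

end AssumptionsFor


/-- The Laplace transform of the Mittag-Leffler law. -/
noncomputable def fracLaplace (α lam s : ℝ) : ℝ := lam / (lam + s ^ α)

section

variable {α lam : ℝ}

theorem fracLaplace_zero (hα : 0 < α) (hlam : 0 < lam) : fracLaplace α lam 0 = 1 := by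
  rw [fracLaplace, Real.zero_rpow hα.ne', add_zero, div_self hlam.ne']

theorem fracLaplace_le_one (hlam : 0 < lam) {s : ℝ} (hs : 0 ≤ s) : fracLaplace α lam s ≤ 1 := by
  have := Real.rpow_nonneg hs α
  exact div_le_one_of_le₀ (by linarith) (by linarith)

theorem fracLaplace_lt_one (hlam : 0 < lam) {s : ℝ} (hs : 0 < s) : fracLaplace α lam s < 1 := by
  have := Real.rpow_pos_of_pos hs α
  rw [fracLaplace, div_lt_one (by linarith)]
  linarith

theorem continuousAt_fracLaplace_zero (hα : 0 < α) (hlam : 0 < lam) :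
    Tendsto (fracLaplace α lam) (𝓝 0) (𝓝 1) := by
  have h : ContinuousAt (fracLaplace α lam) 0 := by
    unfold fracLaplace
    refine continuousAt_const.div
      (continuousAt_const.add (Real.continuousAt_rpow_const 0 α (Or.inr hα.le))) ?_
    rw [Real.zero_rpow hα.ne', add_zero]
    exact hlam.ne'
  simpa [ContinuousAt, fracLaplace_zero hα hlam] using h

end

/-- The bound does not depend on g, so that removing a small discount is controlled by the
functional with g = 1. This gives access to the parameter s = 0. -/
theorem discounted_zero_sub_le {X : Type*} {T : X → X} {A : Set X} {σ : ℝ} (hσ : 0 ≤ σ)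
    {g : X → ℝ} (hg0 : ∀ x, 0 ≤ g x) (hg1 : ∀ x, g x ≤ 1) (x : X) :
    |discounted T A 0 g x - discounted T A σ g x| ≤ 1 - discounted T A σ (fun _ => 1) x := by
  unfold discounted
  split_ifs with h
  · simp
  · have h1 : Real.exp (-(σ * ((returnTime T A 1 x).toNat : ℝ))) ≤ 1 :=
      Real.exp_le_one_iff.2 (neg_nonpos.2 (by positivity))
    rw [zero_mul, neg_zero, Real.exp_zero, ← sub_mul, abs_mul, abs_of_nonneg (sub_nonneg.2 h1),
      abs_of_nonneg (hg0 _), mul_one]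
    exact mul_le_of_le_one_right (sub_nonneg.2 h1) (hg1 _)

/-! ### Solving the two relations -/

namespace AssumptionsFor

variable {X : Type*} [MeasurableSpace X] {μ : Measure X} {T : X → X}
  {B : ℕ → Set X} {a : ℕ → ℝ≥0} {b : ℝ≥0 → ℝ≥0} {α θ : ℝ} {Y : Set X} {U Q : ℕ → Set X}
  {τ : ℕ → X → ℕ} {𝒰 : Set (Lp ℝ 1 μ)}

/-- Some probability density for which the hitting functional factorizes asymptotically. -/
theorem exists_tendsto_hitting [SigmaFinite μ] (hT : IsCEMPT μ T)
    (hab : IsAsymptoticInverse a b) (hB : IsRareSequence μ B) (hα₀ : 0 < α) (hα₁ : α ≤ 1)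
    (h : AssumptionsFor μ T α θ a b B Y U Q τ 𝒰) (hθ : 0 < θ) :
    ∃ f : X → ℝ, Integrable f μ ∧ 0 ≤ᵐ[μ] f ∧ ∫ x, f x ∂μ = 1 ∧
      ∀ s : ℝ, 0 ≤ s → ∀ g : ℕ → X → ℝ, (∀ n, Measurable (g n)) → (∀ n x, 0 ≤ g n x) →
        (∀ n x, g n x ≤ 1) →
        Tendsto (fun n =>
          ∫ x, f x * discounted T (B n) (s * scaling b (μ (B n)).toNNReal) (g n) x ∂μ
          - fracLaplace α (θ * Real.Gamma (1 + α)) s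
            * ((∫ x in B n, g n x ∂μ) / μ.real (B n))) atTop (𝓝 0) := by
  obtain ⟨f, hf, hf0, hf1, hlim⟩ := h.uniformSet.exists_tendsto_hitting_sub_return
    hT.measurePreserving hα₀ hα₁ h.regularlyVarying hab hB h.subset_uniformSet
  have hTm := hT.measurePreserving.measurable
  have hΓ : 0 < Real.Gamma (1 + α) := Real.Gamma_pos_of_pos (by linarith)
  set lam := θ * Real.Gamma (1 + α) with hlam
  have hlam0 : 0 < lam := mul_pos hθ hΓ
  have hpos : ∀ s : ℝ, 0 < s → ∀ g : ℕ → X → ℝ, (∀ n, Measurable (g n)) → (∀ n x, 0 ≤ g n x) →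
        (∀ n x, g n x ≤ 1) →
        Tendsto (fun n =>
          ∫ x, f x * discounted T (B n) (s * scaling b (μ (B n)).toNNReal) (g n) x ∂μ
          - fracLaplace α lam s * ((∫ x in B n, g n x ∂μ) / μ.real (B n))) atTop (𝓝 0) := by
    intro s hs g hg hg0 hg1
    have h1 := hlim s hs g hg hg0 hg1
    have h2 := h.tendsto_return_sub_mixture hT hab hB hθ hs.le hg hg0 hg1 hf hf0 hf1
    set c := Real.Gamma (1 + α) * s ^ (-α) with hc
    have hsα : 0 < s ^ α := Real.rpow_pos_of_pos hs α
    have hc' : c = Real.Gamma (1 + α) / s ^ α := by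
      rw [hc, Real.rpow_neg hs.le, div_eq_mul_inv]
    have hc0 : 0 < c := hc' ▸ div_pos hΓ hsα
    -- Eliminating the return functional R from H ≈ c (m - R) and R ≈ (1-θ) m + θ H leaves (1 + cθ)
    -- H ≈ cθ m, and cθ/(1 + cθ) is the Mittag-Leffler transform.
    have h3 := (h1.sub (h2.const_mul c)).const_mul (1 / (1 + c * θ))
    rw [mul_zero, sub_zero, mul_zero] at h3
    refine h3.congr fun n => ?_
    have hL : fracLaplace α lam s = c * θ / (1 + c * θ) := by
      rw [fracLaplace, hc', hlam]
      field_simp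
      ring
    rw [hL]
    have : 1 + c * θ ≠ 0 := by positivity
    field_simp
    ring
  refine ⟨f, hf, hf0, hf1, fun s hs g hg hg0 hg1 => ?_⟩
  rcases hs.eq_or_lt with rfl | hs
  swap
  · exact hpos s hs g hg hg0 hg1
  rw [fracLaplace_zero hα₀ hlam0]
  -- At s = 0 the first relation is not available, so s = 0 is compared with a small s > 0. Removing
  -- the discount costs at most 1 minus the hitting functional for g = 1, which is close to 1 -
  -- `fracLaplace α lam s` < ε/4; four errors of size ε/4 arise in total.
  refine Metric.tendsto_atTop'.2 fun ε hε => ?_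
  have hL : ∀ᶠ s in 𝓝[>] (0 : ℝ), 1 - ε / 4 < fracLaplace α lam s :=
    ((continuousAt_fracLaplace_zero hα₀ hlam0).mono_left nhdsWithin_le_nhds).eventually
      (lt_mem_nhds (by linarith))
  obtain ⟨s, hsL, hs⟩ := (hL.and self_mem_nhdsWithin).exists
  have hs : 0 < s := hs
  have h1 := hpos s hs g hg hg0 hg1
  have h2 := hpos s hs (fun _ _ => 1) (fun _ => measurable_const) (fun _ _ => zero_le_one)
    fun _ _ => le_rfl
  have hε4 : 0 < ε / 4 := by positivity
  have e1 := h1.eventually (Metric.ball_mem_nhds _ hε4)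
  have e2 := h2.eventually (Metric.ball_mem_nhds _ hε4)
  obtain ⟨N, hN⟩ := eventually_atTop.1
    (e1.and (e2.and (hB.eventually_lt_top.and hB.eventually_real_pos)))
  refine ⟨N, fun n hn => ?_⟩
  obtain ⟨e1, e2, hBfin, hBpos⟩ := hN n hn.le
  have hgabs : ∀ x, |g n x| ≤ 1 := fun x => by rw [abs_of_nonneg (hg0 n x)]; exact hg1 n x
  have hm1 := abs_average_le hBfin hgabs
  set m := (∫ x in B n, g n x ∂μ) / μ.real (B n) with hm
  set L := fracLaplace α lam s with hLdef
  have hL1 : L ≤ 1 := fracLaplace_le_one hlam0 hs.le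
  set σ := s * scaling b (μ (B n)).toNNReal with hσdef
  have hσ : 0 ≤ σ := by positivity
  have hone : (∫ x in B n, (1 : ℝ) ∂μ) / μ.real (B n) = 1 := by
    rw [setIntegral_const, smul_eq_mul, mul_one, div_self hBpos.ne']
  rw [Real.dist_eq, sub_zero] at e1 e2
  rw [hone, mul_one] at e2
  have hi : ∀ ρ : ℝ, 0 ≤ ρ → ∀ φ : X → ℝ, Measurable φ → (∀ x, 0 ≤ φ x) → (∀ x, φ x ≤ 1) →
      Integrable (fun x => f x * discounted T (B n) ρ φ x) μ := fun ρ hρ φ hφ hφ0 hφ1 =>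
    integrable_mul_of_mem_Icc hf (measurable_discounted hTm (hB.measurableSet n) hφ)
      (discounted_nonneg hφ0) (discounted_le_one hρ hφ0 hφ1)
  have i0 := hi 0 le_rfl (g n) (hg n) (hg0 n) (hg1 n)
  have i1 := hi σ hσ (g n) (hg n) (hg0 n) (hg1 n)
  have i2 := hi σ hσ (fun _ => 1) measurable_const (fun _ => zero_le_one) fun _ => le_rfl
  have e3 : |∫ x, f x * discounted T (B n) 0 (g n) x ∂μ
      - ∫ x, f x * discounted T (B n) σ (g n) x ∂μ|
      ≤ 1 - ∫ x, f x * discounted T (B n) σ (fun _ => 1) x ∂μ := by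
    have e5 : 1 - ∫ x, f x * discounted T (B n) σ (fun _ => 1) x ∂μ
        = ∫ x, (f x - f x * discounted T (B n) σ (fun _ => 1) x) ∂μ := by
      rw [integral_sub hf i2, hf1]
    rw [← integral_sub i0 i1, e5, ← Real.norm_eq_abs]
    refine norm_integral_le_of_norm_le (hf.sub i2) ?_
    filter_upwards [hf0] with x hx
    have hx : 0 ≤ f x := hx
    rw [← mul_sub, norm_mul, Real.norm_of_nonneg hx, Real.norm_eq_abs, ← mul_one_sub]
    exact mul_le_mul_of_nonneg_left (discounted_zero_sub_le hσ (hg0 n) (hg1 n) x) hx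
  rw [zero_mul, one_mul, Real.dist_eq, sub_zero]
  have e4 : |(1 - L) * m| ≤ 1 - L := by
    rw [abs_mul, abs_of_nonneg (sub_nonneg.2 hL1)]
    exact mul_le_of_le_one_right (sub_nonneg.2 hL1) hm1
  rw [abs_lt] at e1 e2 ⊢
  rw [abs_le] at e3 e4
  constructor <;> nlinarith

variable [SigmaFinite μ] (hT : IsCEMPT μ T)
    (hab : IsAsymptoticInverse a b) (hB : IsRareSequence μ B) (hα₀ : 0 < α) (hα₁ : α ≤ 1)
    (h : AssumptionsFor μ T α θ a b B Y U Q τ 𝒰) (hθ : 0 < θ) {s : ℝ} (hs : 0 ≤ s)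
    {g : ℕ → X → ℝ} (hg : ∀ n, Measurable (g n)) (hg0 : ∀ n x, 0 ≤ g n x)
    (hg1 : ∀ n x, g n x ≤ 1)

include hT hab hB hα₀ hα₁ h hθ hs hg hg0 hg1

/-- The function v - (∫ v) f has integral zero, so asymptotic invariance transfers the limit from
the particular density f to v. -/
theorem tendsto_hitting {v : X → ℝ} (hv : Integrable v μ) :
    Tendsto (fun n =>
      ∫ x, v x * discounted T (B n) (s * scaling b (μ (B n)).toNNReal) (g n) x ∂μ
        - (∫ x, v x ∂μ) * (fracLaplace α (θ * Real.Gamma (1 + α)) s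
          * ((∫ x in B n, g n x ∂μ) / μ.real (B n)))) atTop (𝓝 0) := by
  have hTm := hT.measurePreserving.measurable
  obtain ⟨f, hf, hf0, hf1, hlim⟩ := h.exists_tendsto_hitting hT hab hB hα₀ hα₁ hθ
  have h1 := (hlim s hs g hg hg0 hg1).const_mul (∫ x, v x ∂μ)
  have h2 := hT.tendsto_integral_discounted hab hB hs hg hg0 hg1
    (u := fun x => v x - (∫ y, v y ∂μ) * f x) (hv.sub (hf.const_mul _)) (by
      rw [integral_sub hv (hf.const_mul _), integral_const_mul, hf1, mul_one, sub_self])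
  have h3 := h2.add h1
  rw [mul_zero, add_zero] at h3
  refine h3.congr fun n => ?_
  have hi : ∀ w : X → ℝ, Integrable w μ → Integrable (fun x => w x *
      discounted T (B n) (s * scaling b (μ (B n)).toNNReal) (g n) x) μ := fun w hw =>
    integrable_mul_of_mem_Icc hw (measurable_discounted hTm (hB.measurableSet n) (hg n))
      (discounted_nonneg (hg0 n)) (discounted_le_one (by positivity) (hg0 n) (hg1 n))
  simp only [sub_mul, mul_assoc]
  rw [integral_sub (hi v hv) ((hi f hf).const_mul _), integral_const_mul]
  ring

theorem tendsto_return :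
    Tendsto (fun n =>
      (∫ x in B n, discounted T (B n) (s * scaling b (μ (B n)).toNNReal) (g n) x ∂μ)
          / μ.real (B n)
        - ((1 - θ) + θ * fracLaplace α (θ * Real.Gamma (1 + α)) s)
          * ((∫ x in B n, g n x ∂μ) / μ.real (B n))) atTop (𝓝 0) := by
  obtain ⟨f, hf, hf0, hf1, hlim⟩ := h.exists_tendsto_hitting hT hab hB hα₀ hα₁ hθ
  have h1 := (hlim s hs g hg hg0 hg1).const_mul θ
  have h2 := h.tendsto_return_sub_mixture hT hab hB hθ hs hg hg0 hg1 hf hf0 hf1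
  have h3 := h2.add h1
  rw [mul_zero, add_zero] at h3
  refine h3.congr fun n => ?_
  ring

end AssumptionsFor


/-! ### Joint Laplace transforms of successive waiting times -/

section WaitingTimes

variable {X : Type*} {T : X → X} {A : Set X}

/-- Iterated discounting: the joint Laplace transform of the first `k` waiting times. -/
noncomputable def discountedProd (T : X → X) (A : Set X) (γ : ℝ≥0) : ℕ → (ℕ → ℕ) → X → ℝ
  | 0, _ => fun _ => 1
  | k + 1, s => discounted T A (s 0 * γ) (discountedProd T A γ k fun i => s (i + 1))

/-- The scaled waiting times between successive visits to `A`. -/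
noncomputable def waitingTime (T : X → X) (A : Set X) (γ : ℝ≥0) (x : X) (i : ℕ) : ℝ≥0 :=
  γ * ((returnTime T A (i + 1) x).toNat - (returnTime T A i x).toNat : ℕ)

theorem measurable_discountedProd [MeasurableSpace X] (hT : Measurable T) (hA : MeasurableSet A) (γ : ℝ≥0) (k : ℕ)
    (s : ℕ → ℕ) : Measurable (discountedProd T A γ k s) := by
  induction k generalizing s with
  | zero => exact measurable_const
  | succ k ih => exact measurable_discounted hT hA (ih _)

theorem discountedProd_nonneg (γ : ℝ≥0) (k : ℕ) (s : ℕ → ℕ) (x : X) :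
    0 ≤ discountedProd T A γ k s x := by
  induction k generalizing s x with
  | zero => exact zero_le_one
  | succ k ih => exact discounted_nonneg (ih _) x

theorem discountedProd_le_one (γ : ℝ≥0) (k : ℕ) (s : ℕ → ℕ) (x : X) :
    discountedProd T A γ k s x ≤ 1 := by
  induction k generalizing s x with
  | zero => exact le_rfl
  | succ k ih => exact discounted_le_one (by positivity) (discountedProd_nonneg γ k _) (ih _) x

theorem measurable_waitingTime [MeasurableSpace X] (hT : Measurable T) (hA : MeasurableSet A) (γ : ℝ≥0) :
    Measurable (waitingTime T A γ) := by
  refine measurable_pi_lambda _ fun i => ?_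
  have h : ∀ k, Measurable fun x => (returnTime T A k x).toNat := fun k =>
    (measurable_of_countable ENat.toNat).comp (measurable_returnTime hT hA k)
  have h2 : Measurable fun n : ℕ => γ * (n : ℝ≥0) := measurable_of_countable _
  exact h2.comp ((h (i + 1)).sub (h i))

theorem returnTime_inducedMap_ne_top {x : X} (h : ∀ n, ∃ k, n < k ∧ T^[k] x ∈ A) :
    ∀ n, ∃ k, n < k ∧ T^[k] (inducedMap T A x) ∈ A :=
  frequently_visit_iterate h _

theorem toNat_returnTime_lt {x : X} (h : ∀ n, ∃ k, n < k ∧ T^[k] x ∈ A) (k : ℕ) :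
    (returnTime T A k x).toNat < (returnTime T A (k + 1) x).toNat := by
  rw [← Nat.cast_lt (α := ℕ∞), ENat.natCast_toNat (returnTime_ne_top h k),
    ENat.natCast_toNat (returnTime_ne_top h (k + 1))]
  exact returnTime_lt_succ (returnTime_ne_top h (k + 1))

theorem sum_waitingTime {x : X} (h : ∀ n, ∃ k, n < k ∧ T^[k] x ∈ A) (γ : ℝ≥0) (k : ℕ) :
    ∑ i ∈ Finset.range k, waitingTime T A γ x i = γ * ((returnTime T A k x).toNat : ℝ≥0) := by
  induction k with
  | zero => simp [returnTime]
  | succ k ih =>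
    rw [Finset.sum_range_succ, ih, waitingTime, ← mul_add, ← Nat.cast_add,
      Nat.add_sub_cancel' (toNat_returnTime_lt h k).le]

/-- This shift property makes the nested functional `discountedProd` a product over waiting times
along one orbit. -/
theorem waitingTime_succ {x : X} (h : ∀ n, ∃ k, n < k ∧ T^[k] x ∈ A) (γ : ℝ≥0) (i : ℕ) :
    waitingTime T A γ x (i + 1) = waitingTime T A γ (inducedMap T A x) i := by
  have h' := returnTime_inducedMap_ne_top h
  have h1 := returnTime_ne_top h 1
  rw [waitingTime, waitingTime, returnTime_succ_eq_add h1 (i + 1),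
    returnTime_succ_eq_add h1 i,
    ENat.toNat_add h1 (returnTime_ne_top h' _), ENat.toNat_add h1 (returnTime_ne_top h' _),
    Nat.add_sub_add_left]

theorem discountedProd_eq {x : X} (h : ∀ n, ∃ k, n < k ∧ T^[k] x ∈ A) (γ : ℝ≥0) (k : ℕ)
    (s : ℕ → ℕ) : discountedProd T A γ k s x
      = ∏ i ∈ Finset.range k, Real.exp (-(s i * (waitingTime T A γ x i : ℝ))) := by
  induction k generalizing s x with
  | zero => simp [discountedProd]
  | succ k ih =>
    rw [Finset.prod_range_succ', discountedProd, discounted, if_neg (returnTime_ne_top h 1),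
      ih (returnTime_inducedMap_ne_top h), mul_comm]
    simp only [waitingTime_succ h]
    congr 3
    simp [waitingTime, returnTime]
    ring

end WaitingTimes

/-- The Laplace transform of the waiting time between two returns. -/
noncomputable def returnLaplace (α θ s : ℝ) : ℝ :=
  (1 - θ) + θ * fracLaplace α (θ * Real.Gamma (1 + α)) s

namespace AssumptionsFor

variable {X : Type*} [MeasurableSpace X] {μ : Measure X} {T : X → X}
  {B : ℕ → Set X} {a : ℕ → ℝ≥0} {b : ℝ≥0 → ℝ≥0} {α θ : ℝ} {Y : Set X} {U Q : ℕ → Set X}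
  {τ : ℕ → X → ℕ} {𝒰 : Set (Lp ℝ 1 μ)}

/-- By induction, using as g the functional of the remaining waiting times. Each return contributes
one factor, which is asymptotic independence. -/
theorem tendsto_average_discountedProd [SigmaFinite μ] (hT : IsCEMPT μ T)
    (hab : IsAsymptoticInverse a b) (hB : IsRareSequence μ B) (hα₀ : 0 < α) (hα₁ : α ≤ 1)
    (h : AssumptionsFor μ T α θ a b B Y U Q τ 𝒰) (hθ : 0 < θ) (k : ℕ) (s : ℕ → ℕ) :
    Tendsto (fun n => (∫ x in B n,
        discountedProd T (B n) (scaling b (μ (B n)).toNNReal) k s x ∂μ) / μ.real (B n)) atTop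
      (𝓝 (∏ i ∈ Finset.range k, returnLaplace α θ (s i))) := by
  have hTm := hT.measurePreserving.measurable
  induction k generalizing s with
  | zero =>
    simp only [Finset.range_zero, Finset.prod_empty]
    refine tendsto_const_nhds.congr' ?_
    filter_upwards [hB.eventually_real_pos] with n hn
    simp [discountedProd, hn.ne']
  | succ k ih =>
    have h1 := h.tendsto_return hT hab hB hα₀ hα₁ hθ (s := s 0) (Nat.cast_nonneg _)
      (g := fun n => discountedProd T (B n) (scaling b (μ (B n)).toNNReal) k fun i => s (i + 1))
      (fun n => measurable_discountedProd hTm (hB.measurableSet n) _ _ _)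
      (fun n => discountedProd_nonneg _ _ _) (fun n => discountedProd_le_one _ _ _)
    have h2 := h1.add ((ih fun i => s (i + 1)).const_mul (returnLaplace α θ (s 0)))
    rw [zero_add] at h2
    rw [Finset.prod_range_succ', mul_comm]
    refine h2.congr fun n => ?_
    simp only [discountedProd, returnLaplace]
    ring

/-- The first waiting time is a hitting time and contributes its own factor. After it the point is
distributed as if uniformly in Bₙ, so the later factors are those of the return process. -/
theorem tendsto_integral_discountedProd [SigmaFinite μ] (hT : IsCEMPT μ T)
    (hab : IsAsymptoticInverse a b) (hB : IsRareSequence μ B) (hα₀ : 0 < α) (hα₁ : α ≤ 1)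
    (h : AssumptionsFor μ T α θ a b B Y U Q τ 𝒰) (hθ : 0 < θ) {v : X → ℝ} (hv : Integrable v μ)
    (k : ℕ) (s : ℕ → ℕ) :
    Tendsto (fun n => ∫ x,
        v x * discountedProd T (B n) (scaling b (μ (B n)).toNNReal) (k + 1) s x ∂μ) atTop
      (𝓝 ((∫ x, v x ∂μ) * (fracLaplace α (θ * Real.Gamma (1 + α)) (s 0)
        * ∏ i ∈ Finset.range k, returnLaplace α θ (s (i + 1))))) := by
  have hTm := hT.measurePreserving.measurable
  have h1 := h.tendsto_hitting hT hab hB hα₀ hα₁ hθ (s := s 0) (Nat.cast_nonneg _)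
      (g := fun n => discountedProd T (B n) (scaling b (μ (B n)).toNNReal) k fun i => s (i + 1))
      (fun n => measurable_discountedProd hTm (hB.measurableSet n) _ _ _)
      (fun n => discountedProd_nonneg _ _ _) (fun n => discountedProd_le_one _ _ _) hv
  have h2 := h1.add (((h.tendsto_average_discountedProd hT hab hB hα₀ hα₁ hθ k
    fun i => s (i + 1)).const_mul (fracLaplace α (θ * Real.Gamma (1 + α)) (s 0))).const_mul
      (∫ x, v x ∂μ))
  rw [zero_add] at h2
  refine h2.congr fun n => ?_
  simp only [discountedProd]
  ring

end AssumptionsFor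


/-! ### From waiting times to point measures -/

/-- Sequences of waiting times with divergent sum. -/
def divergentTimes : Set (ℕ → ℝ≥0) := {w | ∀ M : ℕ, ∃ i, (M : ℝ≥0) < ∑ k ∈ Finset.range i, w k}

theorem measurableSet_divergentTimes : MeasurableSet divergentTimes := by
  simp only [divergentTimes, ofPred_forall, ofPred_exists]
  refine MeasurableSet.iInter fun M => MeasurableSet.iUnion fun i => ?_
  exact measurableSet_lt measurable_const
    (Finset.measurable_sum _ fun k _ => measurable_pi_apply k)

theorem monotone_partialSums (w : ℕ → ℝ≥0) : Monotone fun i => ∑ k ∈ Finset.range i, w k :=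
  fun _ _ h => Finset.sum_le_sum_of_subset (Finset.range_mono h)

theorem exists_partialSum_gt {w : ℕ → ℝ≥0} (hw : w ∈ divergentTimes) (M : ℝ≥0) :
    ∃ i, M < ∑ k ∈ Finset.range i, w k := by
  obtain ⟨n, hn⟩ := exists_nat_gt M
  obtain ⟨i, hi⟩ := hw n
  exact ⟨i, hn.trans hi⟩

/-- The measure `∑ᵢ δ_{w₀ + ⋯ + wᵢ}`. -/
noncomputable def renewalMeasure (w : ℕ → ℝ≥0) : Measure ℝ≥0 :=
  Measure.sum fun i : ℕ => Measure.dirac (∑ k ∈ Finset.range (i + 1), w k)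

theorem pointsOfWaitingTimes_one (w : ℕ → ℝ≥0) :
    (pointsOfWaitingTimes w fun _ => 1) = toAtomicRadon (renewalMeasure w) := by
  simp [pointsOfWaitingTimes, renewalMeasure]

theorem isAtomicRadon_renewalMeasure {w : ℕ → ℝ≥0} (hw : w ∈ divergentTimes) :
    IsLocallyFiniteMeasure (renewalMeasure w) ∧
      ∃ S : Set ℝ≥0, S.Countable ∧ renewalMeasure w Sᶜ = 0 := by
  constructor
  · refine ⟨fun x => ⟨Iio (x + 1), Iio_mem_nhds (lt_add_of_pos_right x one_pos), ?_⟩⟩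
    obtain ⟨i, hi⟩ := exists_partialSum_gt hw (x + 1)
    rw [renewalMeasure, Measure.sum_apply _ measurableSet_Iio,
      tsum_eq_sum (s := Finset.range i) fun j hj => ?_]
    · exact ENNReal.sum_lt_top.2 fun j _ => measure_lt_top _ _
    · rw [Measure.dirac_apply' _ measurableSet_Iio, indicator_of_notMem]
      have hij : i ≤ j + 1 := by
        rw [Finset.mem_range, not_lt] at hj
        omega
      exact not_lt.2 (hi.le.trans (monotone_partialSums w hij))
  · have hc : (range fun i => ∑ k ∈ Finset.range (i + 1), w k).Countable := countable_range _
    refine ⟨_, hc, ?_⟩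
    rw [renewalMeasure, Measure.sum_apply _ hc.measurableSet.compl, ENNReal.tsum_eq_zero]
    intro i
    rw [Measure.dirac_apply' _ hc.measurableSet.compl, indicator_of_notMem]
    exact fun h => h (mem_range_self i)

theorem toAtomicRadon_val {ν : Measure ℝ≥0}
    (h : IsLocallyFiniteMeasure ν ∧ ∃ S : Set ℝ≥0, S.Countable ∧ ν Sᶜ = 0) :
    (toAtomicRadon ν).1 = ν :=
  congrArg Subtype.val (dif_pos h)

/-- Once a partial sum has passed the support of f, no later atom counts. The condition on n is open
in w, so the same finite sum serves in a whole neighbourhood of w. -/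
theorem integral_renewalMeasure {w : ℕ → ℝ≥0} (hw : w ∈ divergentTimes) (f : C_c(ℝ≥0, ℝ))
    {M : ℝ≥0} (hM : ∀ x, M < x → f x = 0) {n : ℕ} (hn : M < ∑ k ∈ Finset.range n, w k) :
    ∫ x, f x ∂(toAtomicRadon (renewalMeasure w)).1
      = ∑ i ∈ Finset.range n, f (∑ k ∈ Finset.range (i + 1), w k) := by
  have h := isAtomicRadon_renewalMeasure hw
  have := h.1
  rw [toAtomicRadon_val h]
  have hi : Integrable f (renewalMeasure w) :=
    f.continuous.integrable_of_hasCompactSupport f.hasCompactSupport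
  rw [renewalMeasure] at hi ⊢
  rw [integral_sum_measure hi]
  simp only [integral_dirac]
  refine tsum_eq_sum fun i hin => hM _ (hn.trans_le (monotone_partialSums w ?_))
  rw [Finset.mem_range, not_lt] at hin
  omega

theorem continuousOn_pointsOfWaitingTimes :
    ContinuousOn (fun w => toAtomicRadon (renewalMeasure w)) divergentTimes := by
  rw [continuousOn_iff_continuous_domRestrict]
  refine continuous_induced_rng.2 (continuous_pi fun f => ?_)
  obtain ⟨M, hM⟩ := f.hasCompactSupport.isCompact.bddAbove
  have hM' : ∀ x, M < x → f x = 0 := fun x hx => by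
    by_contra h0
    exact absurd (hM (subset_tsupport _ (Function.mem_support.2 h0))) (not_le.2 hx)
  have hsum : ∀ n : ℕ, Continuous fun w : divergentTimes => ∑ k ∈ Finset.range n, w.1 k :=
    fun n => continuous_finsetSum _ fun k _ => (continuous_apply k).comp continuous_subtype_val
  refine continuous_iff_continuousAt.2 fun w => ?_
  obtain ⟨n, hn⟩ := exists_partialSum_gt w.2 M
  have hc : Continuous fun w : divergentTimes =>
      ∑ i ∈ Finset.range n, f (∑ k ∈ Finset.range (i + 1), w.1 k) :=
    continuous_finsetSum _ fun i _ => f.continuous.comp (hsum (i + 1))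
  refine hc.continuousAt.congr ?_
  filter_upwards [(hsum n).continuousAt.eventually (lt_mem_nhds hn)] with w' hw'
  exact (integral_renewalMeasure w'.2 f hM' hw').symm

open Classical in
/-- A globally measurable version of the point process with given waiting times. -/
noncomputable def renewalPoints (w : ℕ → ℝ≥0) : AtomicRadon :=
  divergentTimes.piecewise (fun w => toAtomicRadon (renewalMeasure w)) (fun _ => toAtomicRadon 0) w

theorem renewalPoints_eq {w : ℕ → ℝ≥0} (hw : w ∈ divergentTimes) :
    renewalPoints w = pointsOfWaitingTimes w fun _ => 1 := by
  classical
  rw [renewalPoints, piecewise_eq_of_mem _ _ _ hw, pointsOfWaitingTimes_one]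

theorem measurable_renewalPoints : Measurable renewalPoints := by
  classical
  exact continuousOn_pointsOfWaitingTimes.measurable_piecewise continuousOn_const
    measurableSet_divergentTimes

theorem continuousOn_renewalPoints : ContinuousOn renewalPoints divergentTimes := by
  classical
  exact continuousOn_pointsOfWaitingTimes.congr fun w hw => piecewise_eq_of_mem _ _ _ hw

section

variable {X : Type*} {T : X → X} {A : Set X}

/-- The k-th return time is at least k. -/
theorem waitingTime_mem_divergentTimes {x : X} (h : ∀ n, ∃ k, n < k ∧ T^[k] x ∈ A) {γ : ℝ≥0}
    (hγ : 0 < γ) : waitingTime T A γ x ∈ divergentTimes := by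
  intro M
  have hle : ∀ k : ℕ, k ≤ (returnTime T A k x).toNat := fun k => by
    induction k with
    | zero => exact Nat.zero_le _
    | succ k ih => exact ih.trans_lt (toNat_returnTime_lt h k)
  obtain ⟨n, hn⟩ := exists_nat_gt ((M : ℝ≥0) / γ)
  refine ⟨n, ?_⟩
  rw [sum_waitingTime h]
  rw [div_lt_iff₀ hγ] at hn
  refine hn.trans_le ?_
  rw [mul_comm]
  gcongr
  exact hle n

theorem REPP_eq [MeasurableSpace X] {μ : Measure X} {x : X}
    (h : ∀ n, ∃ k, n < k ∧ T^[k] x ∈ A) (γ : ℝ≥0 → ℝ≥0) :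
    REPP μ T γ A x = pointsOfWaitingTimes (waitingTime T A (γ (μ A).toNNReal) x) fun _ => 1 := by
  rw [pointsOfWaitingTimes_one, REPP, renewalMeasure]
  congr 2
  funext k
  rw [if_neg (returnTime_ne_top h _), sum_waitingTime h]

theorem REPP_eq_renewalPoints [MeasurableSpace X] {μ : Measure X} {x : X}
    (h : ∀ n, ∃ k, n < k ∧ T^[k] x ∈ A) {γ : ℝ≥0 → ℝ≥0} (hγ : 0 < γ (μ A).toNNReal) :
    REPP μ T γ A x = renewalPoints (waitingTime T A (γ (μ A).toNNReal) x) := by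
  rw [renewalPoints_eq (waitingTime_mem_divergentTimes h hγ), REPP_eq h]

/-- If the scaling vanishes, all atoms sit at 0 and the process is almost everywhere constant.
Otherwise it agrees almost everywhere with the Borel map `renewalPoints` of the waiting times. -/
theorem aemeasurable_REPP [MeasurableSpace X] {μ ν : Measure X} (hT : Measurable T)
    (hA : MeasurableSet A) (h : ∀ᵐ x ∂ν, ∀ n, ∃ k, n < k ∧ T^[k] x ∈ A) (γ : ℝ≥0 → ℝ≥0) :
    AEMeasurable (REPP μ T γ A) ν := by
  rcases eq_or_ne (γ (μ A).toNNReal) 0 with h0 | h0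
  · refine ⟨fun _ => pointsOfWaitingTimes 0 fun _ => 1, measurable_const, ?_⟩
    filter_upwards [h] with x hx
    rw [REPP_eq hx, h0]
    congr 1
    funext i
    exact zero_mul _
  · refine ⟨_, measurable_renewalPoints.comp (measurable_waitingTime hT hA (γ (μ A).toNNReal)), ?_⟩
    filter_upwards [h] with x hx
    exact REPP_eq_renewalPoints hx (pos_iff_ne_zero.2 h0)

end


/-! ### Convergence of Laplace transforms and continuous mapping -/

/-- Weak convergence of laws on the Hilbert cube follows from the convergence of moments. -/
theorem tendsto_of_tendsto_moments {ρ : ℕ → ProbabilityMeasure (ℕ → unitInterval)}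
    {ρ' : ProbabilityMeasure (ℕ → unitInterval)}
    (h : ∀ (k : ℕ) (s : ℕ → ℕ), Tendsto (fun n =>
      ∫ u, ∏ i ∈ Finset.range (k + 1), (u i : ℝ) ^ s i ∂(ρ n : Measure (ℕ → unitInterval))) atTop
      (𝓝 (∫ u, ∏ i ∈ Finset.range (k + 1), (u i : ℝ) ^ s i
        ∂(ρ' : Measure (ℕ → unitInterval))))) :
    Tendsto ρ atTop (𝓝 ρ') := by
  let c : ℕ → C(ℕ → unitInterval, ℝ) := fun i =>
    ⟨fun u => u i, continuous_subtype_val.comp (continuous_apply i)⟩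
  set S := Algebra.adjoin ℝ (range c) with hS
  have hint : ∀ (κ : ProbabilityMeasure (ℕ → unitInterval)) (φ : C(ℕ → unitInterval, ℝ)),
      Integrable φ (κ : Measure (ℕ → unitInterval)) := fun κ φ =>
    φ.continuous.integrable_of_hasCompactSupport (HasCompactSupport.of_compactSpace φ)
  let good : C(ℕ → unitInterval, ℝ) → Prop := fun φ => Tendsto (fun n =>
    ∫ u, φ u ∂(ρ n : Measure (ℕ → unitInterval))) atTop
      (𝓝 (∫ u, φ u ∂(ρ' : Measure (ℕ → unitInterval))))
  -- Products of coordinates are monomials and their span is the algebra generated by the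
  -- coordinates, which is dense by Stone-Weierstrass. Coordinates absent from a monomial enter the
  -- hypothesis with exponent 0.
  have hmono : ∀ φ ∈ Submonoid.closure (range c),
      ∃ s : ℕ →₀ ℕ, φ = s.prod fun i e => c i ^ e := by
    intro φ hφ
    induction hφ using Submonoid.closure_induction with
    | mem x hx =>
      obtain ⟨i, rfl⟩ := hx
      exact ⟨Finsupp.single i 1, by simp⟩
    | one => exact ⟨0, by simp⟩
    | mul x y _ _ hx hy =>
      obtain ⟨s, rfl⟩ := hx
      obtain ⟨t, rfl⟩ := hy
      exact ⟨s + t, (Finsupp.prod_add_index' (fun _ => pow_zero _) fun _ _ _ => pow_add _ _ _).symm⟩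
  have hgoodS : ∀ φ ∈ S, good φ := by
    intro φ hφ
    rw [← Subalgebra.mem_toSubmodule, hS, Algebra.adjoin_eq_span] at hφ
    induction hφ using Submodule.span_induction with
    | mem x hx =>
      obtain ⟨s, rfl⟩ := hmono x hx
      obtain ⟨k, hk⟩ := s.support.exists_nat_subset_range
      have e : ∀ u, (s.prod fun i e => c i ^ e) u
          = ∏ i ∈ Finset.range (k + 1), (u i : ℝ) ^ s i := fun u => by
        rw [Finsupp.prod_of_support_subset s
          (hk.trans (Finset.range_mono k.le_succ)) _ fun _ _ => pow_zero _,
          ContinuousMap.coe_prod, Finset.prod_apply]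
        rfl
      simp only [good, e]
      exact h k s
    | zero => simp [good]
    | add x y _ _ hx hy =>
      simp only [good, ContinuousMap.add_apply]
      have := Tendsto.add hx hy
      rw [← integral_add (hint _ _) (hint _ _)] at this
      exact this.congr fun n => (integral_add (hint _ _) (hint _ _)).symm
    | smul r x _ hx =>
      simp only [good, ContinuousMap.smul_apply, smul_eq_mul, integral_const_mul]
      exact Tendsto.const_mul r hx
  have hsep : S.SeparatesPoints := by
    intro u v huv
    obtain ⟨i, hi⟩ := Function.ne_iff.1 huv
    exact ⟨c i, ⟨c i, Algebra.subset_adjoin (mem_range_self i), rfl⟩,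
      fun h => hi (Subtype.ext h)⟩
  have hdense : ∀ φ : C(ℕ → unitInterval, ℝ), φ ∈ closure (S : Set C(ℕ → unitInterval, ℝ)) := by
    intro φ
    rw [← Subalgebra.topologicalClosure_coe,
      ContinuousMap.subalgebra_topologicalClosure_eq_top_of_separatesPoints S hsep]
    exact trivial
  refine ProbabilityMeasure.tendsto_iff_forall_integral_tendsto.2 fun f => ?_
  refine Metric.tendsto_atTop.2 fun ε hε => ?_
  obtain ⟨p, hpS, hp⟩ := Metric.mem_closure_iff.1 (hdense f.toContinuousMap) (ε / 3) (by positivity)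
  obtain ⟨N, hN⟩ := Metric.tendsto_atTop.1 (hgoodS p hpS) (ε / 3) (by positivity)
  have hclose : ∀ κ : ProbabilityMeasure (ℕ → unitInterval),
      |∫ u, f u ∂(κ : Measure (ℕ → unitInterval)) - ∫ u, p u ∂(κ : Measure (ℕ → unitInterval))|
        ≤ ε / 3 := fun κ => by
    have hf : Integrable (fun u => f u) (κ : Measure (ℕ → unitInterval)) := hint κ f.toContinuousMap
    rw [← integral_sub hf (hint κ p), ← Real.norm_eq_abs]
    have hb : ∀ u, ‖f u - p u‖ ≤ ε / 3 := fun u => by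
      rw [← dist_eq_norm]
      exact (ContinuousMap.dist_apply_le_dist (f := f.toContinuousMap) (g := p) u).trans hp.le
    simpa using norm_integral_le_of_norm_le_const (μ := (κ : Measure (ℕ → unitInterval)))
      (ae_of_all _ hb)
  refine ⟨N, fun n hn => ?_⟩
  have h1 := hN n hn
  have h2 := hclose (ρ n)
  have h3 := hclose ρ'
  rw [Real.dist_eq, abs_lt] at h1 ⊢
  rw [abs_le] at h2 h3
  constructor <;> linarith

/-- The homeomorphism `x ↦ e⁻ˣ` onto `(0, 1]`. -/
noncomputable def expNeg (x : ℝ≥0) : unitInterval :=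
  ⟨Real.exp (-(x : ℝ)), (Real.exp_pos _).le, Real.exp_le_one_iff.2 (neg_nonpos.2 x.2)⟩

theorem isInducing_expNeg : IsInducing expNeg := by
  refine (IsInducing.subtypeVal.of_comp_iff).1 ?_
  exact Real.isOpenEmbedding_exp.isInducing.comp
    ((Homeomorph.neg ℝ).isInducing.comp IsInducing.subtypeVal)

/-- The image omits points with a zero coordinate and is not closed. Being inducing is enough:
closures of sets of waiting times are preimages of closures in the compact cube. -/
theorem isInducing_expNeg_pi : IsInducing fun (w : ℕ → ℝ≥0) i => expNeg (w i) :=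
  IsInducing.piMap fun _ => isInducing_expNeg

/-- The continuous mapping theorem for sequences of waiting times whose joint Laplace transforms
converge. -/
theorem tendsto_integral_of_tendsto_laplace {Ω Ω' E : Type*} [MeasurableSpace Ω]
    [MeasurableSpace Ω'] [TopologicalSpace E] [MeasurableSpace E] [OpensMeasurableSpace E]
    {P : ℕ → Measure Ω} [∀ n, IsProbabilityMeasure (P n)] {P' : Measure Ω'}
    [IsProbabilityMeasure P'] {W : ℕ → Ω → ℕ → ℝ≥0} (hW : ∀ n, Measurable (W n))
    {V : Ω' → ℕ → ℝ≥0} (hV : Measurable V) {G : Set (ℕ → ℝ≥0)} {Φ : (ℕ → ℝ≥0) → E}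
    (hΦ : Measurable Φ) (hc : ContinuousOn Φ G) (hWG : ∀ n, ∀ᵐ ω ∂P n, W n ω ∈ G)
    (hVG : ∀ᵐ ω ∂P', V ω ∈ G)
    (hlap : ∀ (k : ℕ) (s : ℕ → ℕ), Tendsto (fun n =>
      ∫ ω, ∏ i ∈ Finset.range (k + 1), Real.exp (-(s i * (W n ω i : ℝ))) ∂P n) atTop
      (𝓝 (∫ ω, ∏ i ∈ Finset.range (k + 1), Real.exp (-(s i * (V ω i : ℝ))) ∂P'))) (F : E →ᵇ ℝ) :
    Tendsto (fun n => ∫ ω, F (Φ (W n ω)) ∂P n) atTop (𝓝 (∫ ω, F (Φ (V ω)) ∂P')) := by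
  set e : (ℕ → ℝ≥0) → ℕ → unitInterval := fun w i => expNeg (w i) with he
  have hem : Measurable e := isInducing_expNeg_pi.continuous.measurable
  have hemW : ∀ n, Measurable fun ω => e (W n ω) := fun n => hem.comp (hW n)
  have hemV : Measurable fun ω => e (V ω) := hem.comp hV
  have hΦW : ∀ n, Measurable fun ω => Φ (W n ω) := fun n => hΦ.comp (hW n)
  have hΦV : Measurable fun ω => Φ (V ω) := hΦ.comp hV
  let ρ : ℕ → ProbabilityMeasure (ℕ → unitInterval) := fun n =>
    ⟨(P n).map fun ω => e (W n ω), Measure.isProbabilityMeasure_map (hemW n).aemeasurable⟩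
  let ρ' : ProbabilityMeasure (ℕ → unitInterval) :=
    ⟨P'.map fun ω => e (V ω), Measure.isProbabilityMeasure_map hemV.aemeasurable⟩
  have hpow : ∀ (w : ℕ → ℝ≥0) (k : ℕ) (s : ℕ → ℕ), ∏ i ∈ Finset.range (k + 1), (e w i : ℝ) ^ s i
      = ∏ i ∈ Finset.range (k + 1), Real.exp (-(s i * (w i : ℝ))) := fun w k s =>
    Finset.prod_congr rfl fun i _ => by
      rw [← mul_neg, Real.exp_nat_mul]
      rfl
  have hmm : ∀ (k : ℕ) (s : ℕ → ℕ), Measurable fun u : ℕ → unitInterval =>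
      ∏ i ∈ Finset.range (k + 1), (u i : ℝ) ^ s i := fun k s =>
    Finset.measurable_prod _ fun i _ =>
      (measurable_subtype_coe.comp (measurable_pi_apply i)).pow_const _
  have hρ : Tendsto ρ atTop (𝓝 ρ') := by
    refine tendsto_of_tendsto_moments fun k s => ?_
    simp only [ρ, ρ', ProbabilityMeasure.coe_mk]
    rw [integral_map hemV.aemeasurable (hmm k s).aestronglyMeasurable]
    simp only [hpow]
    refine (hlap k s).congr fun n => ?_
    rw [integral_map (hemW n).aemeasurable (hmm k s).aestronglyMeasurable]
    simp only [hpow]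
  let κ : ℕ → ProbabilityMeasure E := fun n =>
    ⟨(P n).map fun ω => Φ (W n ω), Measure.isProbabilityMeasure_map (hΦW n).aemeasurable⟩
  let κ' : ProbabilityMeasure E :=
    ⟨P'.map fun ω => Φ (V ω), Measure.isProbabilityMeasure_map hΦV.aemeasurable⟩
  have hκ : Tendsto κ atTop (𝓝 κ') := by
    refine tendsto_of_forall_isClosed_limsup_le' fun C hC => ?_
    -- Portmanteau is applied to this closed set of the cube. For V in G, e(V) ∈ D means that V is
    -- in the closure of G ∩ Φ⁻¹C, and continuity of Φ on G then puts Φ(V) in C, although D may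
    -- contain points outside the image of e.
    set D := closure (e '' (G ∩ Φ ⁻¹' C)) with hD
    have h1 := ProbabilityMeasure.limsup_measure_closed_le_of_tendsto hρ
      (isClosed_closure (s := e '' (G ∩ Φ ⁻¹' C)))
    have h2 : (ρ' : Measure (ℕ → unitInterval)) D ≤ (κ' : Measure E) C := by
      simp only [ρ', κ', ProbabilityMeasure.coe_mk]
      rw [Measure.map_apply hemV isClosed_closure.measurableSet,
        Measure.map_apply hΦV hC.measurableSet]
      refine measure_mono_ae ?_
      filter_upwards [hVG] with ω hω hωD
      have hcl : V ω ∈ closure (G ∩ Φ ⁻¹' C) := by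
        rw [isInducing_expNeg_pi.closure_eq_preimage_closure_image]
        exact hωD
      have hmap : Φ (V ω) ∈ closure (Φ '' (G ∩ Φ ⁻¹' C)) :=
        ((hc _ hω).mono inter_subset_left).mem_closure_image hcl
      have : closure (Φ '' (G ∩ Φ ⁻¹' C)) ⊆ C :=
        closure_minimal (image_subset_iff.2 inter_subset_right) hC
      exact this hmap
    refine le_trans (limsup_le_limsup (Eventually.of_forall fun n => ?_)) (h1.trans h2)
    simp only [ρ, κ, ProbabilityMeasure.coe_mk]
    rw [Measure.map_apply (hemW n) isClosed_closure.measurableSet,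
        Measure.map_apply (hΦW n) hC.measurableSet]
    refine measure_mono_ae ?_
    filter_upwards [hWG n] with ω hω hωC
    exact subset_closure (mem_image_of_mem e ⟨hω, hωC⟩)
  have h := ProbabilityMeasure.tendsto_iff_forall_integral_tendsto.1 hκ F
  have hF : Measurable F := F.continuous.measurable
  simp only [κ, κ', ProbabilityMeasure.coe_mk] at h
  rw [integral_map hΦV.aemeasurable hF.aestronglyMeasurable] at h
  refine h.congr fun n => ?_
  rw [integral_map (hΦW n).aemeasurable hF.aestronglyMeasurable]

/-- A sequence of waiting times diverges almost surely if the Laplace transforms of its partial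
sums tend to zero. -/
theorem ae_mem_divergentTimes {Ω : Type*} [MeasurableSpace Ω] {P : Measure Ω}
    [IsFiniteMeasure P] {V : Ω → ℕ → ℝ≥0} (hV : Measurable V)
    (h : Tendsto (fun k : ℕ => ∫ ω, ∏ i ∈ Finset.range (k + 1), Real.exp (-(V ω i : ℝ)) ∂P) atTop
      (𝓝 0)) : ∀ᵐ ω ∂P, V ω ∈ divergentTimes := by
  simp only [divergentTimes, mem_ofPred_eq]
  refine ae_all_iff.2 fun M => ?_
  have hVi : ∀ i, Measurable fun ω => (V ω i : ℝ) := fun i =>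
    measurable_subtype_coe.comp ((measurable_pi_apply i).comp hV)
  -- On the event that all partial sums stay below M, every product is at least e^(-M). Products of
  -- vanishing expectation therefore make the event null.
  set A := {ω | ∀ i, ∑ k ∈ Finset.range i, V ω k ≤ (M : ℝ≥0)} with hA
  have hAm : MeasurableSet A := by
    simp only [hA, ofPred_forall]
    exact MeasurableSet.iInter fun i => measurableSet_le
      (Finset.measurable_sum _ fun k _ => (measurable_pi_apply k).comp hV) measurable_const
  have hle : ∀ k : ℕ, Real.exp (-M) * P.real A
      ≤ ∫ ω, ∏ i ∈ Finset.range (k + 1), Real.exp (-(V ω i : ℝ)) ∂P := by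
    intro k
    rw [mul_comm, ← smul_eq_mul, ← integral_indicator_const _ hAm]
    refine integral_mono ((integrable_const _).indicator hAm) ?_ fun ω => ?_
    · refine Integrable.of_bound (C := 1) (Measurable.aestronglyMeasurable ?_) (ae_of_all _ fun ω => ?_)
      · exact Finset.measurable_prod _ fun i _ => Real.measurable_exp.comp (hVi i).neg
      · rw [Real.norm_of_nonneg (Finset.prod_nonneg fun i _ => (Real.exp_pos _).le)]
        exact Finset.prod_le_one (fun i _ => (Real.exp_pos _).le) fun i _ =>
          Real.exp_le_one_iff.2 (neg_nonpos.2 (V ω i).2)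
    · by_cases hω : ω ∈ A
      · rw [indicator_of_mem hω, ← Real.exp_sum, Finset.sum_neg_distrib]
        refine Real.exp_le_exp.2 (neg_le_neg ?_)
        exact_mod_cast hω (k + 1)
      · rw [indicator_of_notMem hω]
        exact Finset.prod_nonneg fun i _ => (Real.exp_pos _).le
  have h0 : Real.exp (-M) * P.real A ≤ 0 := ge_of_tendsto' h hle
  have hA0 : P A = 0 := by
    have : P.real A ≤ 0 := nonpos_of_mul_nonpos_right h0 (Real.exp_pos _)
    exact (measureReal_eq_zero_iff).1 (le_antisymm this measureReal_nonneg)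
  filter_upwards [measure_eq_zero_iff_ae_notMem.1 hA0] with ω hω
  simpa [hA] using hω


/-! ### I.i.d. sequences and the geometric law -/

/-- Prepending a term to a sequence. -/
def consSeq {E : Type*} (x : E) (w : ℕ → E) : ℕ → E
  | 0 => x
  | n + 1 => w n

theorem sum_range_succ_consSeq (x : ℝ≥0) (w : ℕ → ℝ≥0) (n : ℕ) :
    ∑ k ∈ Finset.range (n + 1), consSeq x w k = x + ∑ k ∈ Finset.range n, w k := by
  rw [Finset.sum_range_succ', add_comm]
  rfl

theorem measurable_consSeq {E : Type*} [MeasurableSpace E] :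
    Measurable fun p : E × (ℕ → E) => consSeq p.1 p.2 := by
  refine measurable_pi_lambda _ fun i => ?_
  cases i with
  | zero => exact measurable_fst
  | succ i => exact (measurable_pi_apply i).comp measurable_snd

/-- Both sides agree on finite-dimensional boxes, which characterizes the product measure. This is
what permits conditioning on the first term of an i.i.d. sequence. -/
theorem map_consSeq_infinitePi {E : Type*} [MeasurableSpace E] (η : Measure E)
    [IsProbabilityMeasure η] :
    (η.prod (Measure.infinitePi fun _ : ℕ => η)).map (fun p => consSeq p.1 p.2)
      = Measure.infinitePi fun _ : ℕ => η := by
  classical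
  refine Measure.eq_infinitePi _ fun s t ht => ?_
  obtain ⟨N, hN⟩ := s.exists_nat_subset_range
  set t' : ℕ → Set E := fun i => if i ∈ s then t i else univ with ht'
  have ht'm : ∀ i, MeasurableSet (t' i) := fun i => by
    by_cases hi : i ∈ s
    · simp only [ht', if_pos hi, ht i]
    · simp only [ht', if_neg hi, MeasurableSet.univ]
  have hset : (fun p : E × (ℕ → E) => consSeq p.1 p.2) ⁻¹' (Set.pi s t)
      = t' 0 ×ˢ Set.pi (Finset.range N) (fun i => t' (i + 1)) := by
    ext ⟨x, w⟩
    simp only [mem_preimage, Set.mem_pi, mem_prod, Finset.mem_coe]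
    constructor
    · refine fun h => ⟨?_, fun i _ => ?_⟩
      · by_cases hi : 0 ∈ s
        · simp only [ht', if_pos hi]
          exact h 0 hi
        · simp only [ht', if_neg hi, mem_univ]
      · by_cases hi : i + 1 ∈ s
        · simp only [ht', if_pos hi]
          exact h _ hi
        · simp only [ht', if_neg hi, mem_univ]
    · rintro ⟨h0, h1⟩ i hi
      cases i with
      | zero =>
        simp only [ht', if_pos hi] at h0
        exact h0
      | succ i =>
        have := h1 i (Finset.mem_range.2 (by have := Finset.mem_range.1 (hN hi); omega))
        simp only [ht', if_pos hi] at this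
        exact this
  rw [Measure.map_apply measurable_consSeq
    (MeasurableSet.pi s.countable_toSet fun i _ => ht i), hset, Measure.prod_prod,
    Measure.infinitePi_pi _ fun i _ => ht'm (i + 1), mul_comm,
    ← Finset.prod_range_succ' fun i => η (t' i)]
  rw [← Finset.prod_subset (hN.trans (Finset.range_mono N.le_succ)) fun i _ hi => ?_]
  · exact Finset.prod_congr rfl fun i hi => by simp only [ht', if_pos hi]
  · simp only [ht', if_neg hi, measure_univ]

theorem lintegral_infinitePi_consSeq {E : Type*} [MeasurableSpace E] (η : Measure E)
    [IsProbabilityMeasure η] {φ : (ℕ → E) → ℝ≥0∞} (hφ : Measurable φ) :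
    ∫⁻ w, φ w ∂(Measure.infinitePi fun _ : ℕ => η)
      = ∫⁻ x, ∫⁻ w, φ (consSeq x w) ∂(Measure.infinitePi fun _ : ℕ => η) ∂η := by
  conv_lhs => rw [← map_consSeq_infinitePi]
  rw [lintegral_map hφ measurable_consSeq,
    lintegral_prod (fun p : E × (ℕ → E) => φ (consSeq p.1 p.2))
      (hφ.comp measurable_consSeq).aemeasurable]

/-- The joint Laplace transform of an i.i.d. sequence. -/
theorem lintegral_prod_infinitePi {E : Type*} [MeasurableSpace E] (η : Measure E)
    [IsProbabilityMeasure η] {φ : ℕ → E → ℝ≥0∞} (hφ : ∀ i, Measurable (φ i)) (k : ℕ) :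
    ∫⁻ w, ∏ i ∈ Finset.range k, φ i (w i) ∂(Measure.infinitePi fun _ : ℕ => η)
      = ∏ i ∈ Finset.range k, ∫⁻ x, φ i x ∂η := by
  induction k generalizing φ with
  | zero => simp
  | succ k ih =>
    have hm' : Measurable fun w : ℕ → E => ∏ i ∈ Finset.range (k + 1), φ i (w i) :=
      Finset.measurable_fun_prod _ fun i _ => (hφ i).comp (measurable_pi_apply i)
    rw [lintegral_infinitePi_consSeq η hm']
    simp only [Finset.prod_range_succ', consSeq]
    have hm : Measurable fun w : ℕ → E => ∏ i ∈ Finset.range k, φ (i + 1) (w i) :=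
      Finset.measurable_fun_prod _ fun i _ => (hφ (i + 1)).comp (measurable_pi_apply i)
    simp only [lintegral_mul_const _ hm, ih fun i => hφ (i + 1)]
    rw [lintegral_const_mul _ (hφ 0)]

/-- Memorylessness: the value is 1 with probability θ, and otherwise it is one more than an
independent copy. -/
theorem lintegral_positiveGeometric {θ : unitInterval} (hθ : 0 < θ) (φ : ℕ → ℝ≥0∞) :
    ∫⁻ j, φ j ∂(positiveGeometric θ : Measure ℕ) = ENNReal.ofReal θ * φ 1
      + ENNReal.ofReal (1 - θ) * ∫⁻ j, φ (j + 1) ∂(positiveGeometric θ : Measure ℕ) := by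
  have h : ∀ ψ : ℕ → ℝ≥0∞, ∫⁻ j, ψ j ∂(positiveGeometric θ : Measure ℕ)
      = ∑' n : ℕ, ENNReal.ofReal ((1 - θ) ^ n * θ) * ψ (n + 1) := fun ψ => by
    change ∫⁻ j, ψ j ∂((geometricMeasure θ).map Nat.succ) = _
    rw [lintegral_map (measurable_of_countable _) (measurable_of_countable _),
      geometricMeasure_eq hθ.ne', lintegral_sum_measure]
    simp only [lintegral_smul_measure, lintegral_dirac, smul_eq_mul, Nat.succ_eq_add_one]
  have h1 : (0 : ℝ) ≤ 1 - θ := sub_nonneg.2 θ.2.2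
  rw [h, h, tsum_eq_zero_add' ENNReal.summable, pow_zero, one_mul, ← ENNReal.tsum_mul_left]
  congr 2
  funext n
  rw [← mul_assoc, ← ENNReal.ofReal_mul h1, pow_succ']
  ring_nf

theorem ae_positiveGeometric (θ : unitInterval) :
    ∀ᵐ j ∂(positiveGeometric θ : Measure ℕ), 1 ≤ j := by
  change ∀ᵐ j ∂((geometricMeasure θ).map Nat.succ), 1 ≤ j
  rw [ae_map_iff (measurable_of_countable _).aemeasurable (MeasurableSet.of_discrete)]
  exact ae_of_all _ fun j => Nat.succ_le_succ j.zero_le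

/-! ### Compound processes as renewal sequences with zero waiting times -/

section Expansion

/-- Remove one point from the list of points with multiplicities. -/
def stepPoints (z : (ℕ → ℝ≥0) × (ℕ → ℕ)) : (ℕ → ℝ≥0) × (ℕ → ℕ) :=
  if z.2 0 ≤ 1 then (fun i => z.1 (i + 1), fun i => z.2 (i + 1))
  else (consSeq 0 fun i => z.1 (i + 1), consSeq (z.2 0 - 1) fun i => z.2 (i + 1))

/-- Waiting times between successive points counted with multiplicity. -/
def expandedTimes (z : (ℕ → ℝ≥0) × (ℕ → ℕ)) (j : ℕ) : ℝ≥0 := (stepPoints^[j] z).1 0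

theorem expandedTimes_succ (z : (ℕ → ℝ≥0) × (ℕ → ℕ)) (j : ℕ) :
    expandedTimes z (j + 1) = expandedTimes (stepPoints z) j := rfl

theorem measurable_stepPoints : Measurable stepPoints := by
  have h1 : ∀ i, Measurable fun z : (ℕ → ℝ≥0) × (ℕ → ℕ) => z.1 i := fun i =>
    (measurable_pi_apply i).comp measurable_fst
  have h2 : ∀ i, Measurable fun z : (ℕ → ℝ≥0) × (ℕ → ℕ) => z.2 i := fun i =>
    (measurable_pi_apply i).comp measurable_snd
  have s1 : Measurable fun z : (ℕ → ℝ≥0) × (ℕ → ℕ) => fun i => z.1 (i + 1) :=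
    measurable_pi_lambda _ fun i => h1 (i + 1)
  have s2 : Measurable fun z : (ℕ → ℝ≥0) × (ℕ → ℕ) => fun i => z.2 (i + 1) :=
    measurable_pi_lambda _ fun i => h2 (i + 1)
  refine Measurable.ite ?_ (s1.prodMk s2) ?_
  · exact h2 0 (MeasurableSet.of_discrete (s := Iic 1))
  · refine (measurable_consSeq.comp (measurable_const.prodMk s1)).prodMk
      (measurable_consSeq.comp (Measurable.prodMk ?_ s2))
    exact (measurable_of_countable fun n : ℕ => n - 1).comp (h2 0)

theorem measurable_expandedTimes : Measurable expandedTimes :=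
  measurable_pi_lambda _ fun j => (measurable_pi_apply 0).comp
    (measurable_fst.comp (measurable_stepPoints.iterate j))

/-- The integral of a function against the sum of point masses. -/
noncomputable def totalMass (h : ℝ≥0 → ℝ≥0∞) (z : (ℕ → ℝ≥0) × (ℕ → ℕ)) : ℝ≥0∞ :=
  ∑' i, (z.2 i : ℝ≥0∞) * h (∑ k ∈ Finset.range (i + 1), z.1 k)

/-- One unit of the first atom is removed and the origin is moved to it. If multiplicity remains,
the next point is at the same place, hence the prepended waiting time 0. -/
theorem totalMass_step (h : ℝ≥0 → ℝ≥0∞) {z : (ℕ → ℝ≥0) × (ℕ → ℕ)} (hz : 1 ≤ z.2 0) :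
    totalMass h z = h (z.1 0) + totalMass (fun x => h (z.1 0 + x)) (stepPoints z) := by
  have e : ∀ i, ∑ k ∈ Finset.range (i + 1 + 1), z.1 k
      = z.1 0 + ∑ k ∈ Finset.range (i + 1), z.1 (k + 1) := fun i => by
    rw [Finset.sum_range_succ' _ (i + 1), add_comm]
  rw [totalMass, tsum_eq_zero_add' ENNReal.summable]
  simp only [e, zero_add, Finset.sum_range_one]
  unfold stepPoints
  split_ifs with h1
  · have : z.2 0 = 1 := le_antisymm h1 hz
    simp [totalMass, this]
  · obtain ⟨m, hm⟩ := Nat.exists_eq_add_of_le hz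
    have hR : ∀ g : ℝ≥0 → ℝ≥0∞, totalMass g
        (consSeq 0 fun i => z.1 (i + 1), consSeq (z.2 0 - 1) fun i => z.2 (i + 1))
        = (m : ℝ≥0∞) * g 0
          + ∑' i, (z.2 (i + 1) : ℝ≥0∞) * g (∑ k ∈ Finset.range (i + 1), z.1 (k + 1)) := fun g => by
      rw [totalMass, tsum_eq_zero_add' ENNReal.summable, hm, Nat.add_sub_cancel_left]
      simp only [sum_range_succ_consSeq, zero_add, Finset.sum_range_zero]
      rfl
    rw [hR, hm, Nat.cast_add, Nat.cast_one, add_mul, one_mul, add_zero, add_assoc]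

theorem stepPoints_pos {z : (ℕ → ℝ≥0) × (ℕ → ℕ)} (hz : ∀ i, 1 ≤ z.2 i) :
    ∀ i, 1 ≤ (stepPoints z).2 i := by
  intro i
  unfold stepPoints
  split_ifs with h
  · exact hz (i + 1)
  · cases i with
    | zero => simp only [consSeq]; omega
    | succ i => exact hz (i + 1)

theorem totalMass_iterate (h : ℝ≥0 → ℝ≥0∞) {z : (ℕ → ℝ≥0) × (ℕ → ℕ)} (hz : ∀ i, 1 ≤ z.2 i)
    (J : ℕ) : totalMass h z
      = ∑ j ∈ Finset.range J, h (∑ k ∈ Finset.range (j + 1), expandedTimes z k)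
        + totalMass (fun x => h (∑ k ∈ Finset.range J, expandedTimes z k + x))
          (stepPoints^[J] z) := by
  induction J generalizing h z with
  | zero => simp
  | succ J ih =>
    rw [totalMass_step h (hz 0), ih _ (stepPoints_pos hz), ← add_assoc]
    simp only [Finset.sum_range_succ' _ J, Finset.sum_range_succ' (expandedTimes z),
      expandedTimes_succ, Finset.sum_range_zero, zero_add, Function.iterate_succ_apply]
    have e0 : expandedTimes z 0 = z.1 0 := rfl
    simp only [e0, add_comm, add_assoc]

/-- The two measures are compared on A ∩ [0, n]. By divergence finitely many removals pass n, after
which neither description has an atom left there. Exhausting by n gives equality. -/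
theorem pointsOfWaitingTimes_eq_expandedTimes {z : (ℕ → ℝ≥0) × (ℕ → ℕ)} (hz : ∀ i, 1 ≤ z.2 i)
    (hV : expandedTimes z ∈ divergentTimes) :
    pointsOfWaitingTimes z.1 z.2 = pointsOfWaitingTimes (expandedTimes z) fun _ => 1 := by
  have hsum : ∀ (w : ℕ → ℝ≥0) (m : ℕ → ℕ) (A : Set ℝ≥0), MeasurableSet A →
      (Measure.sum fun i : ℕ => (m i : ℝ≥0∞) • Measure.dirac (∑ k ∈ Finset.range (i + 1), w k)) A
        = totalMass (A.indicator 1) (w, m) := fun w m A hA => by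
    rw [Measure.sum_apply _ hA]
    simp only [Measure.smul_apply, Measure.dirac_apply' _ hA, smul_eq_mul, totalMass]
  have hbdd : ∀ (A : Set ℝ≥0) (n : ℕ), totalMass ((A ∩ Iic (n : ℝ≥0)).indicator 1) z
      = totalMass ((A ∩ Iic (n : ℝ≥0)).indicator 1) (expandedTimes z, fun _ => 1) := by
    intro A n
    obtain ⟨J, hJ⟩ := hV n
    rw [totalMass_iterate _ hz J]
    have h0 : totalMass (fun x => (A ∩ Iic (n : ℝ≥0)).indicator 1
        (∑ k ∈ Finset.range J, expandedTimes z k + x)) (stepPoints^[J] z) = 0 := by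
      rw [totalMass, ENNReal.tsum_eq_zero]
      intro i
      rw [indicator_of_notMem, mul_zero]
      exact fun hmem => absurd hmem.2 (not_le.2 (hJ.trans_le le_self_add))
    rw [h0, add_zero, totalMass, tsum_eq_sum (s := Finset.range J)]
    · simp
    · intro j hj
      rw [indicator_of_notMem, mul_zero]
      have hij : J ≤ j + 1 := by
        rw [Finset.mem_range, not_lt] at hj
        omega
      exact fun hmem => absurd hmem.2 (not_le.2 (hJ.trans_le (monotone_partialSums _ hij)))
  unfold pointsOfWaitingTimes
  congr 1
  ext A hA
  have hU : A = ⋃ n : ℕ, A ∩ Iic (n : ℝ≥0) := by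
    rw [← inter_iUnion, eq_comm, inter_eq_left]
    intro x _
    obtain ⟨n, hn⟩ := exists_nat_ge x
    exact mem_iUnion.2 ⟨n, hn⟩
  have hmono : Monotone fun n : ℕ => A ∩ Iic (n : ℝ≥0) := fun i j hij =>
    inter_subset_inter_right _ (Iic_subset_Iic.2 (Nat.cast_le.2 hij))
  rw [hU, hmono.measure_iUnion, hmono.measure_iUnion]
  congr 1
  funext n
  rw [hsum _ _ _ (hA.inter measurableSet_Iic), hsum _ _ _ (hA.inter measurableSet_Iic)]
  exact hbdd A n

end Expansion


/-- The Laplace factor `e^{-s x}`. -/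
noncomputable def expFactor (s : ℕ) (x : ℝ≥0) : ℝ≥0∞ := ENNReal.ofReal (Real.exp (-(s * (x : ℝ))))

theorem measurable_expFactor (s : ℕ) : Measurable (expFactor s) :=
  ENNReal.measurable_ofReal.comp
    (Real.measurable_exp.comp (measurable_const.mul measurable_subtype_coe).neg)

theorem expFactor_zero_right (s : ℕ) : expFactor s 0 = 1 := by simp [expFactor]

/-- The joint Laplace factor of the first `k` terms. -/
noncomputable def expProd (s : ℕ → ℕ) (k : ℕ) (v : ℕ → ℝ≥0) : ℝ≥0∞ :=
  ∏ i ∈ Finset.range k, expFactor (s i) (v i)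

theorem measurable_expProd (s : ℕ → ℕ) (k : ℕ) : Measurable (expProd s k) :=
  Finset.measurable_fun_prod _ fun i _ => (measurable_expFactor (s i)).comp (measurable_pi_apply i)

/-- Allows the recursions to be done with extended nonnegative integrals, where no integrability has
to be checked. -/
theorem integral_prod_exp {Ω : Type*} [MeasurableSpace Ω] {P : Measure Ω} {V : Ω → ℕ → ℝ≥0}
    (hV : Measurable V) (s : ℕ → ℕ) (k : ℕ) :
    ∫ ω, ∏ i ∈ Finset.range k, Real.exp (-(s i * (V ω i : ℝ))) ∂P
      = (∫⁻ ω, expProd s k (V ω) ∂P).toReal := by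
  have hVi : ∀ i, Measurable fun ω => (V ω i : ℝ) := fun i =>
    measurable_subtype_coe.comp ((measurable_pi_apply i).comp hV)
  have hm : Measurable fun ω => ∏ i ∈ Finset.range k, Real.exp (-(s i * (V ω i : ℝ))) :=
    Finset.measurable_fun_prod _ fun i _ =>
      Real.measurable_exp.comp (measurable_const.mul (hVi i)).neg
  rw [integral_eq_lintegral_of_nonneg_ae
    (ae_of_all _ fun ω => Finset.prod_nonneg fun i _ => (Real.exp_pos _).le)
    hm.aestronglyMeasurable]
  congr 2
  funext ω
  rw [expProd, ENNReal.ofReal_prod_of_nonneg fun i _ => (Real.exp_pos _).le]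
  rfl

theorem lintegral_expFactor {η : Measure ℝ≥0} [IsProbabilityMeasure η] (s : ℕ) :
    ∫⁻ x, expFactor s x ∂η = ENNReal.ofReal (∫ x : ℝ≥0, Real.exp (-(s * (x : ℝ))) ∂η) := by
  have hm : Measurable fun x : ℝ≥0 => Real.exp (-(s * (x : ℝ))) :=
    Real.measurable_exp.comp (measurable_const.mul measurable_subtype_coe).neg
  rw [ofReal_integral_eq_lintegral_ofReal _ (ae_of_all _ fun x => (Real.exp_pos _).le)]
  · rfl
  · refine Integrable.of_bound (C := 1) hm.aestronglyMeasurable (ae_of_all _ fun x => ?_)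
    rw [Real.norm_of_nonneg (Real.exp_pos _).le]
    exact Real.exp_le_one_iff.2 (neg_nonpos.2 (by positivity))

theorem lintegral_const_mul_add {Ω : Type*} [MeasurableSpace Ω] {P : Measure Ω}
    {φ ψ : Ω → ℝ≥0∞} (hφ : Measurable φ) (hψ : Measurable ψ) (c p q : ℝ≥0∞) :
    ∫⁻ ω, c * (p * φ ω + q * ψ ω) ∂P = c * (p * ∫⁻ ω, φ ω ∂P + q * ∫⁻ ω, ψ ω ∂P) := by
  have h : Measurable fun ω => p * φ ω + q * ψ ω := (hφ.const_mul p).add (hψ.const_mul q)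
  rw [lintegral_const_mul _ h, lintegral_add_left (hφ.const_mul p), lintegral_const_mul _ hφ,
    lintegral_const_mul _ hψ]

/-! ### Laplace transforms of the expanded waiting times -/

section Compound

variable {θ : unitInterval} (hθ : 0 < θ)

include hθ in
-- With probability θ the first atom is simple, and the rest starts afresh with w. With probability
-- 1 - θ it is multiple; the next waiting time is then 0 and the remaining multiplicity is again
-- geometric.
theorem lintegral_expProd_step (s : ℕ → ℕ) (k : ℕ) (x : ℝ≥0) (w : ℕ → ℝ≥0) :
    ∫⁻ m, expProd s (k + 1) (expandedTimes (consSeq x w, m))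
        ∂(Measure.infinitePi fun _ : ℕ => (positiveGeometric θ : Measure ℕ))
      = expFactor (s 0) x * (ENNReal.ofReal θ *
          ∫⁻ m, expProd (fun i => s (i + 1)) k (expandedTimes (w, m))
            ∂(Measure.infinitePi fun _ : ℕ => (positiveGeometric θ : Measure ℕ))
        + ENNReal.ofReal (1 - θ) *
          ∫⁻ m, expProd (fun i => s (i + 1)) k (expandedTimes (consSeq 0 w, m))
            ∂(Measure.infinitePi fun _ : ℕ => (positiveGeometric θ : Measure ℕ))) := by
  have hm : ∀ (t : ℕ → ℕ) (l : ℕ) (v : ℕ → ℝ≥0),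
      Measurable fun m : ℕ → ℕ => expProd t l (expandedTimes (v, m)) := fun t l v =>
    (measurable_expProd t l).comp (measurable_expandedTimes.comp measurable_prodMk_left)
  have hstep : ∀ m : ℕ → ℕ, expProd s (k + 1) (expandedTimes (consSeq x w, m))
      = expFactor (s 0) x
        * expProd (fun i => s (i + 1)) k (expandedTimes (stepPoints (consSeq x w, m))) := fun m => by
    rw [expProd, Finset.prod_range_succ', mul_comm]
    rfl
  have hm' : Measurable fun m : ℕ → ℕ =>
      expProd (fun i => s (i + 1)) k (expandedTimes (stepPoints (consSeq x w, m))) :=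
    (measurable_expProd _ k).comp (measurable_expandedTimes.comp
      (measurable_stepPoints.comp measurable_prodMk_left))
  simp only [hstep]
  rw [lintegral_const_mul _ hm', lintegral_infinitePi_consSeq _ hm',
    lintegral_positiveGeometric hθ]
  congr 3
  rw [lintegral_infinitePi_consSeq _ (hm _ k (consSeq 0 w))]
  refine lintegral_congr_ae ?_
  -- Positivity of j is what places multiplicity j + 1 in the branch of `stepPoints` that keeps the
  -- atom.
  filter_upwards [ae_positiveGeometric θ] with j hj
  have hs : ∀ m : ℕ → ℕ, stepPoints (consSeq x w, consSeq (j + 1) m)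
      = (consSeq 0 w, consSeq j m) := fun m => by
    have : ¬ j + 1 ≤ 1 := by omega
    simp [stepPoints, consSeq]
    omega
  simp only [hs]

variable (H : Measure ℝ≥0) [IsProbabilityMeasure H]

theorem measurable_lintegral_expProd (s : ℕ → ℕ) (k : ℕ) :
    Measurable fun w : ℕ → ℝ≥0 => ∫⁻ m, expProd s k (expandedTimes (w, m))
      ∂(Measure.infinitePi fun _ : ℕ => (positiveGeometric θ : Measure ℕ)) :=
  Measurable.lintegral_prod_right' ((measurable_expProd s k).comp measurable_expandedTimes)

/-- The Laplace transform of the expanded waiting times, when the first one has law `η`. -/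
noncomputable def delayedLaplace (θ : unitInterval) (H η : Measure ℝ≥0) (s : ℕ → ℕ) (k : ℕ) :
    ℝ≥0∞ :=
  ∫⁻ x, ∫⁻ w, ∫⁻ m, expProd s k (expandedTimes (consSeq x w, m))
    ∂(Measure.infinitePi fun _ : ℕ => (positiveGeometric θ : Measure ℕ))
    ∂(Measure.infinitePi fun _ : ℕ => H) ∂η

theorem delayedLaplace_self (s : ℕ → ℕ) (k : ℕ) :
    delayedLaplace θ H H s k = ∫⁻ w, ∫⁻ m, expProd s k (expandedTimes (w, m))
      ∂(Measure.infinitePi fun _ : ℕ => (positiveGeometric θ : Measure ℕ))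
      ∂(Measure.infinitePi fun _ : ℕ => H) :=
  (lintegral_infinitePi_consSeq H (measurable_lintegral_expProd s k)).symm

include hθ in
theorem delayedLaplace_succ (η : Measure ℝ≥0) (s : ℕ → ℕ) (k : ℕ) :
    delayedLaplace θ H η s (k + 1) = (∫⁻ x, expFactor (s 0) x ∂η) *
      (ENNReal.ofReal θ * delayedLaplace θ H H (fun i => s (i + 1)) k
        + ENNReal.ofReal (1 - θ) * delayedLaplace θ H (Measure.dirac 0) (fun i => s (i + 1)) k) := by
  have h1 := measurable_lintegral_expProd (θ := θ) (fun i => s (i + 1)) k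
  have h2 := h1.comp (measurable_consSeq.comp (measurable_prodMk_left (x := (0 : ℝ≥0))))
  rw [delayedLaplace, delayedLaplace_self, delayedLaplace, lintegral_dirac]
  simp only [lintegral_expProd_step hθ]
  have h3 := fun x => lintegral_const_mul_add (P := Measure.infinitePi fun _ : ℕ => H) h1 h2
    (expFactor (s 0) x) (ENNReal.ofReal θ) (ENNReal.ofReal (1 - θ))
  simp only [Function.comp_def] at h3
  simp only [h3]
  rw [lintegral_mul_const _ (measurable_expFactor _)]

include hθ in
-- The mixture of a fresh start and a delay 0 satisfies a closed recursion: after one step the same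
-- mixture appears, multiplied by θ Ĥ(s) + (1-θ), since the transform of δ₀ is 1.
theorem delayedLaplace_mixture (s : ℕ → ℕ) (k : ℕ) :
    ENNReal.ofReal θ * delayedLaplace θ H H s k
        + ENNReal.ofReal (1 - θ) * delayedLaplace θ H (Measure.dirac 0) s k
      = ∏ i ∈ Finset.range k,
        (ENNReal.ofReal θ * ∫⁻ x, expFactor (s i) x ∂H + ENNReal.ofReal (1 - θ)) := by
  induction k generalizing s with
  | zero =>
    rw [Finset.prod_range_zero]
    simp only [delayedLaplace, expProd, Finset.prod_range_zero, lintegral_const, measure_univ,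
      mul_one]
    rw [← ENNReal.ofReal_add θ.2.1 (sub_nonneg.2 θ.2.2)]
    simp
  | succ k ih =>
    rw [delayedLaplace_succ hθ, delayedLaplace_succ hθ, ih, Finset.prod_range_succ',
      lintegral_dirac, expFactor_zero_right]
    ring

include hθ in
/-- The joint Laplace transform of the waiting times of a compound renewal process. -/
theorem lintegral_expProd_expandedTimes (s : ℕ → ℕ) (k : ℕ) :
    ∫⁻ z, expProd s (k + 1) (expandedTimes z) ∂((Measure.infinitePi fun _ : ℕ => H).prod
        (Measure.infinitePi fun _ : ℕ => (positiveGeometric θ : Measure ℕ)))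
      = (∫⁻ x, expFactor (s 0) x ∂H) * ∏ i ∈ Finset.range k,
        (ENNReal.ofReal θ * ∫⁻ x, expFactor (s (i + 1)) x ∂H + ENNReal.ofReal (1 - θ)) := by
  rw [lintegral_prod (fun z => expProd s (k + 1) (expandedTimes z))
    ((measurable_expProd s (k + 1)).comp measurable_expandedTimes).aemeasurable]
  rw [← delayedLaplace_mixture hθ H fun i => s (i + 1), ← delayedLaplace_succ hθ,
    delayedLaplace_self]

end Compound


/-- A law on `[0, ∞)` is obtained as a limit of laws on the compactification `[0, ∞]`, which is
identified with the unit interval. -/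
theorem exists_isMittagLeffler_of_tendsto {α lam : ℝ} (hα : 0 < α) (hlam : 0 < lam)
    {ρ : ℕ → ProbabilityMeasure unitInterval}
    (h : ∀ s : ℝ, 0 < s → Tendsto (fun n => ∫ u, (u : ℝ) ^ s ∂(ρ n : Measure unitInterval)) atTop
      (𝓝 (fracLaplace α lam s))) :
    ∃ H : ProbabilityMeasure ℝ≥0, IsMittagLeffler α lam H := by
  have hcont : ∀ s : ℝ, 0 < s → Continuous fun u : unitInterval => (u : ℝ) ^ s := fun s hs =>
    continuous_subtype_val.rpow_const fun _ => Or.inr hs.le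
  -- Probability measures on the unit interval form a compact space, and an ultrafilter limit makes
  -- the choice of a subsequence unnecessary.
  obtain ⟨κ, hκ⟩ : ∃ κ, Tendsto ρ (hyperfilter ℕ : Filter ℕ) (𝓝 κ) :=
    ⟨_, ((hyperfilter ℕ).map ρ).le_nhds_lim⟩
  have hmom : ∀ s : ℝ, 0 < s →
      ∫ u, (u : ℝ) ^ s ∂(κ : Measure unitInterval) = fracLaplace α lam s := by
    intro s hs
    refine tendsto_nhds_unique (f := fun n => ∫ u, (u : ℝ) ^ s ∂(ρ n : Measure unitInterval)) ?_
      ((h s hs).mono_left Nat.hyperfilter_le_atTop)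
    exact ProbabilityMeasure.tendsto_iff_forall_integral_tendsto.1 hκ
      (BoundedContinuousFunction.mkOfCompact ⟨_, hcont s hs⟩)
  have hpow1 : ∀ (s : ℝ), 0 ≤ s → ∀ u : unitInterval, (u : ℝ) ^ s ≤ 1 := fun s hs u =>
    Real.rpow_le_one u.2.1 u.2.2 hs
  -- The point u = 0 stands for x = ∞. Since u^s is at most the indicator of u ≠ 0, letting s → 0
  -- shows that no mass escapes to infinity, because the limit transform tends to 1.
  have hne : ∀ᵐ u ∂(κ : Measure unitInterval), u ≠ 0 := by
    have hle : ∀ s : ℝ, 0 < s → fracLaplace α lam s ≤ (κ : Measure unitInterval).real {0}ᶜ := by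
      intro s hs
      rw [← hmom s hs, ← mul_one ((κ : Measure unitInterval).real _), ← smul_eq_mul,
        ← integral_indicator_const _ (measurableSet_singleton (0 : unitInterval)).compl]
      refine integral_mono ?_ ((integrable_const _).indicator
        (measurableSet_singleton (0 : unitInterval)).compl) fun u => ?_
      · refine Integrable.of_bound (C := 1) (hcont s hs).aestronglyMeasurable
          (ae_of_all _ fun u => ?_)
        rw [Real.norm_of_nonneg (Real.rpow_nonneg u.2.1 s)]
        exact hpow1 s hs.le u
      · by_cases hu : u = 0
        · simp [hu, Real.zero_rpow hs.ne']
        · rw [indicator_of_mem (by simpa using hu)]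
          exact hpow1 s hs.le u
    have h1 : 1 ≤ (κ : Measure unitInterval).real {0}ᶜ :=
      le_of_tendsto ((continuousAt_fracLaplace_zero hα hlam).mono_left nhdsWithin_le_nhds)
        (eventually_nhdsWithin_of_forall (s := Ioi 0) fun s hs => hle s hs)
    have h0 : (κ : Measure unitInterval).real {0} = 0 := by
      have := probReal_add_probReal_compl (μ := (κ : Measure unitInterval))
        (measurableSet_singleton (0 : unitInterval))
      linarith [measureReal_nonneg (μ := (κ : Measure unitInterval)) (s := {0})]
    exact measure_eq_zero_iff_ae_notMem.1 ((measureReal_eq_zero_iff).1 h0)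
  let ℓ : unitInterval → ℝ≥0 := fun u => (-Real.log u).toNNReal
  have hℓ : Measurable ℓ :=
    measurable_real_toNNReal.comp (Real.measurable_log.comp measurable_subtype_coe).neg
  refine ⟨⟨(κ : Measure unitInterval).map ℓ, Measure.isProbabilityMeasure_map hℓ.aemeasurable⟩,
    fun s hs => ?_⟩
  have hexp : Measurable fun x : ℝ≥0 => Real.exp (-(s * (x : ℝ))) :=
    Real.measurable_exp.comp (measurable_const.mul measurable_subtype_coe).neg
  rw [ProbabilityMeasure.coe_mk, integral_map hℓ.aemeasurable hexp.aestronglyMeasurable]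
  have hae : ∀ᵐ u ∂(κ : Measure unitInterval), Real.exp (-(s * (ℓ u : ℝ))) = (u : ℝ) ^ s := by
    filter_upwards [hne] with u hu
    have hu0 : 0 < (u : ℝ) := lt_of_le_of_ne u.2.1 fun h => hu (Subtype.ext h.symm)
    rw [Real.coe_toNNReal _ (neg_nonneg.2 (Real.log_nonpos u.2.1 u.2.2)), mul_neg, neg_neg,
      Real.rpow_def_of_pos hu0, mul_comm]
  rw [integral_congr_ae hae]
  rcases hs.eq_or_lt with rfl | hs
  · simp [Real.zero_rpow hα.ne', hlam.ne']
  · exact hmom s hs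

theorem isProbabilityMeasure_withDensity_ofReal {X : Type*} [MeasurableSpace X] {μ : Measure X}
    {f : X → ℝ} (hf : Integrable f μ) (hf0 : 0 ≤ᵐ[μ] f) (hf1 : ∫ x, f x ∂μ = 1) :
    IsProbabilityMeasure (μ.withDensity fun x => ENNReal.ofReal (f x)) :=
  ⟨by rw [withDensity_apply _ MeasurableSet.univ, setLIntegral_univ,
    ← ofReal_integral_eq_lintegral_ofReal hf hf0, hf1, ENNReal.ofReal_one]⟩

theorem integral_withDensity_ofReal {X : Type*} [MeasurableSpace X] {μ : Measure X}
    {f : X → ℝ} (hf : Integrable f μ) (hf0 : 0 ≤ᵐ[μ] f) (φ : X → ℝ) :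
    ∫ x, φ x ∂(μ.withDensity fun x => ENNReal.ofReal (f x)) = ∫ x, f x * φ x ∂μ := by
  rw [integral_withDensity_eq_integral_toReal_smul₀
    hf.aestronglyMeasurable.aemeasurable.ennreal_ofReal (ae_of_all _ fun _ => ENNReal.ofReal_lt_top)]
  refine integral_congr_ae ?_
  filter_upwards [hf0] with x hx
  simp only [ENNReal.toReal_ofReal hx, smul_eq_mul]

namespace AssumptionsFor

variable {X : Type*} [MeasurableSpace X] {μ : Measure X} {T : X → X}
  {B : ℕ → Set X} {a : ℕ → ℝ≥0} {b : ℝ≥0 → ℝ≥0} {α θ : ℝ} {Y : Set X} {U Q : ℕ → Set X}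
  {τ : ℕ → X → ℕ} {𝒰 : Set (Lp ℝ 1 μ)}

open Classical in
-- The laws of exp(-γₙ r) under f dμ have as s-th moments the hitting functionals with g = 1, which
-- converge to the required transform. The rare events thus show that the law exists, and the choice
-- made in `mittagLeffler` is a genuine one.
theorem isMittagLeffler [SigmaFinite μ] (hT : IsCEMPT μ T)
    (hab : IsAsymptoticInverse a b) (hB : IsRareSequence μ B) (hα₀ : 0 < α) (hα₁ : α ≤ 1)
    (h : AssumptionsFor μ T α θ a b B Y U Q τ 𝒰) (hθ : 0 < θ) :
    IsMittagLeffler α (θ * Real.Gamma (1 + α)) (mittagLeffler α (θ * Real.Gamma (1 + α))) := by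
  have hTm := hT.measurePreserving.measurable
  obtain ⟨f, hf, hf0, hf1, hlim⟩ := h.exists_tendsto_hitting hT hab hB hα₀ hα₁ hθ
  have hlam : 0 < θ * Real.Gamma (1 + α) := mul_pos hθ (Real.Gamma_pos_of_pos (by linarith))
  refine Classical.epsilon_spec (exists_isMittagLeffler_of_tendsto hα₀ hlam
    (ρ := fun n => ?_) fun s hs => ?_)
  · have := isProbabilityMeasure_withDensity_ofReal hf hf0 hf1
    refine ⟨(μ.withDensity fun x => ENNReal.ofReal (f x)).map fun x =>
      if returnTime T (B n) 1 x = ⊤ then 0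
      else expNeg (scaling b (μ (B n)).toNNReal * (returnTime T (B n) 1 x).toNat),
      Measure.isProbabilityMeasure_map (Measurable.aemeasurable ?_)⟩
    exact (measurable_of_countable fun r : ℕ∞ => if r = ⊤ then (0 : unitInterval)
      else expNeg (scaling b (μ (B n)).toNNReal * r.toNat)).comp
        (measurable_returnTime hTm (hB.measurableSet n) 1)
  · have h1 := hlim s hs.le (fun _ _ => 1) (fun _ => measurable_const) (fun _ _ => zero_le_one)
      fun _ _ => le_rfl
    have h2 := h1.add_const (fracLaplace α (θ * Real.Gamma (1 + α)) s)
    rw [zero_add] at h2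
    refine h2.congr' ?_
    filter_upwards [hB.eventually_real_pos] with n hn
    have hone : (∫ x in B n, (1 : ℝ) ∂μ) / μ.real (B n) = 1 := by
      rw [setIntegral_const, smul_eq_mul, mul_one, div_self hn.ne']
    have hmeas : Measurable fun x => if returnTime T (B n) 1 x = ⊤ then (0 : unitInterval)
        else expNeg (scaling b (μ (B n)).toNNReal * (returnTime T (B n) 1 x).toNat) :=
      (measurable_of_countable fun r : ℕ∞ => if r = ⊤ then (0 : unitInterval)
        else expNeg (scaling b (μ (B n)).toNNReal * r.toNat)).comp
        (measurable_returnTime hTm (hB.measurableSet n) 1)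
    rw [hone, mul_one, sub_add_cancel, ProbabilityMeasure.coe_mk,
      integral_map hmeas.aemeasurable
        (measurable_subtype_coe.pow_const s).aestronglyMeasurable, integral_withDensity_ofReal hf hf0]
    congr 1
    funext x
    congr 1
    unfold discounted
    split_ifs with htop
    · exact (Real.zero_rpow hs.ne').symm
    · rw [mul_one, expNeg, ← Real.exp_mul]
      push_cast
      ring_nf

end AssumptionsFor


/-! ### Limit laws expressed through almost surely divergent waiting times -/

section Limits

theorem measurable_fun_renewalPoints {Ω : Type*} [MeasurableSpace Ω] {V : Ω → ℕ → ℝ≥0}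
    (hV : Measurable V) : Measurable fun ω => renewalPoints (V ω) :=
  measurable_renewalPoints.comp hV

/-- Geometric decay in k of the transforms of the partial sums, at parameter 1, is enough for
divergence. -/
theorem ae_mem_divergentTimes_of_eq {Ω : Type*} [MeasurableSpace Ω] {P : Measure Ω}
    [IsFiniteMeasure P] {V : Ω → ℕ → ℝ≥0} (hV : Measurable V) {c r : ℝ} (hr0 : 0 ≤ r) (hr1 : r < 1)
    (h : ∀ k, ∫ ω, ∏ i ∈ Finset.range (k + 1), Real.exp (-((1 : ℕ) * (V ω i : ℝ))) ∂P = c * r ^ k) :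
    ∀ᵐ ω ∂P, V ω ∈ divergentTimes := by
  refine ae_mem_divergentTimes hV ?_
  have := (tendsto_pow_atTop_nhds_zero_of_lt_one hr0 hr1).const_mul c
  rw [mul_zero] at this
  refine this.congr fun k => ?_
  rw [← h]
  simp

section Renewal

variable (η : ProbabilityMeasure ℝ≥0) {φ : ℕ → ℝ}
  (hφ : ∀ s : ℕ, ∫ x : ℝ≥0, Real.exp (-(s * (x : ℝ))) ∂(η : Measure ℝ≥0) = φ s)

include hφ

theorem integral_prod_exp_infinitePi (k : ℕ) (s : ℕ → ℕ) :
    ∫ w, ∏ i ∈ Finset.range k, Real.exp (-(s i * (w i : ℝ)))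
      ∂(Measure.infinitePi fun _ : ℕ => (η : Measure ℝ≥0)) = ∏ i ∈ Finset.range k, φ (s i) := by
  rw [integral_prod_exp (V := fun w => w) measurable_id]
  simp only [expProd]
  rw [lintegral_prod_infinitePi (η : Measure ℝ≥0) (φ := fun i => expFactor (s i))
    fun i => measurable_expFactor (s i), ENNReal.toReal_prod]
  refine Finset.prod_congr rfl fun i _ => ?_
  rw [lintegral_expFactor, ENNReal.toReal_ofReal (integral_nonneg fun x => (Real.exp_pos _).le), hφ]

theorem ae_mem_divergentTimes_infinitePi (hφ1 : φ 1 < 1) :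
    ∀ᵐ w ∂(Measure.infinitePi fun _ : ℕ => (η : Measure ℝ≥0)), w ∈ divergentTimes := by
  have hφ0 : 0 ≤ φ 1 := by
    rw [← hφ]
    exact integral_nonneg fun x => (Real.exp_pos _).le
  refine ae_mem_divergentTimes_of_eq measurable_id (c := φ 1) hφ0 hφ1 fun k => ?_
  have := integral_prod_exp_infinitePi η hφ (k + 1) fun _ => 1
  rw [Finset.prod_const, Finset.card_range, pow_succ'] at this
  exact this

/-- The map that defines the process agrees almost surely with the globally measurable
`renewalPoints`, which makes the change of variables legitimate. -/
theorem integral_RPP (hφ1 : φ 1 < 1) (F : AtomicRadon →ᵇ ℝ) :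
    ∫ z, F z ∂(RPP η) = ∫ w, F (renewalPoints w)
      ∂(Measure.infinitePi fun _ : ℕ => (η : Measure ℝ≥0)) := by
  have h : (fun w : ℕ → ℝ≥0 => pointsOfWaitingTimes w fun _ => 1)
      =ᵐ[Measure.infinitePi fun _ : ℕ => (η : Measure ℝ≥0)] renewalPoints := by
    filter_upwards [ae_mem_divergentTimes_infinitePi η hφ hφ1] with w hw
    exact (renewalPoints_eq hw).symm
  rw [RPP, Measure.map_congr h, integral_map measurable_renewalPoints.aemeasurable
    F.continuous.measurable.aestronglyMeasurable]

end Renewal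

section Compound

variable {θ : unitInterval} (hθ : 0 < θ) (H : ProbabilityMeasure ℝ≥0) {φ : ℕ → ℝ}
  (hφ : ∀ s : ℕ, ∫ x : ℝ≥0, Real.exp (-(s * (x : ℝ))) ∂(H : Measure ℝ≥0) = φ s)

include hθ hφ

theorem integral_prod_exp_expandedTimes (k : ℕ) (s : ℕ → ℕ) :
    ∫ z, ∏ i ∈ Finset.range (k + 1), Real.exp (-(s i * (expandedTimes z i : ℝ)))
      ∂((Measure.infinitePi fun _ : ℕ => (H : Measure ℝ≥0)).prod
        (Measure.infinitePi fun _ : ℕ => (positiveGeometric θ : Measure ℕ)))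
      = φ (s 0) * ∏ i ∈ Finset.range k, ((1 - θ) + θ * φ (s (i + 1))) := by
  have hφ0 : ∀ s, 0 ≤ φ s := fun s => by
    rw [← hφ]
    exact integral_nonneg fun x => (Real.exp_pos _).le
  rw [integral_prod_exp measurable_expandedTimes, lintegral_expProd_expandedTimes hθ,
    ENNReal.toReal_mul, ENNReal.toReal_prod]
  simp only [lintegral_expFactor, hφ]
  rw [ENNReal.toReal_ofReal (hφ0 _)]
  congr 1
  refine Finset.prod_congr rfl fun i _ => ?_
  rw [← ENNReal.ofReal_mul θ.2.1, ENNReal.toReal_add ENNReal.ofReal_ne_top ENNReal.ofReal_ne_top,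
    ENNReal.toReal_ofReal (mul_nonneg θ.2.1 (hφ0 _)),
    ENNReal.toReal_ofReal (sub_nonneg.2 θ.2.2), add_comm]

theorem ae_expandedTimes_mem_divergentTimes (hφ1 : φ 1 < 1) :
    ∀ᵐ z ∂((Measure.infinitePi fun _ : ℕ => (H : Measure ℝ≥0)).prod
        (Measure.infinitePi fun _ : ℕ => (positiveGeometric θ : Measure ℕ))),
      expandedTimes z ∈ divergentTimes := by
  have hφ0 : 0 ≤ φ 1 := by
    rw [← hφ]
    exact integral_nonneg fun x => (Real.exp_pos _).le
  have hθ0 : (0 : ℝ) < θ := hθ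
  have hθ1 : (θ : ℝ) ≤ 1 := θ.2.2
  refine ae_mem_divergentTimes_of_eq measurable_expandedTimes (c := φ 1)
    (r := (1 - θ) + θ * φ 1) (by nlinarith) (by nlinarith) fun k => ?_
  have := integral_prod_exp_expandedTimes hθ H hφ k fun _ => 1
  rw [Finset.prod_const, Finset.card_range] at this
  exact this

/-- Almost surely all multiplicities are positive and the expanded waiting times diverge, so the
compound process is the simple list of the expanded points. -/
theorem integral_compoundRPP (hφ1 : φ 1 < 1) (F : AtomicRadon →ᵇ ℝ) :
    ∫ z, F z ∂(compoundRPP H (positiveGeometric θ)) = ∫ z, F (renewalPoints (expandedTimes z))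
      ∂((Measure.infinitePi fun _ : ℕ => (H : Measure ℝ≥0)).prod
        (Measure.infinitePi fun _ : ℕ => (positiveGeometric θ : Measure ℕ))) := by
  have hpos : ∀ᵐ m ∂(Measure.infinitePi fun _ : ℕ => (positiveGeometric θ : Measure ℕ)),
      ∀ i, 1 ≤ m i := ae_all_iff.2 fun i =>
    (measurePreserving_eval_infinitePi (fun _ : ℕ => (positiveGeometric θ : Measure ℕ))
      i).quasiMeasurePreserving.ae (ae_positiveGeometric θ)
  have hpos' : ∀ᵐ z ∂((Measure.infinitePi fun _ : ℕ => (H : Measure ℝ≥0)).prod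
        (Measure.infinitePi fun _ : ℕ => (positiveGeometric θ : Measure ℕ))),
      ∀ i, 1 ≤ z.2 i := Measure.quasiMeasurePreserving_snd.ae hpos
  have h : (fun p : (ℕ → ℝ≥0) × (ℕ → ℕ) => pointsOfWaitingTimes p.1 p.2)
      =ᵐ[(Measure.infinitePi fun _ : ℕ => (H : Measure ℝ≥0)).prod
        (Measure.infinitePi fun _ : ℕ => (positiveGeometric θ : Measure ℕ))]
      fun z => renewalPoints (expandedTimes z) := by
    filter_upwards [ae_expandedTimes_mem_divergentTimes hθ H hφ hφ1, hpos'] with z hz hzpos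
    rw [renewalPoints_eq hz, pointsOfWaitingTimes_eq_expandedTimes hzpos hz]
  rw [compoundRPP, Measure.map_congr h,
    integral_map (measurable_fun_renewalPoints measurable_expandedTimes).aemeasurable
    F.continuous.measurable.aestronglyMeasurable]

end Compound

end Limits

theorem integral_exp_waitingLaw {α lam : ℝ} {θ : unitInterval}
    (h : IsMittagLeffler α lam (mittagLeffler α lam)) (s : ℕ) :
    ∫ x : ℝ≥0, Real.exp (-(s * (x : ℝ))) ∂(waitingLaw α lam θ : Measure ℝ≥0)
      = (1 - θ) + θ * fracLaplace α lam s := by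
  have hexp : Measurable fun x : ℝ≥0 => Real.exp (-(s * (x : ℝ))) :=
    Real.measurable_exp.comp (measurable_const.mul measurable_subtype_coe).neg
  have hi : ∀ κ : Measure ℝ≥0, IsFiniteMeasure κ →
      Integrable (fun x : ℝ≥0 => Real.exp (-(s * (x : ℝ)))) κ := fun κ _ =>
    Integrable.of_bound (C := 1) hexp.aestronglyMeasurable (ae_of_all _ fun x => by
      rw [Real.norm_of_nonneg (Real.exp_pos _).le]
      exact Real.exp_le_one_iff.2 (neg_nonpos.2 (by positivity)))
  have e : (waitingLaw α lam θ : Measure ℝ≥0) = ENNReal.ofReal (1 - θ) • Measure.dirac 0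
      + ENNReal.ofReal θ • (mittagLeffler α lam : Measure ℝ≥0) := rfl
  rw [e, integral_add_measure ((hi _ inferInstance).smul_measure ENNReal.ofReal_ne_top)
    ((hi _ inferInstance).smul_measure ENNReal.ofReal_ne_top), integral_smul_measure,
    integral_smul_measure, integral_dirac, h s (Nat.cast_nonneg _),
    ENNReal.toReal_ofReal (sub_nonneg.2 θ.2.2), ENNReal.toReal_ofReal θ.2.1]
  simp [fracLaplace]

/-! ### Convergence of the rare event point processes -/

section Convergence

variable {X : Type*} [MeasurableSpace X] {μ : Measure X} [SigmaFinite μ] {T : X → X}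
  {B : ℕ → Set X} {a : ℕ → ℝ≥0} {b : ℝ≥0 → ℝ≥0}

theorem IsCEMPT.aemeasurable_REPP (hT : IsCEMPT μ T) (hB : IsRareSequence μ B) {ν : Measure X}
    (hν : ν ≪ μ) (γ : ℝ≥0 → ℝ≥0) (n : ℕ) : AEMeasurable (REPP μ T γ (B n)) ν :=
  RareEvents.aemeasurable_REPP hT.measurePreserving.measurable (hB.measurableSet n)
    (hν.ae_le (hT.ae_frequently_visit (hB.measurableSet n) (hB.measure_ne_zero n))) γ

/-- Positive scaling and unit total mass hold only for large n, whereas the continuous mapping lemma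
asks for them at every index; hence the shift by N. -/
theorem IsCEMPT.tendsto_integral_REPP (hT : IsCEMPT μ T)
    (hab : IsAsymptoticInverse a b) (hB : IsRareSequence μ B) {P : ℕ → Measure X}
    (hP : ∀ᶠ n in atTop, IsProbabilityMeasure (P n)) (hPμ : ∀ n, P n ≪ μ) {Ω : Type*}
    [MeasurableSpace Ω] {P' : Measure Ω} [IsProbabilityMeasure P'] {V : Ω → ℕ → ℝ≥0}
    (hV : Measurable V) (hVG : ∀ᵐ ω ∂P', V ω ∈ divergentTimes)
    (hlap : ∀ (k : ℕ) (s : ℕ → ℕ), Tendsto (fun n =>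
      ∫ x, discountedProd T (B n) (scaling b (μ (B n)).toNNReal) (k + 1) s x ∂P n) atTop
      (𝓝 (∫ ω, ∏ i ∈ Finset.range (k + 1), Real.exp (-(s i * (V ω i : ℝ))) ∂P')))
    (F : AtomicRadon →ᵇ ℝ) :
    Tendsto (fun n => ∫ x, F (REPP μ T (scaling b) (B n) x) ∂P n) atTop
      (𝓝 (∫ ω, F (renewalPoints (V ω)) ∂P')) := by
  have hTm := hT.measurePreserving.measurable
  obtain ⟨N, hN⟩ := eventually_atTop.1 (hP.and (hB.eventually_scaling_pos hab))
  have hvisit : ∀ n, ∀ᵐ x ∂P n, ∀ m, ∃ k, m < k ∧ T^[k] x ∈ B n := fun n =>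
    (hPμ n).ae_le (hT.ae_frequently_visit (hB.measurableSet n) (hB.measure_ne_zero n))
  have hprob : ∀ n, IsProbabilityMeasure (P (n + N)) := fun n => (hN _ (Nat.le_add_left _ _)).1
  have hpos : ∀ n, 0 < scaling b (μ (B (n + N))).toNNReal := fun n =>
    (hN _ (Nat.le_add_left _ _)).2
  rw [← tendsto_add_atTop_iff_nat N]
  refine (tendsto_integral_of_tendsto_laplace (P := fun n => P (n + N))
    (W := fun n => waitingTime T (B (n + N)) (scaling b (μ (B (n + N))).toNNReal))
    (fun n => measurable_waitingTime hTm (hB.measurableSet _) _) hV measurable_renewalPoints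
    continuousOn_renewalPoints (fun n => ?_) hVG (fun k s => ?_) F).congr fun n => ?_
  · filter_upwards [hvisit (n + N)] with x hx
    exact waitingTime_mem_divergentTimes hx (hpos n)
  · refine ((tendsto_add_atTop_iff_nat N).2 (hlap k s)).congr fun n => integral_congr_ae ?_
    filter_upwards [hvisit (n + N)] with x hx
    exact discountedProd_eq hx _ _ _
  · refine integral_congr_ae ?_
    filter_upwards [hvisit (n + N)] with x hx
    rw [REPP_eq_renewalPoints hx (hpos n)]

namespace AssumptionsFor

variable {α θ : ℝ} {Y : Set X} {U Q : ℕ → Set X} {τ : ℕ → X → ℕ} {𝒰 : Set (Lp ℝ 1 μ)}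
  (hT : IsCEMPT μ T) (hab : IsAsymptoticInverse a b) (hB : IsRareSequence μ B) (hα₀ : 0 < α)
  (hα₁ : α ≤ 1) (h : AssumptionsFor μ T α θ a b B Y U Q τ 𝒰) (hθ : 0 < θ)
  {Ω : Type*} [MeasurableSpace Ω] {P' : Measure Ω} [IsProbabilityMeasure P'] {V : Ω → ℕ → ℝ≥0}
  (hV : Measurable V) (hVG : ∀ᵐ ω ∂P', V ω ∈ divergentTimes) {Λ : Measure AtomicRadon}
  (hΛ : ∀ F : AtomicRadon →ᵇ ℝ, ∫ z, F z ∂Λ = ∫ ω, F (renewalPoints (V ω)) ∂P')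

include hT hab hB hα₀ hα₁ h hθ hV hVG hΛ

/-- The density of ν with respect to μ serves as the integrable function in the hitting asymptotics,
and its integral is 1. -/
theorem convergesStronglyInLaw
    (hlap : ∀ (k : ℕ) (s : ℕ → ℕ),
      ∫ ω, ∏ i ∈ Finset.range (k + 1), Real.exp (-(s i * (V ω i : ℝ))) ∂P'
        = fracLaplace α (θ * Real.Gamma (1 + α)) (s 0)
          * ∏ i ∈ Finset.range k, returnLaplace α θ (s (i + 1))) :
    ConvergesStronglyInLaw (fun n => REPP μ T (scaling b) (B n)) μ Λ := by
  intro ν hν hac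
  refine ⟨fun n => hT.aemeasurable_REPP hB hac _ n, fun F => ?_⟩
  rw [hΛ]
  refine hT.tendsto_integral_REPP hab hB (Eventually.of_forall fun _ => hν) (fun _ => hac) hV hVG
    (fun k s => ?_) F
  have hi : Integrable (fun x => (ν.rnDeriv μ x).toReal) μ := Measure.integrable_toReal_rnDeriv
  have h1 : ∫ x, (ν.rnDeriv μ x).toReal ∂μ = 1 := by
    rw [Measure.integral_toReal_rnDeriv hac, probReal_univ]
  have h2 := h.tendsto_integral_discountedProd hT hab hB hα₀ hα₁ hθ hi k s
  rw [h1, one_mul, ← hlap k s] at h2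
  refine h2.congr fun n => ?_
  exact integral_rnDeriv_smul hac

theorem convergesInLaw_cond
    (hlap : ∀ (k : ℕ) (s : ℕ → ℕ),
      ∫ ω, ∏ i ∈ Finset.range (k + 1), Real.exp (-(s i * (V ω i : ℝ))) ∂P'
        = ∏ i ∈ Finset.range (k + 1), returnLaplace α θ (s i)) :
    ConvergesInLaw (fun n => REPP μ T (scaling b) (B n))
      (fun n => ProbabilityTheory.cond μ (B n)) Λ := by
  have hac : ∀ n, ProbabilityTheory.cond μ (B n) ≪ μ := fun n => cond_absolutelyContinuous
  refine ⟨fun n => hT.aemeasurable_REPP hB (hac n) _ n, fun F => ?_⟩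
  rw [hΛ]
  refine hT.tendsto_integral_REPP hab hB ?_ hac hV hVG (fun k s => ?_) F
  · filter_upwards [hB.eventually_lt_top] with n hn
    exact cond_isProbabilityMeasure_of_finite (hB.measure_ne_zero n) hn.ne
  · rw [hlap]
    refine (h.tendsto_average_discountedProd hT hab hB hα₀ hα₁ hθ (k + 1) s).congr fun n => ?_
    rw [integral_cond]

end AssumptionsFor

end Convergence

end RareEvents

theorem mainTheorem3 {X : Type*} [MeasurableSpace X] (μ : MeasureTheory.Measure X)
    [MeasureTheory.SigmaFinite μ] (T : X → X)
    (hT : RareEvents.IsCEMPT μ T) (hPDE : RareEvents.IsPointwiseDualErgodic μ T)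
    (hμ : μ Set.univ = ∞)
    (α : ℝ) (hα₀ : 0 < α) (hα₁ : α ≤ 1) (θ : unitInterval) (hθ : 0 < θ)
    (a : ℕ → ℝ≥0) (b : ℝ≥0 → ℝ≥0) (hab : RareEvents.IsAsymptoticInverse a b)
    (B : ℕ → Set X) (hB : RareEvents.IsRareSequence μ B)
    (hA : RareEvents.SatisfiesA μ T α θ a b B) :
    -- the Laplace transform of the Mittag-Leffler law
    RareEvents.IsMittagLeffler α (θ * Real.Gamma (1 + α))
      (RareEvents.mittagLeffler α (θ * Real.Gamma (1 + α))) ∧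
    -- the hitting process
    RareEvents.ConvergesStronglyInLaw
      (fun n => RareEvents.REPP μ T (RareEvents.scaling b) (B n)) μ
      (RareEvents.CFPP α (θ * Real.Gamma (1 + α)) (RareEvents.positiveGeometric θ)) ∧
    -- the return process
    RareEvents.ConvergesInLaw
      (fun n => RareEvents.REPP μ T (RareEvents.scaling b) (B n))
      (fun n => ProbabilityTheory.cond μ (B n))
      (RareEvents.RPP (RareEvents.waitingLaw α (θ * Real.Gamma (1 + α)) θ)) ∧
    -- the case of extremal index one
    (θ = 1 →
      RareEvents.ConvergesStronglyInLaw
        (fun n => RareEvents.REPP μ T (RareEvents.scaling b) (B n)) μ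
        (RareEvents.FPP α (Real.Gamma (1 + α))) ∧
      RareEvents.ConvergesInLaw
        (fun n => RareEvents.REPP μ T (RareEvents.scaling b) (B n))
        (fun n => ProbabilityTheory.cond μ (B n))
        (RareEvents.FPP α (Real.Gamma (1 + α)))) := by
  obtain ⟨Y, U, Q, τ, 𝒰, h⟩ := hA
  have hθ0 : (0 : ℝ) < θ := hθ
  have hΓ : 0 < Real.Gamma (1 + α) := Real.Gamma_pos_of_pos (by linarith)
  have hlam : 0 < θ * Real.Gamma (1 + α) := mul_pos hθ0 hΓ
  have hML := h.isMittagLeffler hT hab hB hα₀ hα₁ hθ0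
  have hH : ∀ s : ℕ, ∫ x : ℝ≥0, Real.exp (-(s * (x : ℝ)))
      ∂(RareEvents.mittagLeffler α (θ * Real.Gamma (1 + α)) : Measure ℝ≥0)
        = RareEvents.fracLaplace α (θ * Real.Gamma (1 + α)) s := fun s => hML s (Nat.cast_nonneg _)
  have hH1 : RareEvents.fracLaplace α (θ * Real.Gamma (1 + α)) (1 : ℕ) < 1 :=
    RareEvents.fracLaplace_lt_one hlam (by simp)
  have hW : ∀ s : ℕ, ∫ x : ℝ≥0, Real.exp (-(s * (x : ℝ)))
      ∂(RareEvents.waitingLaw α (θ * Real.Gamma (1 + α)) θ : Measure ℝ≥0)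
        = RareEvents.returnLaplace α θ s := RareEvents.integral_exp_waitingLaw hML
  have hW1 : RareEvents.returnLaplace α θ (1 : ℕ) < 1 := by
    rw [RareEvents.returnLaplace]
    nlinarith
  -- The hitting limit is realized by expanded waiting times on the product space, the return limit
  -- by an i.i.d. sequence itself. For θ = 1 the return transform equals the Mittag-Leffler one, so
  -- a single i.i.d. sequence serves both.
  refine ⟨hML, ?_, ?_, fun hθ1 => ?_⟩
  · exact h.convergesStronglyInLaw hT hab hB hα₀ hα₁ hθ0 RareEvents.measurable_expandedTimes
      (RareEvents.ae_expandedTimes_mem_divergentTimes hθ _ hH hH1)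
      (RareEvents.integral_compoundRPP hθ _ hH hH1)
      (RareEvents.integral_prod_exp_expandedTimes hθ _ hH)
  · exact h.convergesInLaw_cond hT hab hB hα₀ hα₁ hθ0 measurable_id
      (RareEvents.ae_mem_divergentTimes_infinitePi _ hW hW1) (RareEvents.integral_RPP _ hW hW1)
      fun k => RareEvents.integral_prod_exp_infinitePi _ hW (k + 1)
  · have hθ1' : (θ : ℝ) = 1 := by rw [hθ1]; rfl
    have hret : ∀ s : ℝ, RareEvents.returnLaplace α θ s
        = RareEvents.fracLaplace α (θ * Real.Gamma (1 + α)) s := fun s => by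
      rw [RareEvents.returnLaplace, hθ1', sub_self, zero_add, one_mul, one_mul]
    have hFPP : RareEvents.FPP α (Real.Gamma (1 + α))
        = RareEvents.RPP (RareEvents.mittagLeffler α (θ * Real.Gamma (1 + α))) := by
      rw [RareEvents.FPP, hθ1', one_mul]
    have hmom := RareEvents.integral_prod_exp_infinitePi _ hH
    rw [hFPP]
    constructor
    · refine h.convergesStronglyInLaw hT hab hB hα₀ hα₁ hθ0 measurable_id
        (RareEvents.ae_mem_divergentTimes_infinitePi _ hH hH1)
        (RareEvents.integral_RPP _ hH hH1) fun k s => ?_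
      simp only [hret]
      refine (hmom (k + 1) s).trans ?_
      rw [Finset.prod_range_succ', mul_comm]
    · refine h.convergesInLaw_cond hT hab hB hα₀ hα₁ hθ0 measurable_id
        (RareEvents.ae_mem_divergentTimes_infinitePi _ hH hH1)
        (RareEvents.integral_RPP _ hH hH1) fun k s => ?_
      simp only [hret]
      exact hmom (k + 1) s
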